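/- **Setting.** Let $n,k\ge 0$, $m=[n/2]$, and let $\Gamma$ be a Bieberbach group in $\mathrm{SO}(n)\ltimes\mathbb R^n$ (a discrete, cocompact, torsion-free group of orientation-preserving isometries of $\mathbb R^n$). Write $\gamma\in\Gamma$ as $\gamma=BL_b$, i.e. $\gamma x=B(x+b)$, and put $r(\gamma)=B$. Let $\Lambda=\{\lambda: L_\lambda\in\Gamma\}$, and suppose that $F=r(\Gamma)\cong\mathbb Z_2^k$. Let $n_B=\dim\ker(B-\mathrm{Id})$ and $F_1=\{B\in F: n_B=1\}$. Let $\varepsilon:\Gamma\to\mathrm{Spin}(n)$ be a homomorphism lifting $r$ through the covering $g\mapsto(v\mapsto gvg^{-1})$ (a spin structure on $M_\Gamma=\Gamma\backslash\mathbb R^n$). Let $\delta_\varepsilon:\Lambda\to\{\pm1\}$ be its restriction to $\Lambda$, let $\Lambda^*_\varepsilon=\{u\in\mathbb R^n:\ e^{2\pi i u\cdot\lambda}=\delta_\varepsilon(\lambda)\ \text{for all } \lambda\in\Lambda\}$, and $\Lambda^*_{\varepsilon,\mu}=\{u\in\Lambda_\varepsilon^*:\|u\|=\mu\}$. Let $\rho:\Gamma\to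 U(V)$ be a finite-dimensional complex unitary representation with $\rho|_\Lambda=1$, of dimension $d_\rho$ and character $\chi_\rho$. Let $(L,S)$ be an irreducible complex representation of the Clifford algebra of $\mathbb R^n$ (with relations $vw+wv=-2\langle v,w\rangle$), chosen, for odd $n$, so that $e_1\cdots e_n$ acts as $-i^{m+1}$. The Dirac operator $D_\rho f=\sum_j L(e_j)\,\partial f/\partial x_j$ acts on smooth $f:\mathbb R^n\to S\otimes V$ satisfying $f(\gamma x)=(L(\varepsilon(\gamma))\otimes\rho(\gamma))f(x)$ for all $\gamma\in\Gamma$. Let $d(t)$ be the dimension of the space of such $f$ with $D_\rho f=tf$ ($t\in\mathbb R$); put $d^\pm_{\rho,\mu}=d(\pm2\pi\mu)$ for $\mu>0$ and $d_{\rho,0}=d(0)$. The asymmetric spectrum is $\mathcal A=\{t\in\mathbb R: d(t)\ne d(-t)\}$ (non-eigenvalues having multiplicity $0$), and the spectrum is called symmetric if $\mathcal A=\emptyset$. For $\gamma=BL_b\in\Gamma$, $n=2m+1$, $u\ne0$ with $Bu=u$, and $g_m=e_1e_2\cdots e_{2m}$, let $\sigma(u,g_m)=1$ if $h\varepsilon(\gamma)h^{-1}$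 is conjugate to $g_m$ in $\mathrm{Spin}(n-1)=\{g\in \mathrm{Spin}(n): ge_ng^{-1}=e_n\}$, where $h\in\mathrm{Spin}(n)$ satisfies $huh^{-1}=\|u\|e_n$, and $\sigma(u,g_m)=-1$ otherwise. We say that $B|_\Lambda=-\delta_\varepsilon\mathrm{Id}$ *in a basis* if $\Lambda$ has a $\mathbb Z$-basis $f_1,\dots,f_n$ with $Bf_j=-\delta_\varepsilon(f_j)f_j$ for all $j$. **Theorem.** All $d(t)$, $t\in\mathbb R$, are finite, and the following hold. (i) If $F_1=\emptyset$, the spectrum is symmetric and, for every $\mu>0$, $$d^{\pm}_{\rho,\mu}=2^{m-k-1}\,d_\rho\,|\Lambda^*_{\varepsilon,\mu}|.\qquad(1)$$ (ii) If $F_1\neq\emptyset$, the spectrum is asymmetric if and only if $n=4r+3$ for some $r\ge0$ and there is $\gamma=BL_b\in\Gamma$ with $n_B=1$, $\chi_\rho(\gamma)\ne0$ and $B|_\Lambda=-\delta_\varepsilon\mathrm{Id}$ in a basis. In this case, for every such $\gamma$, there is $f$ with $\{\lambda\in\Lambda:B\lambda=\lambda\}=\mathbb Zf$, and for every such $f$: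 $f\neq 0$, $$\mathcal A=\{\pm2\pi\mu_j: j\in\mathbb N_0\},\qquad \mu_j=(j+\tfrac12)\|f\|^{-1};$$ moreover $|f\cdot 2b|=(2s+1)\|f\|^2$ for some $s\in\mathbb N_0$ and, with $\sigma_\gamma=\sigma((f\cdot2b)f,g_m)$, $$d^\pm_{\rho,\mu}=\begin{cases}2^{m-k-1}\big(d_\rho|\Lambda^*_{\varepsilon,\mu}|\pm2\sigma_\gamma(-1)^{r+j+s}\chi_\rho(\gamma)\big)&\mu=\mu_j,\\[2pt] 2^{m-k-1}d_\rho|\Lambda^*_{\varepsilon,\mu}|&\mu>0,\ \mu\ne\mu_j\text{ for all }j.\end{cases}$$ (Thus the sign is $\sigma_\gamma(-1)^{r+j}$ if $b$ is normalized modulo $\Lambda$ so that $f\cdot2b=\pm\|f\|^2$.) If the spectrum is symmetric, (1) holds for every $\mu>0$. (iii) $d_{\rho,0}=2^{m-k}d_\rho$ if $\varepsilon|_\Lambda=1$, and $d_{\rho,0}=0$ otherwise. If $k>m$, then $M_\Gamma$ has no spin structure that is trivial on $\Lambda$, hence $d_{\rho,0}=0$. If $d_\rho>0$ and $d_{\rho,0}=2^md_\rho$,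 then $\Gamma=L_\Lambda$ (so $M_\Gamma$ is a torus) and $\varepsilon=1$. -/

import Mathlib

open scoped TensorProduct ContDiff

noncomputable section

namespace FlatSpin

/-! ### Euclidean space, its Clifford algebra and the spin group -/

/-- Euclidean `n`-space. -/
abbrev E (n : ℕ) : Type := EuclideanSpace ℝ (Fin n)

/-- The quadratic form `v ↦ -‖v‖²`. -/
def negSq (n : ℕ) : QuadraticForm ℝ (E n) :=
  -LinearMap.BilinMap.toQuadraticMap (innerₗ (E n))

theorem negSq_apply {n : ℕ} (v : E n) : negSq n v = -(‖v‖ ^ 2) := by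
  simp [negSq]

/-- The Clifford algebra of `ℝⁿ`, with the relations `v w + w v + 2⟨v, w⟩ = 0`. -/
abbrev Cl (n : ℕ) : Type := CliffordAlgebra (negSq n)

/-- A vector, seen in the Clifford algebra. -/
abbrev vec {n : ℕ} (v : E n) : Cl n := CliffordAlgebra.ι (negSq n) v

theorem vec_sq {n : ℕ} (v : E n) : vec v * vec v = algebraMap ℝ (Cl n) (-(‖v‖ ^ 2)) := by
  rw [CliffordAlgebra.ι_sq_scalar, negSq_apply]

/-- `Spin(n)`, the products of an even number of unit vectors. -/
abbrev Spin (n : ℕ) : Type := spinGroup (negSq n)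

/-- The canonical basis vector `e_{i+1}` in the Clifford algebra. -/
def e {n : ℕ} (i : Fin n) : Cl n := vec (EuclideanSpace.single i (1 : ℝ))

/-- The product `e₁ e₂ ⋯ e_l` of the first `l` canonical basis vectors (`l ≤ n`). -/
def eProd (n l : ℕ) : Cl n := ((List.ofFn (fun i : Fin n => (e i : Cl n))).take l).prod

/-- The last canonical basis vector `e_n` of `ℝⁿ`. -/
def lastVec (n : ℕ) : E n := WithLp.toLp 2 (fun i => if (i : ℕ) + 1 = n then 1 else 0)

/-! ### Bieberbach groups -/

/-- The group of isometries of `ℝⁿ`. -/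
abbrev Isom (n : ℕ) : Type := E n ≃ᵃⁱ[ℝ] E n

/-- The rotational part `B` of `γ = B L_b`, as a homomorphism `I(ℝⁿ) → O(n)`. -/
def rot (n : ℕ) : Isom n →* (E n ≃ₗᵢ[ℝ] E n) where
  toFun γ := γ.linearIsometryEquiv
  map_one' := by ext1 v; rfl
  map_mul' γ γ' := by ext1 v; rfl

/-- The vector `b` of `γ = B L_b`, that is `γ x = B (x + b)`. -/
def transPart {n : ℕ} (γ : Isom n) : E n := (rot n γ).symm (γ 0)

theorem apply_eq {n : ℕ} (γ : Isom n) (x : E n) : γ x = rot n γ (x + transPart γ) := by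
  have h := γ.map_vadd 0 x
  simp only [vadd_eq_add, add_zero] at h
  rw [h, map_add, transPart, LinearIsometryEquiv.apply_symm_apply]
  rfl

/-- The translation `L_v : x ↦ v + x`. -/
abbrev transl {n : ℕ} (v : E n) : Isom n := AffineIsometryEquiv.constVAdd ℝ (E n) v

/-- A Bieberbach group: a discrete, cocompact, torsion-free group of isometries of `ℝⁿ`.
Discreteness refers to the usual topology of the isometry group, that of pointwise convergence. -/
structure IsBieberbach {n : ℕ} (Γ : Subgroup (Isom n)) : Prop where
  discrete : DiscreteTopology ((fun γ : Isom n => (γ : E n → E n)) '' (Γ : Set (Isom n)))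
  cocompact : ∃ K : Set (E n), IsCompact K ∧ ∀ x : E n, ∃ γ ∈ Γ, γ x ∈ K
  torsionFree : ∀ γ ∈ Γ, γ ≠ 1 → ∀ l : ℕ, 0 < l → γ ^ l ≠ 1

/-- `Γ ⊂ SO(n) ⋉ ℝⁿ`, that is, the quotient manifold is orientable. -/
def IsOriented {n : ℕ} (Γ : Subgroup (Isom n)) : Prop :=
  ∀ γ ∈ Γ, LinearMap.det ((rot n γ).toLinearEquiv : E n →ₗ[ℝ] E n) = 1

/-- The holonomy group `F = r(Γ)`. -/
def holonomy {n : ℕ} (Γ : Subgroup (Isom n)) : Subgroup (E n ≃ₗᵢ[ℝ] E n) := Γ.map (rot n)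

/-- The translation lattice `Λ = {v : L_v ∈ Γ}`. -/
def lattice {n : ℕ} (Γ : Subgroup (Isom n)) : AddSubgroup (E n) where
  carrier := {v | transl v ∈ Γ}
  zero_mem' := by
    have h : transl (0 : E n) = 1 := by ext1 x; simp
    change transl (0 : E n) ∈ Γ
    rw [h]
    exact one_mem Γ
  add_mem' {v w} hv hw := by
    have h : transl (v + w) = transl v * transl w := by ext1 x; simp [add_assoc]
    change transl (v + w) ∈ Γ
    rw [h]
    exact Γ.mul_mem hv hw
  neg_mem' {v} hv := by
    have h : transl (-v) = (transl v)⁻¹ := by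
      rw [eq_inv_iff_mul_eq_one]; ext1 x; simp
    change transl (-v) ∈ Γ
    rw [h]
    exact Γ.inv_mem hv

/-- The translation `L_v`, `v ∈ Λ`, as an element of `Γ`. -/
def latticeElt {n : ℕ} {Γ : Subgroup (Isom n)} (v : lattice Γ) : Γ := ⟨transl (v : E n), v.2⟩

/-- `n_B`, the dimension of the space of vectors fixed by `B`. -/
def nFix {n : ℕ} (B : E n ≃ₗᵢ[ℝ] E n) : ℕ :=
  Module.finrank ℝ (LinearMap.ker ((B.toLinearEquiv : E n →ₗ[ℝ] E n) - LinearMap.id))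

/-- `F₁ = {B ∈ F : n_B = 1}`. -/
def F₁ {n : ℕ} (Γ : Subgroup (Isom n)) : Set (E n ≃ₗᵢ[ℝ] E n) :=
  {B | B ∈ holonomy Γ ∧ nFix B = 1}

/-- `Λ^B = ℤ f`. -/
def GeneratesFixed {n : ℕ} (Γ : Subgroup (Isom n)) (B : E n ≃ₗᵢ[ℝ] E n) (f : E n) : Prop :=
  {v : E n | v ∈ lattice Γ ∧ B v = v} = (AddSubgroup.zmultiples f : Set (E n))

/-! ### Spin structures -/

/-- A spin structure on `Γ \ ℝⁿ`: a homomorphism `ε : Γ → Spin(n)` that lifts `r : Γ → SO(n)`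
through the covering `g ↦ (v ↦ g v g⁻¹)`. -/
structure SpinStructure {n : ℕ} (Γ : Subgroup (Isom n)) where
  hom : Γ →* Spin n
  lift : ∀ (γ : Γ) (v : E n),
    (hom γ : Cl n) * vec v * ((hom γ)⁻¹ : Spin n) = vec (rot n (γ : Isom n) v)

section SpinStructure

variable {n : ℕ} {Γ : Subgroup (Isom n)} (ε : SpinStructure Γ)

open Classical in
/-- The character `δ_ε` of `Λ`: `δ_ε(v) = 1` if `ε(L_v) = 1`, and `δ_ε(v) = -1` otherwise
(in which case `ε(L_v) = -1`). -/
def SpinStructure.delta (v : lattice Γ) : ℤ := if ε.hom (latticeElt v) = 1 then 1 else -1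

/-- Spin structures of trivial type: `ε` is trivial on `Λ`. -/
def SpinStructure.TrivialType : Prop := ∀ v : lattice Γ, ε.hom (latticeElt v) = 1

/-- `Λ*_ε = Λ* + u_ε`, that is, the set of all `u` with `δ_ε(v) = exp(2πi u·v)` for `v ∈ Λ`. -/
def SpinStructure.dualCoset : Set (E n) :=
  {u | ∀ v : lattice Γ,
    (ε.delta v : ℂ) = Complex.exp (2 * Real.pi * Complex.I * (inner ℝ u (v : E n) : ℝ))}

/-- `Λ*_{ε,μ}`, the vectors of norm `μ` in `Λ*_ε`. -/
def SpinStructure.dualSphere (μ : ℝ) : Set (E n) := {u | u ∈ ε.dualCoset ∧ ‖u‖ = μ}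

/-- The condition `B|_Λ = -δ_ε Id`, to be read in a basis of the lattice:
some `ℤ`-basis `f₁, …, fₙ` of `Λ` satisfies `B fⱼ = -δ_ε(fⱼ) fⱼ` for every `j`. -/
def SpinStructure.NegDelta (B : E n ≃ₗᵢ[ℝ] E n) : Prop :=
  ∃ f : Module.Basis (Fin n) ℤ (lattice Γ),
    ∀ j, B (f j : E n) = -(ε.delta (f j)) • (f j : E n)

open Classical in
/-- The sign `σ_ε(u, x)`, for `u ≠ 0` fixed by the rotational part of `γ`: it is `1` if
`h ε(γ) h⁻¹` is conjugate to `x` in `Spin(n-1) = {g ∈ Spin(n) : g e_n g⁻¹ = e_n}`, where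
`h ∈ Spin(n)` satisfies `h u h⁻¹ = ‖u‖ e_n`, and `-1` otherwise. -/
def SpinStructure.sign (γ : Γ) (u : E n) (x : Cl n) : ℤ :=
  if ∃ h : Spin n, (h : Cl n) * vec u * (h⁻¹ : Spin n) = vec (‖u‖ • lastVec n) ∧
      ∃ g : Spin n, (g : Cl n) * vec (lastVec n) * (g⁻¹ : Spin n) = vec (lastVec n) ∧
        (g : Cl n) * (h * ε.hom γ * h⁻¹ : Spin n) * (g⁻¹ : Spin n) = x
  then 1 else -1

end SpinStructure

/-! ### Spinors and the twisted Dirac operator -/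

section Dirac

variable {n : ℕ} {Γ : Subgroup (Isom n)}
  {S : Type*} [NormedAddCommGroup S] [InnerProductSpace ℂ S]
  {V : Type*} [NormedAddCommGroup V] [InnerProductSpace ℂ V]

/-- The complex vector space `S ⊗ V`, with the inner product that those of `S` and `V` induce
(which only serves to speak of smooth maps into this finite-dimensional space). -/
def Spinor (S V : Type*) [NormedAddCommGroup S] [InnerProductSpace ℂ S]
    [NormedAddCommGroup V] [InnerProductSpace ℂ V] : Type _ := S ⊗[ℂ] V

instance : NormedAddCommGroup (Spinor S V) := inferInstanceAs (NormedAddCommGroup (S ⊗[ℂ] V))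

instance : InnerProductSpace ℂ (Spinor S V) := inferInstanceAs (InnerProductSpace ℂ (S ⊗[ℂ] V))

/-- The endomorphism `A ⊗ C` of `S ⊗ V`. -/
def tensorAct (A : S →ₗ[ℂ] S) (C : V →ₗ[ℂ] V) : Spinor S V →ₗ[ℂ] Spinor S V :=
  (TensorProduct.map A C : S ⊗[ℂ] V →ₗ[ℂ] S ⊗[ℂ] V)

/-- `L` is the spin representation: a complex irreducible representation of the Clifford algebra.
For even `n` it is unique up to isomorphism. For odd `n` there are two, told apart by the scalar
`± i^{m+1}`, `m = [n/2]`, by which the central element `e₁ ⋯ eₙ` acts; the one used here has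
`e₁ ⋯ eₙ = -i^{m+1}`, so that `e_n` acts by `-i` on the vectors on which each of
`e₁e₂, e₃e₄, …, e_{2m-1}e_{2m}` acts by `i`. -/
structure IsSpinRep (L : Cl n →ₐ[ℝ] Module.End ℂ S) : Prop where
  nontrivial : Nontrivial S
  irreducible : ∀ W : Submodule ℂ S, (∀ a : Cl n, ∀ w ∈ W, L a w ∈ W) → W = ⊥ ∨ W = ⊤
  volume : Odd n → ∀ w : S, L (eProd n n) w = -(Complex.I ^ (n / 2 + 1)) • w

/-- `ρ` is trivial on the translation lattice. -/
def TrivialOnLattice (ρ : Γ →* (V ≃ₗᵢ[ℂ] V)) : Prop := ∀ v : lattice Γ, ρ (latticeElt v) = 1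

/-- The character `χ_ρ`. -/
def chi (ρ : Γ →* (V ≃ₗᵢ[ℂ] V)) (γ : Γ) : ℂ :=
  LinearMap.trace ℂ V ((ρ γ).toLinearEquiv : V →ₗ[ℂ] V)

/-- The spinor fields of `Γ \ ℝⁿ` with twist `V`, identified with the smooth maps
`f : ℝⁿ → S ⊗ V` that satisfy `f (γ x) = (L(ε(γ)) ⊗ ρ(γ)) f(x)`. -/
def spinorFields (ε : SpinStructure Γ) (L : Cl n →ₐ[ℝ] Module.End ℂ S)
    (ρ : Γ →* (V ≃ₗᵢ[ℂ] V)) : Submodule ℂ (E n → Spinor S V) where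
  carrier := {f | ContDiff ℝ ∞ f ∧ ∀ (γ : Γ) (x : E n),
    f ((γ : Isom n) x) =
      tensorAct (L (ε.hom γ : Cl n)) ((ρ γ).toLinearEquiv : V →ₗ[ℂ] V) (f x)}
  zero_mem' := ⟨contDiff_const, fun γ x => by simp⟩
  add_mem' {f g} hf hg := ⟨hf.1.add hg.1, fun γ x => by simp [hf.2, hg.2]⟩
  smul_mem' c f hf := ⟨contDiff_const.smul hf.1, fun γ x => by simp [hf.2]⟩

/-- The twisted Dirac operator `D_ρ f = ∑ᵢ (L(eᵢ) ⊗ Id) ∂f/∂xᵢ`. -/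
def dirac (L : Cl n →ₐ[ℝ] Module.End ℂ S) (f : E n → Spinor S V) : E n → Spinor S V :=
  fun x => ∑ i : Fin n,
    tensorAct (L (e i)) (LinearMap.id : V →ₗ[ℂ] V)
      (fderiv ℝ f x (EuclideanSpace.single i (1 : ℝ)))

/-- The space of spinor fields `f` with `D_ρ f = t f`. -/
def eigenspace (ε : SpinStructure Γ) (L : Cl n →ₐ[ℝ] Module.End ℂ S)
    (ρ : Γ →* (V ≃ₗᵢ[ℂ] V)) (t : ℝ) : Submodule ℂ (E n → Spinor S V) where
  carrier := {f | f ∈ spinorFields ε L ρ ∧ ∀ x, dirac L f x = (t : ℂ) • f x}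
  zero_mem' := ⟨zero_mem _, fun x => by simp [dirac]⟩
  add_mem' {f g} hf hg := by
    refine ⟨add_mem hf.1 hg.1, fun x => ?_⟩
    have h1 : DifferentiableAt ℝ f x := hf.1.1.differentiable (by simp) x
    have h2 : DifferentiableAt ℝ g x := hg.1.1.differentiable (by simp) x
    have h3 := hf.2 x
    have h4 := hg.2 x
    simp only [dirac] at h3 h4 ⊢
    rw [fderiv_add h1 h2]
    simp [Finset.sum_add_distrib, h3, h4]
  smul_mem' c f hf := by
    refine ⟨Submodule.smul_mem _ c hf.1, fun x => ?_⟩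
    have h1 : DifferentiableAt ℝ f x := hf.1.1.differentiable (by simp) x
    have h3 := hf.2 x
    simp only [dirac] at h3 ⊢
    rw [fderiv_const_smul h1]
    simp [← Finset.smul_sum, h3, smul_comm c]

/-- The multiplicity of `t` as an eigenvalue of `D_ρ`. -/
def mult (ε : SpinStructure Γ) (L : Cl n →ₐ[ℝ] Module.End ℂ S)
    (ρ : Γ →* (V ≃ₗᵢ[ℂ] V)) (t : ℝ) : ℕ :=
  Module.finrank ℂ (eigenspace ε L ρ t)

/-- The asymmetric part of the Dirac spectrum: all `t` such that `t` and `-t` have different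
multiplicities (a non-eigenvalue has multiplicity `0`). -/
def asymSpectrum (ε : SpinStructure Γ) (L : Cl n →ₐ[ℝ] Module.End ℂ S)
    (ρ : Γ →* (V ≃ₗᵢ[ℂ] V)) : Set ℝ :=
  {t | mult ε L ρ t ≠ mult ε L ρ (-t)}

/-- The Dirac spectrum is symmetric. -/
def SymmetricSpectrum (ε : SpinStructure Γ) (L : Cl n →ₐ[ℝ] Module.End ℂ S)
    (ρ : Γ →* (V ≃ₗᵢ[ℂ] V)) : Prop :=
  asymSpectrum ε L ρ = ∅

/-- For `μ > 0`, both `±2πμ` have multiplicity `2^{m-k-1} d_ρ |Λ*_{ε,μ}|`, where `m = [n/2]`. -/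
def SymmetricFormula (k : ℕ) (ε : SpinStructure Γ) (L : Cl n →ₐ[ℝ] Module.End ℂ S)
    (ρ : Γ →* (V ≃ₗᵢ[ℂ] V)) (μ : ℝ) : Prop :=
  (mult ε L ρ (2 * Real.pi * μ) : ℝ) =
      (2 : ℝ) ^ ((n / 2 : ℕ) - k - 1 : ℤ) *
        (Module.finrank ℂ V * (ε.dualSphere μ).ncard) ∧
  (mult ε L ρ (-(2 * Real.pi * μ)) : ℝ) =
      (2 : ℝ) ^ ((n / 2 : ℕ) - k - 1 : ℤ) *
        (Module.finrank ℂ V * (ε.dualSphere μ).ncard)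

/-- The conditions on `γ = B L_b` under which it makes the spectrum asymmetric:
`n_B = 1`, `χ_ρ(γ) ≠ 0` and `B|_Λ = -δ_ε Id`. -/
def IsAsymmetryElement (ε : SpinStructure Γ) (ρ : Γ →* (V ≃ₗᵢ[ℂ] V)) (γ : Γ) : Prop :=
  nFix (rot n (γ : Isom n)) = 1 ∧ chi ρ γ ≠ 0 ∧ ε.NegDelta (rot n (γ : Isom n))

end Dirac

end FlatSpin

end

noncomputable section

namespace FlatSpin

open scoped TensorProduct ContDiff

/-! ### The Clifford algebra -/

section Clifford

variable {n : ℕ}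

/-! The proof is Fourier analysis on the torus Λ\ℝⁿ followed by a trace computation over F. Under
translation by Λ a spinor field is multiplied by δ_ε, because ρ is trivial there. So it expands in
the characters e^{2πi u·x}, u ∈ Λ*_ε, and D_ρ acts on the coefficient at u as 2πi L(u), whose square
is (2π‖u‖)². Hence an eigenspinor for t = ±2πμ is a trigonometric polynomial with frequencies of
norm μ, whose coefficients satisfy 2πi L(u) c_u = t c_u and are invariant under an action of Γ that
factors through F (`map_trigPoly_coeffSpace`, `coeffAct_eq_of_rot_eq`). The multiplicity is the
trace of the averaging projection: the mean over B ∈ F of χ_ρ(γ) times the sum over the u fixed by B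
of e^{-2πi u·b} tr(L(ε(γ)) P_t(u)), where P_t(u) = ½(1 + 2πi L(u)/t) for t ≠ 0
(`finiteDimensional_eigenspace_and_mult`).

For t ≠ 0, B = Id gives the main term, since dim S = 2^m and the part odd in u cancels. For B ≠ Id
the traces vanish unless n_B = 1, because an operator that anticommutes with an invertible one has
trace 0. If n_B = 1, then B is the half-turn about a line, n is odd, and ε(γ)u = ±‖u‖ e₁⋯eₙ acts on
S as a scalar; its sign is σ (`SpinStructure.hom_mul_vec_eq_sign`). The frequencies u and -u
contribute multiples of e^{-2πi u·b} and -e^{2πi u·b}. Squaring γ shows that (e^{2πi u·b})² = (-1)^m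
(`delta_sq`), so the two cancel for even m and reinforce each other for odd m, that is, for n =
4r+3.

It remains to see when B fixes an element of Λ*_ε. Let m be odd and Λ^B = ℤf. If there is such an
element, then δ_ε(f) = -1, Λ projects orthogonally onto ℤf, and the fixed elements of Λ*_ε are the
odd multiples of f/(2‖f‖²), of norms (j+½)/‖f‖. Existence amounts to B|_Λ = -δ_ε Id in a basis
(`negDelta_of_fixed`, `SpinStructure.NegDelta.exists_fixed`), and at most one B with n_B = 1 has
this property (`rot_eq_of_fixed`). For t = 0 only u = 0 and B = Id contribute, which gives (iii). -/

theorem vec_mul_vec_add_swap (v w : E n) :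
    vec v * vec w + vec w * vec v = algebraMap ℝ (Cl n) (-2 * inner ℝ v w) := by
  have h := vec_sq (v + w)
  have hv := vec_sq v
  have hw := vec_sq w
  simp only [vec, map_add, add_mul, mul_add] at h hv hw ⊢
  rw [hv, hw, norm_add_sq_real] at h
  have : algebraMap ℝ (Cl n) (-2 * inner ℝ v w) = algebraMap ℝ (Cl n) (-(‖v‖ ^ 2 +
      2 * inner ℝ v w + ‖w‖ ^ 2)) - algebraMap ℝ (Cl n) (-‖v‖ ^ 2) -
      algebraMap ℝ (Cl n) (-‖w‖ ^ 2) := by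
    rw [← map_sub, ← map_sub]; congr 1; ring
  rw [this, ← h]
  abel

theorem vec_mul_vec_of_inner_eq_zero {v w : E n} (h : inner ℝ v w = 0) :
    vec v * vec w = -(vec w * vec v) := by
  have := vec_mul_vec_add_swap v w
  rw [h, mul_zero, map_zero] at this
  exact eq_neg_of_add_eq_zero_left this

theorem vec_sq_of_norm_eq_one {v : E n} (h : ‖v‖ = 1) : vec v * vec v = -1 := by
  rw [vec_sq, h]; simp

theorem e_sq (i : Fin n) : (e i : Cl n) * e i = -1 :=
  vec_sq_of_norm_eq_one (by simp)

theorem e_mul_e_of_ne {i j : Fin n} (h : i ≠ j) : (e i : Cl n) * e j = -(e j * e i) :=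
  vec_mul_vec_of_inner_eq_zero (by simp [EuclideanSpace.inner_single_left, h])

theorem vec_eq_sum (v : E n) : vec v = ∑ i, v i • (e i : Cl n) := by
  have h : v = ∑ i, v i • EuclideanSpace.single i (1 : ℝ) := by
    have := (EuclideanSpace.basisFun (Fin n) ℝ).sum_repr v
    simpa using this.symm
  conv_lhs => rw [h]
  simp [vec, e]

/-- The product of the basis vectors listed in `l`. -/
def eList (l : List (Fin n)) : Cl n := (l.map e).prod

@[simp] theorem eList_nil : (eList [] : Cl n) = 1 := rfl

@[simp] theorem eList_cons (i : Fin n) (l : List (Fin n)) : eList (i :: l) = e i * eList l := by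
  simp [eList]

theorem eList_append (l l' : List (Fin n)) : eList (l ++ l') = eList l * eList l' := by
  simp [eList]

/-- Each factor other than e_i contributes a sign; their number is the length minus the count, of
the same parity as the sum. -/
theorem e_mul_eList (i : Fin n) (l : List (Fin n)) :
    e i * eList l = ((-1 : ℝ) ^ (l.length + l.count i)) • (eList l * e i) := by
  induction l with
  | nil => simp
  | cons j l ih =>
    by_cases h : i = j
    · subst h
      simp only [eList_cons, List.length_cons, List.count_cons_self]
      rw [mul_assoc (e i) (eList l), ih, mul_smul_comm,
        show l.length + 1 + (l.count i + 1) = l.length + l.count i + 2 by ring,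
        pow_add _ _ 2, neg_one_sq, mul_one]
    · simp only [eList_cons, List.length_cons, List.count_cons_of_ne (Ne.symm h)]
      rw [← mul_assoc, e_mul_e_of_ne h, neg_mul, mul_assoc, ih, mul_smul_comm, ← mul_assoc,
        ← neg_smul]
      congr 1
      ring

theorem e_mul_eList_mul_e (i : Fin n) (l : List (Fin n)) :
    e i * eList l * e i = ((-1 : ℝ) ^ (l.length + l.count i + 1)) • eList l := by
  rw [e_mul_eList, smul_mul_assoc, mul_assoc, e_sq, mul_neg_one, smul_neg, pow_succ]
  simp

/-- The leading factor cancels, up to sign, against its next occurrence, and all parities are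
preserved. -/
theorem eList_mem_of_count_even (l : List (Fin n)) (h : ∀ i, Even (l.count i)) :
    eList l ∈ (⊥ : Subalgebra ℝ (Cl n)) := by
  induction hl : l.length using Nat.strong_induction_on generalizing l with
  | _ N ih =>
    cases l with
    | nil => simp
    | cons i t =>
      have hi : i ∈ t := by
        have := h i
        rw [List.count_cons_self] at this
        rw [← List.count_pos_iff]
        grind
      obtain ⟨a, b, rfl⟩ := List.append_of_mem hi
      have key : eList (i :: (a ++ i :: b)) =
          ((-1 : ℝ) ^ (a.length + a.count i + 1)) • eList (a ++ b) := by
        rw [eList_cons, eList_append, eList_cons, ← mul_assoc, ← mul_assoc, e_mul_eList_mul_e,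
          smul_mul_assoc, eList_append]
      rw [key]
      refine Subalgebra.smul_mem _ (ih (a ++ b).length ?_ _ ?_ rfl) _
      · rw [← hl]; simp
      · intro j
        have := h j
        simp only [List.count_cons, List.count_append] at this ⊢
        grind

theorem vec_mul_vec_mul_mem_span (v w : E n) {x : Cl n}
    (hx : x ∈ Submodule.span ℝ {y : Cl n | ∃ l : List (Fin n), Even l.length ∧ eList l = y}) :
    vec v * vec w * x ∈
      Submodule.span ℝ {y : Cl n | ∃ l : List (Fin n), Even l.length ∧ eList l = y} := by
  induction hx using Submodule.span_induction with
  | mem x hx =>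
    obtain ⟨l, hl, rfl⟩ := hx
    rw [vec_eq_sum v, vec_eq_sum w]
    simp only [Finset.sum_mul, Finset.mul_sum]
    refine Submodule.sum_mem _ fun i _ => Submodule.sum_mem _ fun j _ => ?_
    simp only [smul_mul_assoc, mul_smul_comm, mul_assoc]
    refine Submodule.smul_mem _ _ (Submodule.smul_mem _ _ (Submodule.subset_span
      ⟨_ :: _ :: l, ?_, by rw [eList_cons, eList_cons]⟩))
    simpa [Nat.even_add_one] using hl
  | zero => simp
  | add x y _ _ h1 h2 => rw [mul_add]; exact add_mem h1 h2
  | smul r x _ h1 => rw [mul_smul_comm]; exact Submodule.smul_mem _ _ h1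

theorem even_mem_span (x : Cl n) (hx : x ∈ CliffordAlgebra.evenOdd (negSq n) 0) :
    x ∈ Submodule.span ℝ {y : Cl n | ∃ l : List (Fin n), Even l.length ∧ eList l = y} := by
  induction x, hx using CliffordAlgebra.even_induction with
  | algebraMap r =>
    rw [Algebra.algebraMap_eq_smul_one]
    exact Submodule.smul_mem _ _ (Submodule.subset_span ⟨[], by simp⟩)
  | add x y hx hy h1 h2 => exact add_mem h1 h2
  | ι_mul_ι_mul v w x hx h => exact vec_mul_vec_mul_mem_span v w h

/-- The span of the even monomials in which the first `j` basis vectors occur evenly often. -/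
def evenSpan (n j : ℕ) : Submodule ℝ (Cl n) :=
  Submodule.span ℝ {y : Cl n | ∃ l : List (Fin n), Even l.length ∧
    (∀ i : Fin n, (i : ℕ) < j → Even (l.count i)) ∧ eList l = y}

/-- The map y ↦ y - e_j y e_j doubles the even monomials that contain e_j evenly often and kills the
others, while it sends an x that commutes with e_j to 2x. -/
theorem mem_evenSpan_succ {j : ℕ} (hj : j < n) {x : Cl n} (hx : x ∈ evenSpan n j)
    (hc : e ⟨j, hj⟩ * x = x * e ⟨j, hj⟩) : x ∈ evenSpan n (j + 1) := by
  have key : ∀ y ∈ evenSpan n j, y - e ⟨j, hj⟩ * y * e ⟨j, hj⟩ ∈ evenSpan n (j + 1) := by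
    intro y hy
    induction hy using Submodule.span_induction with
    | mem y hy =>
      obtain ⟨l, h1, h2, rfl⟩ := hy
      rw [e_mul_eList_mul_e]
      by_cases h : Even (l.count ⟨j, hj⟩)
      · rw [Odd.neg_one_pow (by grind), neg_one_smul, sub_neg_eq_add]
        have : eList l ∈ evenSpan n (j + 1) := by
          refine Submodule.subset_span ⟨l, h1, fun i hi => ?_, rfl⟩
          rcases Nat.lt_succ_iff_lt_or_eq.1 hi with h' | h'
          · exact h2 i h'
          · have : i = ⟨j, hj⟩ := Fin.ext h'
            rwa [this]
        exact add_mem this this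
      · rw [Even.neg_one_pow (by grind), one_smul, sub_self]
        exact zero_mem _
    | zero => simp
    | add x y _ _ h1 h2 =>
      convert add_mem h1 h2 using 1
      noncomm_ring
    | smul r x _ h1 =>
      convert Submodule.smul_mem _ r h1 using 1
      simp [smul_sub]
  have h := key x hx
  rw [hc, mul_assoc, e_sq, mul_neg_one, sub_neg_eq_add, ← two_smul ℝ x] at h
  have := Submodule.smul_mem _ (2⁻¹ : ℝ) h
  rwa [smul_smul, inv_mul_cancel₀ (two_ne_zero), one_smul] at this

/-- The basis vectors are eliminated one at a time, so linear independence of the monomials is never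
used. -/
theorem exists_algebraMap_of_even_of_commute {x : Cl n}
    (hx : x ∈ CliffordAlgebra.even (negSq n)) (hc : ∀ i, e i * x = x * e i) :
    ∃ c : ℝ, x = algebraMap ℝ (Cl n) c := by
  have h : ∀ j ≤ n, x ∈ evenSpan n j := by
    intro j
    induction j with
    | zero => intro _; simpa [evenSpan] using even_mem_span x hx
    | succ j ih => intro hj; exact mem_evenSpan_succ hj (ih (by omega)) (hc _)
  have h2 : evenSpan n n ≤ Subalgebra.toSubmodule (⊥ : Subalgebra ℝ (Cl n)) := by
    rw [evenSpan, Submodule.span_le]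
    rintro _ ⟨l, -, hl, rfl⟩
    exact eList_mem_of_count_even l fun i => hl i i.2
  obtain ⟨c, hc⟩ := Algebra.mem_bot.1 (h2 (h n le_rfl))
  exact ⟨c, hc.symm⟩

end Clifford

/-! ### The spin group -/

section SpinGroup

variable {n : ℕ}

theorem star_vec (v : E n) : star (vec v) = -vec v := by
  simp [vec, CliffordAlgebra.star_def]

theorem vec_mul_vec_mem_spin {v w : E n} (hv : ‖v‖ = 1) (hw : ‖w‖ = 1) :
    vec v * vec w ∈ spinGroup (negSq n) := by
  have key : ∀ u : E n, ‖u‖ = 1 → vec u ∈ pinGroup (negSq n) := by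
    intro u hu
    have h1 : vec u * -vec u = 1 := by rw [mul_neg, vec_sq_of_norm_eq_one hu, neg_neg]
    have h2 : -vec u * vec u = 1 := by rw [neg_mul, vec_sq_of_norm_eq_one hu, neg_neg]
    refine ⟨⟨⟨vec u, -vec u, h1, h2⟩, Subgroup.subset_closure ⟨u, rfl⟩, rfl⟩, ?_⟩
    exact Unitary.mem_iff.2 (by rw [star_vec]; exact ⟨h2, h1⟩)
  exact ⟨mul_mem (key v hv) (key w hw), CliffordAlgebra.ι_mul_ι_mem_evenOdd_zero _ _ _⟩

theorem Spin.coe_mul_coe_inv (g : Spin n) : (g : Cl n) * (g⁻¹ : Spin n) = 1 := by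
  rw [← Submonoid.coe_mul, mul_inv_cancel, Submonoid.coe_one]

theorem Spin.coe_inv_mul_coe (g : Spin n) : ((g⁻¹ : Spin n) : Cl n) * g = 1 := by
  rw [← Submonoid.coe_mul, inv_mul_cancel, Submonoid.coe_one]

theorem algebraMap_Cl_injective : Function.Injective (algebraMap ℝ (Cl n)) :=
  (algebraMap ℝ (Cl n)).injective

/-- Stated for even elements rather than for `Spin n`, since it is also applied to (e₁⋯eₙ)² and to
products g u e₁⋯eₙ. -/
theorem eq_one_or_neg_one_of_commute {x : Cl n} (hx : x ∈ CliffordAlgebra.even (negSq n))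
    (hc : ∀ i, e i * x = x * e i) (hs : star x * x = 1) : x = 1 ∨ x = -1 := by
  obtain ⟨c, rfl⟩ := exists_algebraMap_of_even_of_commute hx hc
  rw [CliffordAlgebra.star_algebraMap, ← map_mul, ← map_one (algebraMap ℝ (Cl n))] at hs
  rcases mul_self_eq_one_iff.1 (algebraMap_Cl_injective hs) with rfl | rfl
  · left; simp
  · right; simp

theorem Spin.coe_eq_one_or_neg_one (g : Spin n) (h : ∀ v : E n, (g : Cl n) * vec v = vec v * g) :
    (g : Cl n) = 1 ∨ (g : Cl n) = -1 :=
  eq_one_or_neg_one_of_commute (spinGroup.mem_even g.2) (fun _ => (h _).symm)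
    (spinGroup.star_mul_self_of_mem g.2)

theorem norm_lastVec (hn : 0 < n) : ‖lastVec n‖ = 1 := by
  obtain ⟨m, rfl⟩ : ∃ m, n = m + 1 := ⟨n - 1, by omega⟩
  have : lastVec (m + 1) = EuclideanSpace.single (Fin.last m) 1 := by
    ext i
    simp only [lastVec, PiLp.single_apply, Fin.ext_iff, Fin.val_last]
    simp
  rw [this]; simp

/-- With w = u + ‖u‖eₙ one has w u = ‖u‖eₙ w, because u and ‖u‖eₙ have the same square. So
conjugation by eₙ w/‖w‖ takes u to ‖u‖eₙ. -/
theorem exists_spin_conj_eq_lastVec (hn : 2 ≤ n) (u : E n) :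
    ∃ h : Spin n, (h : Cl n) * vec u * (h⁻¹ : Spin n) = vec (‖u‖ • lastVec n) := by
  have hl : ‖lastVec n‖ = 1 := norm_lastVec (by omega)
  suffices H : ∃ c d : E n, ‖c‖ = 1 ∧ ‖d‖ = 1 ∧
      vec d * vec c * vec u = vec (‖u‖ • lastVec n) * (vec d * vec c) by
    obtain ⟨c, d, hc, hd, h⟩ := H
    refine ⟨⟨_, vec_mul_vec_mem_spin hd hc⟩, ?_⟩
    change vec d * vec c * vec u * _ = _
    rw [h, mul_assoc]
    erw [Spin.coe_mul_coe_inv ⟨_, vec_mul_vec_mem_spin hd hc⟩]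
    rw [mul_one]
  -- Here u = -‖u‖eₙ, and the half-turn in the plane of eₙ and an orthogonal unit vector does it;
  -- this needs n ≥ 2.
  by_cases hw : u + ‖u‖ • lastVec n = 0
  · obtain ⟨i, hi⟩ : ∃ c : E n, ‖c‖ = 1 ∧ inner ℝ c (lastVec n) = 0 := by
      refine ⟨EuclideanSpace.single ⟨0, by omega⟩ 1, by simp, ?_⟩
      simp [EuclideanSpace.inner_single_left, lastVec]
      omega
    refine ⟨lastVec n, i, hl, hi.1, ?_⟩
    have h1 := vec_mul_vec_of_inner_eq_zero hi.2
    have h2 : vec u = -(‖u‖ • vec (lastVec n)) := by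
      conv_lhs => rw [eq_neg_of_add_eq_zero_left hw]
      simp [vec]
    rw [h2]
    simp only [vec, map_smul] at h1 ⊢
    rw [mul_neg, mul_smul_comm, smul_mul_assoc, ← smul_neg]
    congr 1
    rw [h1, neg_mul, neg_neg, mul_neg, mul_assoc, h1, mul_neg]
  · set w := u + ‖u‖ • lastVec n with hwdef
    refine ⟨(‖w‖⁻¹) • w, lastVec n, ?_, hl, ?_⟩
    · rw [norm_smul, norm_inv, norm_norm, inv_mul_cancel₀ (by simpa using hw)]
    · have h1 : vec w * vec u = vec (‖u‖ • lastVec n) * vec w := by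
        rw [hwdef]
        have h2 := vec_sq u
        have h3 := vec_sq (‖u‖ • lastVec n)
        have h4 : ‖‖u‖ • lastVec n‖ = ‖u‖ := by rw [norm_smul, hl]; simp
        rw [h4, ← h2] at h3
        simp only [vec, map_add, add_mul, mul_add] at h2 h3 ⊢
        rw [h3]; abel
      simp only [vec, map_smul] at h1 ⊢
      rw [mul_smul_comm, smul_mul_assoc, mul_smul_comm, mul_assoc, h1]
      simp only [smul_mul_assoc, mul_smul_comm]

end SpinGroup

/-! ### The volume element -/

section Volume

variable {n : ℕ}

theorem eProd_eq_eList (l : ℕ) : eProd n l = eList ((List.finRange n).take l) := by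
  rw [eProd, eList, List.map_take, List.ofFn_eq_map]

theorem eProd_self_eq_eList : eProd n n = eList (List.finRange n) := by
  rw [eProd_eq_eList, List.take_of_length_le (by simp)]

theorem e_mul_eProd_self (hn : Odd n) (i : Fin n) : e i * eProd n n = eProd n n * e i := by
  rw [eProd_self_eq_eList, e_mul_eList, List.length_finRange,
    List.count_eq_one_of_mem (List.nodup_finRange n) (List.mem_finRange i),
    Even.neg_one_pow (by simpa [Nat.even_add_one] using hn), one_smul]

theorem eProd_self_mul_comm (hn : Odd n) (x : Cl n) : x * eProd n n = eProd n n * x := by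
  induction x using CliffordAlgebra.induction with
  | algebraMap r => exact Algebra.commutes r _
  | ι v =>
    change vec v * _ = _ * vec v
    rw [vec_eq_sum, Finset.sum_mul, Finset.mul_sum]
    exact Finset.sum_congr rfl fun i _ => by
      rw [smul_mul_assoc, mul_smul_comm, e_mul_eProd_self hn]
  | mul a b ha hb => rw [mul_assoc, hb, ← mul_assoc, ha, mul_assoc]
  | add a b ha hb => rw [add_mul, mul_add, ha, hb]

theorem e_last (hn : 0 < n) : (e ⟨n - 1, by omega⟩ : Cl n) = vec (lastVec n) := by
  rw [e]
  congr 1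
  ext i
  simp only [lastVec, PiLp.single_apply, Fin.ext_iff]
  congr 1
  simp; omega

theorem eProd_self_of_odd (hn : Odd n) :
    eProd n n = eProd n (2 * (n / 2)) * vec (lastVec n) := by
  have h0 : 0 < n := hn.pos
  rw [eProd_self_eq_eList, eProd_eq_eList, ← e_last h0]
  have h : List.finRange n = (List.finRange n).take (2 * (n / 2)) ++ [⟨n - 1, by omega⟩] := by
    obtain ⟨m, rfl⟩ := hn
    rw [show 2 * ((2 * m + 1) / 2) = 2 * m by omega]
    conv_lhs => rw [← List.take_append_drop (2 * m) (List.finRange (2 * m + 1))]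
    congr 1
    apply List.ext_getElem
    · simp
    · intro i h1 h2
      simp at h2
      subst h2
      simp
  conv_lhs => rw [h, eList_append]
  simp

theorem eList_mem_evenOdd (l : List (Fin n)) :
    eList l ∈ CliffordAlgebra.evenOdd (negSq n) (l.length : ZMod 2) := by
  induction l with
  | nil => simpa using CliffordAlgebra.one_le_evenOdd_zero (negSq n) (Submodule.one_le.1 le_rfl)
  | cons i l ih =>
    rw [eList_cons, List.length_cons, Nat.cast_add, add_comm, Nat.cast_one]
    exact CliffordAlgebra.evenOdd_mul_le (negSq n) _ _
      (Submodule.mul_mem_mul (CliffordAlgebra.ι_mem_evenOdd_one _ _) ih)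

theorem eList_mul_star (l : List (Fin n)) : eList l * star (eList l) = 1 := by
  induction l with
  | nil => simp
  | cons i l ih =>
    rw [eList_cons, star_mul, mul_assoc, ← mul_assoc (eList l), ih, one_mul, e, star_vec, mul_neg]
    exact neg_eq_iff_eq_neg.2 (e_sq i)

theorem star_mul_eList (l : List (Fin n)) : star (eList l) * eList l = 1 := by
  induction l with
  | nil => simp
  | cons i l ih =>
    rw [eList_cons, star_mul, mul_assoc, ← mul_assoc (star (e i)), e, star_vec, neg_mul]
    have : (vec (EuclideanSpace.single i (1 : ℝ)) : Cl n) * vec (EuclideanSpace.single i 1) = -1 :=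
      e_sq i
    rw [this, neg_neg, one_mul, ih]

theorem mul_mem_evenOdd {i j k : ZMod 2} {x y : Cl n}
    (hx : x ∈ CliffordAlgebra.evenOdd (negSq n) i) (hy : y ∈ CliffordAlgebra.evenOdd (negSq n) j)
    (h : i + j = k) : x * y ∈ CliffordAlgebra.evenOdd (negSq n) k :=
  h ▸ CliffordAlgebra.evenOdd_mul_le (negSq n) i j (Submodule.mul_mem_mul hx hy)

/-- A spin element `g` that fixes the unit vector `u` and reverses its orthogonal complement
satisfies `g u = ± e₁ ⋯ eₙ`. -/
theorem spin_mul_vec_eq_or (hn : Odd n) (g : Spin n) {u : E n} (hu : ‖u‖ = 1)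
    (h1 : (g : Cl n) * vec u = vec u * g)
    (h2 : ∀ v : E n, inner ℝ u v = 0 → (g : Cl n) * vec v = -(vec v * g)) :
    (g : Cl n) * vec u = eProd n n ∨ (g : Cl n) * vec u = -eProd n n := by
  -- Each v splits into a multiple of u, which commutes with both g and u, and a part orthogonal to
  -- u, which anticommutes with both.
  have hc : ∀ v : E n, vec v * (g * vec u) = g * vec u * vec v := by
    intro v
    set a := inner ℝ u v with ha
    set w := v - a • u with hw
    have huw : inner ℝ u w = 0 := by
      rw [hw, inner_sub_right, inner_smul_right, real_inner_self_eq_norm_sq, hu, ← ha]; ring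
    have h3 : vec w * (g * vec u) = g * vec u * vec w := by
      rw [mul_assoc, vec_mul_vec_of_inner_eq_zero huw, mul_neg, ← mul_assoc, ← mul_assoc,
        h2 w huw, neg_mul, neg_neg]
    have h4 : vec u * (g * vec u) = g * vec u * vec u := by rw [h1, mul_assoc, h1]
    have h5 : v = w + a • u := by rw [hw]; abel
    rw [h5]
    simp only [vec, map_add, map_smul, add_mul, mul_add] at h3 h4 ⊢
    rw [h3, smul_mul_assoc, h4, mul_smul_comm]
  have hω : eProd n n * star (eProd n n) = 1 := by
    rw [eProd_self_eq_eList]; exact eList_mul_star _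
  have hω' : star (eProd n n) * eProd n n = 1 := by
    rw [eProd_self_eq_eList]; exact star_mul_eList _
  have hodd : eProd n n ∈ CliffordAlgebra.evenOdd (negSq n) 1 := by
    have := eList_mem_evenOdd (List.finRange n)
    rwa [← eProd_self_eq_eList, List.length_finRange, ZMod.natCast_eq_one_iff_odd.2 hn] at this
  have heven : (g : Cl n) * vec u * eProd n n ∈ CliffordAlgebra.evenOdd (negSq n) 0 :=
    mul_mem_evenOdd (mul_mem_evenOdd (k := 1) (spinGroup.mem_even g.2)
      (CliffordAlgebra.ι_mem_evenOdd_one (negSq n) u) (zero_add 1)) hodd (by decide)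
  have hs : star ((g : Cl n) * vec u) * ((g : Cl n) * vec u) = 1 := by
    rw [star_mul, mul_assoc, ← mul_assoc (star (g : Cl n)), spinGroup.star_mul_self_of_mem g.2,
      one_mul, star_vec, neg_mul, vec_sq_of_norm_eq_one hu, neg_neg]
  -- Both g u ω and ω², with ω = e₁⋯eₙ, are even, unitary and commute with all vectors, hence are
  -- ±1. The sign of ω², which depends on n, need not be known.
  have key1 : (g : Cl n) * vec u * eProd n n = 1 ∨ (g : Cl n) * vec u * eProd n n = -1 :=
    eq_one_or_neg_one_of_commute heven
      (fun i => by rw [← mul_assoc, e, hc, mul_assoc, ← e, e_mul_eProd_self hn, ← mul_assoc])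
      (by rw [star_mul, mul_assoc, ← mul_assoc (star _) ((g : Cl n) * vec u), hs, one_mul, hω'])
  have key2 : eProd n n * eProd n n = 1 ∨ eProd n n * eProd n n = -1 :=
    eq_one_or_neg_one_of_commute
      (mul_mem_evenOdd (k := 0) hodd hodd (by decide))
      (fun i => by rw [← mul_assoc, e_mul_eProd_self hn, mul_assoc, e_mul_eProd_self hn,
        ← mul_assoc])
      (by rw [star_mul, mul_assoc, ← mul_assoc (star _) (eProd n n), hω', one_mul, hω'])
  have key3 : (g : Cl n) * vec u = (g : Cl n) * vec u * eProd n n * eProd n n ∨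
      (g : Cl n) * vec u = -((g : Cl n) * vec u * eProd n n * eProd n n) := by
    rcases key2 with h | h
    · left; rw [mul_assoc _ (eProd n n), h, mul_one]
    · right; rw [mul_assoc _ (eProd n n), h, mul_neg_one, neg_neg]
  rcases key1 with h | h <;> rcases key3 with h' | h' <;> rw [h] at h' <;> simp [h']

theorem SpinStructure.hom_mul_vec {Γ : Subgroup (Isom n)} (ε : SpinStructure Γ) (γ : Γ) (v : E n) :
    (ε.hom γ : Cl n) * vec v = vec (rot n (γ : Isom n) v) * ε.hom γ := by
  rw [← ε.lift γ v, mul_assoc, Spin.coe_inv_mul_coe, mul_one]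

/-- For odd n the element ω = g_m eₙ is central. Hence ε(γ)u = ‖u‖ω can be conjugated by any h with
h u h⁻¹ = ‖u‖eₙ and turns into hε(γ)h⁻¹ = g_m. This makes σ the sign in ε(γ)u = ±‖u‖ω, independently
of h. -/
theorem SpinStructure.hom_mul_vec_eq_sign {Γ : Subgroup (Isom n)} (ε : SpinStructure Γ) (γ : Γ)
    (hn : Odd n) (hn2 : 2 ≤ n) {u : E n} (hu : u ≠ 0) (h1 : rot n (γ : Isom n) u = u)
    (h2 : ∀ v : E n, inner ℝ u v = 0 → rot n (γ : Isom n) v = -v) :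
    (ε.hom γ : Cl n) * vec u =
      (‖u‖ * ε.sign γ u (eProd n (2 * (n / 2)))) • (eProd n n : Cl n) := by
  have hu' : ‖u‖ ≠ 0 := by simpa using hu
  have hl : ‖lastVec n‖ = 1 := norm_lastVec (by omega)
  set w := ‖u‖⁻¹ • u with hw
  have huw : u = ‖u‖ • w := by rw [hw, smul_smul, mul_inv_cancel₀ hu', one_smul]
  have hcr := spin_mul_vec_eq_or hn (ε.hom γ) (u := w)
    (by rw [hw, norm_smul, norm_inv, norm_norm, inv_mul_cancel₀ hu'])
    (by rw [ε.hom_mul_vec, hw, map_smul, h1])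
    (fun v hv => by
      rw [ε.hom_mul_vec, h2 v, vec, map_neg, neg_mul]
      rw [huw, inner_smul_left, hv, mul_zero])
  classical
  have key : ε.sign γ u (eProd n (2 * (n / 2))) = if (ε.hom γ : Cl n) * vec w = eProd n n
      then 1 else -1 := by
    rw [SpinStructure.sign]
    congr 1
    refine propext ⟨?_, ?_⟩
    · rintro ⟨h, hh, g, hg, hgh⟩
      have e1 : ∀ (g : Spin n) (a b : E n), (g : Cl n) * vec a * (g⁻¹ : Spin n) = vec b →
          (g : Cl n) * vec a = vec b * g := by
        intro g a b hab
        rw [← hab, mul_assoc, Spin.coe_inv_mul_coe, mul_one]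
      have hh' : (h : Cl n) * vec w = vec (lastVec n) * h := by
        have := e1 _ _ _ hh
        rw [hw]
        simp only [vec, map_smul, smul_mul_assoc, mul_smul_comm] at this ⊢
        rw [this, smul_smul, inv_mul_cancel₀ hu', one_smul]
      have hg' := e1 _ _ _ hg
      -- The same product is evaluated twice: by moving w through h and g, where it becomes eₙ, and
      -- by cancelling the inverses.
      have e2 : (g : Cl n) * ((h * ε.hom γ * h⁻¹ : Spin n) : Cl n) * (g⁻¹ : Spin n) * g * h * vec w
          = eProd n n * (g * h) := by
        rw [hgh, eProd_self_of_odd hn]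
        simp only [mul_assoc]
        rw [hh', ← mul_assoc (g : Cl n), hg', mul_assoc]
      have e3 : (g : Cl n) * ((h * ε.hom γ * h⁻¹ : Spin n) : Cl n) * (g⁻¹ : Spin n) * g * h * vec w
          = g * h * (ε.hom γ * vec w) := by
        simp only [Submonoid.coe_mul, mul_assoc]
        rw [← mul_assoc ((g⁻¹ : Spin n) : Cl n), Spin.coe_inv_mul_coe, one_mul,
          ← mul_assoc ((h⁻¹ : Spin n) : Cl n), Spin.coe_inv_mul_coe, one_mul]
      rw [e3, ← eProd_self_mul_comm hn] at e2
      have e4 : ((h⁻¹ : Spin n) : Cl n) * (g⁻¹ : Spin n) * (g * h) = 1 := by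
        rw [mul_assoc, ← mul_assoc ((g⁻¹ : Spin n) : Cl n), Spin.coe_inv_mul_coe, one_mul,
          Spin.coe_inv_mul_coe]
      have e5 := congrArg (fun y => ((h⁻¹ : Spin n) : Cl n) * (g⁻¹ : Spin n) * y) e2
      simp only [← mul_assoc _ ((g : Cl n) * h), e4, one_mul] at e5
      exact e5
    · intro h
      obtain ⟨k, hk⟩ := exists_spin_conj_eq_lastVec hn2 u
      -- No conjugation in Spin(n-1) is needed: by centrality of ω the conjugate by k already equals
      -- g_m.
      refine ⟨k, hk, 1, by simp, ?_⟩
      have hk' : (k : Cl n) * vec w * (k⁻¹ : Spin n) = vec (lastVec n) := by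
        rw [hw]
        simp only [vec, map_smul, smul_mul_assoc, mul_smul_comm] at hk ⊢
        rw [hk, smul_smul, inv_mul_cancel₀ hu', one_smul]
      have e1 : ((k * ε.hom γ * k⁻¹ : Spin n) : Cl n) * vec (lastVec n) =
          eProd n (2 * (n / 2)) * vec (lastVec n) := by
        rw [← hk', ← mul_assoc, ← mul_assoc, hk', ← eProd_self_of_odd hn]
        simp only [Submonoid.coe_mul, mul_assoc]
        rw [← mul_assoc ((k⁻¹ : Spin n) : Cl n), Spin.coe_inv_mul_coe, one_mul,
          ← mul_assoc (ε.hom γ : Cl n), h, ← eProd_self_mul_comm hn, ← mul_assoc,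
          Spin.coe_mul_coe_inv, one_mul]
      have e2 := congrArg (fun y => y * vec (lastVec n)) e1
      simp only [mul_assoc, vec_sq_of_norm_eq_one hl, mul_neg_one, neg_inj] at e2
      simpa [mul_assoc] using e2
  rw [key]
  have e0 : (ε.hom γ : Cl n) * vec u = ‖u‖ • ((ε.hom γ : Cl n) * vec w) := by
    conv_lhs => rw [huw]
    simp [vec]
  rw [e0, mul_smul]
  congr 1
  split_ifs with h
  · simp [h]
  · simp [hcr.resolve_left h]

end Volume

/-! ### The spin representation -/

section SpinRep

variable {n : ℕ} {S : Type*} [NormedAddCommGroup S] [InnerProductSpace ℂ S]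

/-- Conjugation by M changes the sign of T but not its trace. All vanishing traces below come from
this, except those cancelled by u ↦ -u or lacking a fixed frequency. -/
theorem trace_eq_zero_of_anticommute {W : Type*} [AddCommGroup W] [Module ℂ W]
    {T M M' : Module.End ℂ W} (h : T * M = -(M * T)) (h1 : M * M' = 1) (h2 : M' * M = 1) :
    LinearMap.trace ℂ W T = 0 := by
  have e1 : LinearMap.trace ℂ W T = LinearMap.trace ℂ W (T * M * M') := by
    rw [mul_assoc, h1, mul_one]
  rw [LinearMap.trace_mul_comm, h, mul_neg, ← mul_assoc, h2, one_mul, map_neg] at e1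
  exact CharZero.eq_neg_self_iff.1 e1

theorem commute_of_commute_e {A : Type*} [Ring A] [Algebra ℝ A] (L : Cl n →ₐ[ℝ] A) {X : A}
    (h : ∀ i, L (e i) * X = X * L (e i)) (a : Cl n) : L a * X = X * L a := by
  induction a using CliffordAlgebra.induction with
  | algebraMap r => rw [AlgHom.commutes]; exact Algebra.commutes r X
  | ι v =>
    change L (vec v) * X = X * L (vec v)
    rw [vec_eq_sum, map_sum, Finset.sum_mul, Finset.mul_sum]
    exact Finset.sum_congr rfl fun i _ => by
      rw [map_smul, smul_mul_assoc, mul_smul_comm, h]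
  | mul a b ha hb => rw [map_mul, mul_assoc, hb, ← mul_assoc, ha, mul_assoc]
  | add a b ha hb => rw [map_add, add_mul, mul_add, ha, hb]

/-- Schur's lemma: an eigenspace of X is stable under the Clifford algebra. -/
theorem IsSpinRep.exists_eq_smul_one [FiniteDimensional ℂ S] {L : Cl n →ₐ[ℝ] Module.End ℂ S}
    (hL : IsSpinRep L) {X : Module.End ℂ S} (h : ∀ i, L (e i) * X = X * L (e i)) :
    ∃ c : ℂ, X = c • 1 := by
  have := hL.nontrivial
  obtain ⟨c, hc⟩ := Module.End.exists_eigenvalue X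
  refine ⟨c, ?_⟩
  have hinv : ∀ a : Cl n, ∀ w ∈ X.eigenspace c, L a w ∈ X.eigenspace c := fun a w hw => by
    rw [Module.End.mem_eigenspace_iff] at hw ⊢
    rw [← Module.End.mul_apply, ← commute_of_commute_e L h, Module.End.mul_apply, hw, map_smul]
  have h0 := (hL.irreducible (X.eigenspace c) hinv).resolve_left hc
  ext w
  have : w ∈ X.eigenspace c := h0 ▸ Submodule.mem_top
  simpa using Module.End.mem_eigenspace_iff.1 this

/-- Conjugation by `e_{l+1}` on `End S`. -/
def adE (L : Cl n →ₐ[ℝ] Module.End ℂ S) (i : Fin n) : Module.End ℂ (Module.End ℂ S) :=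
  -(LinearMap.mulLeft ℂ (L (e i)) * LinearMap.mulRight ℂ (L (e i)))

theorem adE_apply (L : Cl n →ₐ[ℝ] Module.End ℂ S) (i : Fin n) (X : Module.End ℂ S) :
    adE L i X = -(L (e i) * X * L (e i)) := by
  simp [adE, mul_assoc]

theorem L_e_sq (L : Cl n →ₐ[ℝ] Module.End ℂ S) (i : Fin n) : L (e i) * L (e i) = -1 := by
  rw [← map_mul, e_sq, map_neg, map_one]

theorem adE_apply_eq_iff (L : Cl n →ₐ[ℝ] Module.End ℂ S) (i : Fin n) (X : Module.End ℂ S) :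
    adE L i X = X ↔ L (e i) * X = X * L (e i) := by
  rw [adE_apply]
  constructor
  · intro h
    conv_rhs => rw [← h]
    rw [neg_mul, mul_assoc, L_e_sq]; simp
  · intro h
    rw [h, mul_assoc, L_e_sq]; simp

theorem adE_mul_self (L : Cl n →ₐ[ℝ] Module.End ℂ S) (i : Fin n) : adE L i * adE L i = 1 := by
  ext X : 1
  rw [Module.End.mul_apply, adE_apply, adE_apply, Module.End.one_apply]
  have := L_e_sq L i
  calc -(L (e i) * -(L (e i) * X * L (e i)) * L (e i))
      = L (e i) * L (e i) * X * (L (e i) * L (e i)) := by noncomm_ring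
    _ = X := by rw [this]; simp

theorem adE_comm (L : Cl n →ₐ[ℝ] Module.End ℂ S) (i j : Fin n) :
    adE L i * adE L j = adE L j * adE L i := by
  by_cases hij : i = j
  · rw [hij]
  ext X : 1
  simp only [Module.End.mul_apply, adE_apply]
  have h : L (e i) * L (e j) = -(L (e j) * L (e i)) := by
    rw [← map_mul, e_mul_e_of_ne hij, map_neg, map_mul]
  calc -(L (e i) * -(L (e j) * X * L (e j)) * L (e i))
      = (L (e i) * L (e j)) * X * (L (e j) * L (e i)) := by noncomm_ring
    _ = -(L (e j) * L (e i)) * X * -(L (e i) * L (e j)) := by rw [h, neg_neg]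
    _ = _ := by noncomm_ring

/-- The average of the conjugations by the products of the first `l` basis vectors. -/
def adAvg (L : Cl n →ₐ[ℝ] Module.End ℂ S) : ℕ → Module.End ℂ (Module.End ℂ S)
  | 0 => 1
  | l + 1 => if h : l < n then (2⁻¹ : ℂ) • (adAvg L l + adE L ⟨l, h⟩ * adAvg L l) else adAvg L l

theorem adAvg_comm (L : Cl n →ₐ[ℝ] Module.End ℂ S) {l : ℕ} {M : Module.End ℂ (Module.End ℂ S)}
    (h : ∀ i : Fin n, (i : ℕ) < l → M * adE L i = adE L i * M) :
    M * adAvg L l = adAvg L l * M := by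
  induction l with
  | zero => simp [adAvg]
  | succ l ih =>
    have ih := ih fun i hi => h i (by omega)
    rw [adAvg]
    split_ifs with hl
    · rw [mul_smul_comm, smul_mul_assoc, mul_add, add_mul, ih, ← mul_assoc, h ⟨l, hl⟩ (by simp),
        mul_assoc, ih, mul_assoc]
    · exact ih

theorem adE_mul_adAvg (L : Cl n →ₐ[ℝ] Module.End ℂ S) {l : ℕ} (i : Fin n) (hi : (i : ℕ) < l) :
    adE L i * adAvg L l = adAvg L l := by
  induction l with
  | zero => omega
  | succ l ih =>
    rw [adAvg]
    split_ifs with hl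
    · rw [mul_smul_comm, mul_add]
      rcases Nat.lt_succ_iff_lt_or_eq.1 hi with h | h
      · rw [ih h, ← mul_assoc, adE_comm, mul_assoc, ih h]
      · have : i = ⟨l, hl⟩ := Fin.ext h
        rw [this, ← mul_assoc, adE_mul_self, one_mul, add_comm]
    · exact ih (by omega)

theorem adAvg_apply_of_fixed (L : Cl n →ₐ[ℝ] Module.End ℂ S) {l : ℕ} {X : Module.End ℂ S}
    (h : ∀ i : Fin n, (i : ℕ) < l → adE L i X = X) : adAvg L l X = X := by
  induction l with
  | zero => simp [adAvg]
  | succ l ih =>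
    have ih := ih fun i hi => h i (by omega)
    rw [adAvg]
    split_ifs with hl
    · rw [LinearMap.smul_apply, LinearMap.add_apply, Module.End.mul_apply, ih,
        h ⟨l, hl⟩ (by simp), ← two_smul ℂ X, smul_smul]
      norm_num
    · exact ih

/-- For even l the product of the vectors with indices l and l+1 works, for odd l the product of the
first l vectors. The bound excludes the last vector in odd dimension, for which the index l+1 does
not exist. -/
theorem exists_eList_anticommute (l : ℕ) (hl : l < 2 * (n / 2)) :
    ∃ p : List (Fin n), (∀ i : Fin n, (i : ℕ) < l → e i * eList p = eList p * e i) ∧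
      e ⟨l, by omega⟩ * eList p = -(eList p * e ⟨l, by omega⟩) := by
  have hln : l < n := by omega
  rcases Nat.even_or_odd l with h | h
  · have hl1 : l + 1 < n := by
      obtain ⟨a, rfl⟩ := h
      omega
    refine ⟨[⟨l, by omega⟩, ⟨l + 1, hl1⟩], fun i hi => ?_, ?_⟩
    · rw [e_mul_eList, List.count_eq_zero_of_not_mem]
      · simp
      · simp [Fin.ext_iff]; omega
    · rw [e_mul_eList, List.count_cons_self, List.count_eq_zero_of_not_mem]
      · norm_num [pow_succ]
      · simp [Fin.ext_iff]
  · refine ⟨(List.finRange n).take l, fun i hi => ?_, ?_⟩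
    · rw [e_mul_eList, List.count_eq_one_of_mem ((List.nodup_finRange n).sublist
        (List.take_sublist _ _)), List.length_take_of_le (by simp; omega)]
      · rw [Even.neg_one_pow (by grind), one_smul]
      · rw [List.mem_take_iff_getElem]
        exact ⟨i, by simp [hi], by simp⟩
    · rw [e_mul_eList, List.count_eq_zero_of_not_mem, List.length_take_of_le (by simp; omega)]
      · rw [Odd.neg_one_pow (by grind), neg_one_smul]
      · rw [List.mem_take_iff_getElem]
        rintro ⟨i, h1, h2⟩
        simp [Fin.ext_iff] at h1 h2
        omega

/-- Each averaging step halves the trace: the new term anticommutes with multiplication by a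
monomial that commutes with all earlier conjugations. -/
theorem trace_adAvg (L : Cl n →ₐ[ℝ] Module.End ℂ S) [FiniteDimensional ℂ S] (l : ℕ)
    (hl : l ≤ 2 * (n / 2)) :
    LinearMap.trace ℂ _ (adAvg L l) = (Module.finrank ℂ S : ℂ) ^ 2 / 2 ^ l := by
  induction l with
  | zero =>
    rw [adAvg, LinearMap.trace_one, Module.finrank_linearMap]
    push_cast; ring
  | succ l ih =>
    have hln : l < n := by omega
    rw [adAvg, dif_pos hln, map_smul, map_add, ih (by omega)]
    obtain ⟨p, h1, h2⟩ := exists_eList_anticommute l (by omega : l < 2 * (n / 2))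
    have key : LinearMap.trace ℂ _ (adE L ⟨l, hln⟩ * adAvg L l) = 0 := by
      refine trace_eq_zero_of_anticommute (M := LinearMap.mulLeft ℂ (L (eList p)))
        (M' := LinearMap.mulLeft ℂ (L (star (eList p)))) ?_ ?_ ?_
      · have hc : LinearMap.mulLeft ℂ (L (eList p)) * adAvg L l =
            adAvg L l * LinearMap.mulLeft ℂ (L (eList p)) := by
          refine adAvg_comm L fun i hi => ?_
          ext X : 1
          simp only [Module.End.mul_apply, adE_apply, LinearMap.mulLeft_apply]
          rw [mul_neg, ← mul_assoc, ← mul_assoc, ← mul_assoc, ← map_mul, ← map_mul, h1 i hi]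
        rw [mul_assoc, ← hc, ← mul_assoc, ← mul_assoc,
          show ∀ a b : Module.End ℂ (Module.End ℂ S), -(a * b) = -a * b from
            fun a b => (neg_mul a b).symm]
        congr 1
        ext X : 1
        simp only [Module.End.mul_apply, adE_apply, LinearMap.mulLeft_apply, LinearMap.neg_apply]
        rw [mul_neg, ← mul_assoc, ← mul_assoc, ← mul_assoc, ← map_mul, ← map_mul, h2]
        simp
      · ext X : 1
        simp only [Module.End.mul_apply, LinearMap.mulLeft_apply]
        rw [← mul_assoc, ← map_mul, eList_mul_star]; simp
      · ext X : 1
        simp only [Module.End.mul_apply, LinearMap.mulLeft_apply]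
        rw [← mul_assoc, ← map_mul, star_mul_eList]; simp
    rw [key, pow_succ, add_zero, smul_eq_mul]
    field_simp
    ring

theorem IsSpinRep.L_eProd_self {L : Cl n →ₐ[ℝ] Module.End ℂ S} (hL : IsSpinRep L) (hn : Odd n) :
    L (eProd n n) = (-(Complex.I ^ (n / 2 + 1))) • 1 := by
  ext w
  simpa using hL.volume hn w

/-- In odd dimension e₁⋯eₙ acts as a scalar, so L(eₙ) is a scalar multiple of the inverse of L(g_m).
This lets even and odd n be treated together. -/
theorem IsSpinRep.commute_of_lt {L : Cl n →ₐ[ℝ] Module.End ℂ S} (hL : IsSpinRep L)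
    {X : Module.End ℂ S} (h : ∀ i : Fin n, (i : ℕ) < 2 * (n / 2) → L (e i) * X = X * L (e i))
    (i : Fin n) : L (e i) * X = X * L (e i) := by
  by_cases hi : (i : ℕ) < 2 * (n / 2)
  · exact h i hi
  have hn : Odd n := by
    rw [← Nat.not_even_iff_odd]
    rintro ⟨a, ha⟩
    have := i.2
    omega
  have hn0 : 0 < n := hn.pos
  have hil : (e i : Cl n) = vec (lastVec n) := by
    rw [← e_last hn0]
    congr 1
    ext
    have := i.2
    simp; omega
  have hz : L (eProd n (2 * (n / 2))) * X = X * L (eProd n (2 * (n / 2))) := by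
    rw [eProd_eq_eList]
    have : ∀ j ∈ (List.finRange n).take (2 * (n / 2)), L (e j) * X = X * L (e j) := by
      intro j hj
      rw [List.mem_take_iff_getElem] at hj
      obtain ⟨a, ha, rfl⟩ := hj
      exact h _ (by simp at ha ⊢; omega)
    generalize (List.finRange n).take (2 * (n / 2)) = p at this
    induction p with
    | nil => simp
    | cons j p ih =>
      rw [eList_cons, map_mul, mul_assoc, ih fun a ha => this a (by simp [ha]), ← mul_assoc,
        this j (by simp), mul_assoc]
  have hs : star (eProd n (2 * (n / 2))) * eProd n (2 * (n / 2)) = 1 := by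
    rw [eProd_eq_eList, star_mul_eList]
  have hs' : eProd n (2 * (n / 2)) * star (eProd n (2 * (n / 2))) = 1 := by
    rw [eProd_eq_eList, eList_mul_star]
  have hz' : L (star (eProd n (2 * (n / 2)))) * X = X * L (star (eProd n (2 * (n / 2)))) := by
    calc L (star (eProd n (2 * (n / 2)))) * X
        = L (star (eProd n (2 * (n / 2)))) * (X * L (eProd n (2 * (n / 2)))) *
          L (star (eProd n (2 * (n / 2)))) := by
            rw [mul_assoc _ (X * _), mul_assoc X, ← map_mul, hs', map_one, mul_one]
      _ = _ := by rw [← hz, ← mul_assoc, ← map_mul, hs, map_one, one_mul]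
  have hlast : L (e i) = (-(Complex.I ^ (n / 2 + 1))) • L (star (eProd n (2 * (n / 2)))) := by
    have := hL.L_eProd_self hn
    rw [eProd_self_of_odd hn, ← hil, map_mul] at this
    have h2 := congrArg (fun y => L (star (eProd n (2 * (n / 2)))) * y) this
    simp only [← mul_assoc, ← map_mul, hs, one_mul] at h2
    rw [h2]
    simp
  rw [hlast, smul_mul_assoc, hz', mul_smul_comm]

/-- By Schur's lemma the full average is a projection of End S onto the scalars. Its trace is 1 on
the one hand and (dim S)²/2^{2m} on the other. -/
theorem IsSpinRep.finrank_eq [FiniteDimensional ℂ S] {L : Cl n →ₐ[ℝ] Module.End ℂ S}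
    (hL : IsSpinRep L) : Module.finrank ℂ S = 2 ^ (n / 2) := by
  have := hL.nontrivial
  have hproj : LinearMap.IsProj (ℂ ∙ (1 : Module.End ℂ S)) (adAvg L (2 * (n / 2))) := by
    constructor
    · intro X
      obtain ⟨c, hc⟩ := hL.exists_eq_smul_one (X := adAvg L (2 * (n / 2)) X)
        (hL.commute_of_lt fun i hi => by
          rw [← adE_apply_eq_iff, ← Module.End.mul_apply, adE_mul_adAvg L i hi])
      rw [hc]
      exact Submodule.smul_mem _ _ (Submodule.mem_span_singleton_self _)
    · intro X hX
      obtain ⟨c, rfl⟩ := Submodule.mem_span_singleton.1 hX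
      refine adAvg_apply_of_fixed L fun i _ => ?_
      rw [adE_apply_eq_iff]; simp
  have h1 := hproj.trace
  rw [trace_adAvg L _ le_rfl, finrank_span_singleton one_ne_zero, Nat.cast_one,
    div_eq_one_iff_eq (pow_ne_zero _ two_ne_zero), pow_mul'] at h1
  have h2 : (Module.finrank ℂ S) ^ 2 = (2 ^ (n / 2)) ^ 2 := by exact_mod_cast h1
  exact Nat.pow_left_injective (by norm_num : 2 ≠ 0) h2

end SpinRep

/-! ### Fourier coefficients of quasi-periodic functions -/

section Fourier

open MeasureTheory UnitAddTorus

variable {n : ℕ} {W : Type*} [NormedAddCommGroup W] [InnerProductSpace ℂ W]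

/-- The half-open unit cube with lower corner `a`. -/
def cubeAt (a : Fin n → ℝ) : Set (Fin n → ℝ) := {x | ∀ i, x i ∈ Set.Ioc (a i) (a i + 1)}

theorem measurableSet_cubeAt (a : Fin n → ℝ) : MeasurableSet (cubeAt a) :=
  MeasurableSet.univ_pi' fun _ => measurableSet_Ioc

theorem cubeAt_subset (a : Fin n → ℝ) : cubeAt a ⊆ Set.Icc a (a + 1) := fun _ hx =>
  ⟨fun i => (hx i).1.le, fun i => (hx i).2⟩

theorem volume_cubeAt (a : Fin n → ℝ) : volume (cubeAt a) = 1 := by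
  have : cubeAt a = Set.univ.pi fun i => Set.Ioc (a i) (a i + 1) := by
    ext x; simp [cubeAt]
  rw [this, Real.volume_pi_Ioc]
  simp

theorem periodic_add_int {β : Type*} {h : (Fin n → ℝ) → β}
    (hp : ∀ i, Function.Periodic h (Pi.single i 1)) (k : Fin n → ℤ) :
    Function.Periodic h (fun i => (k i : ℝ)) := by
  have hk : (fun i => (k i : ℝ)) = ∑ i, k i • (Pi.single i (1 : ℝ) : Fin n → ℝ) := by
    ext j
    simp [Finset.sum_apply, Pi.single_apply]
  rw [hk]
  have : ∀ s : Finset (Fin n),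
      Function.Periodic h (∑ i ∈ s, k i • (Pi.single i (1 : ℝ) : Fin n → ℝ)) := by
    intro s
    induction s using Finset.induction_on with
    | empty => intro x; simp
    | insert a s ha ih =>
      rw [Finset.sum_insert ha]
      exact Function.Periodic.add_period ((hp a).zsmul (k a)) ih
  exact this _

/-- A periodic function factors through the torus. -/
theorem exists_torus_lift {β : Type*} {h : (Fin n → ℝ) → β}
    (hp : ∀ i, Function.Periodic h (Pi.single i 1)) :
    ∃ F : UnitAddTorus (Fin n) → β, ∀ s : Fin n → ℝ, F (fun i => (s i : UnitAddCircle)) = h s := by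
  refine ⟨fun y => h fun i => (y i).out, fun s => ?_⟩
  have : ∀ i, ∃ k : ℤ, ((s i : UnitAddCircle)).out = s i + k := by
    intro i
    have h1 : (((s i : UnitAddCircle)).out : UnitAddCircle) = (s i : UnitAddCircle) :=
      Quotient.out_eq _
    obtain ⟨k, hk⟩ := AddSubgroup.mem_zmultiples_iff.1 (QuotientAddGroup.eq.1 h1.symm)
    exact ⟨k, by rw [zsmul_one] at hk; rw [hk]; ring⟩
  choose k hk using this
  have h2 : (fun i => ((s i : UnitAddCircle)).out) = s + fun i => (k i : ℝ) := by
    ext i; exact hk i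
  change h (fun i => ((s i : UnitAddCircle)).out) = h s
  rw [h2]
  exact periodic_add_int hp k s

/-- Both sides are the integral over the torus of the induced function. -/
theorem setIntegral_cubeAt_eq {h : (Fin n → ℝ) → W}
    (hp : ∀ i, Function.Periodic h (Pi.single i 1)) (a : Fin n → ℝ) :
    ∫ s in cubeAt a, h s = ∫ s in cubeAt 0, h s := by
  obtain ⟨F, hF⟩ := exists_torus_lift hp
  have := (integral_preimage F a).symm.trans (integral_preimage F 0)
  simp only [hF] at this
  exact this

theorem setIntegral_add_cubeAt {h : (Fin n → ℝ) → W}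
    (hp : ∀ i, Function.Periodic h (Pi.single i 1)) (a : Fin n → ℝ) :
    ∫ s in cubeAt 0, h (s + a) = ∫ s in cubeAt 0, h s := by
  rw [← setIntegral_cubeAt_eq hp a]
  have hpre : (fun s : Fin n → ℝ => s + a) ⁻¹' cubeAt a = cubeAt 0 := by
    ext s
    simp only [cubeAt, Set.mem_preimage, Set.mem_ofPred_eq, Set.mem_Ioc, Pi.add_apply, Pi.zero_apply]
    refine forall_congr' fun i => ?_
    constructor <;> rintro ⟨h1, h2⟩ <;> constructor <;> linarith
  rw [← hpre]
  exact (measurePreserving_add_right volume a).setIntegral_preimage_emb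
    (MeasurableEquiv.addRight a).measurableEmbedding h _

/-- Zero coefficients are summable, so the Fourier series converges pointwise to the induced
continuous function on the torus. -/
theorem eq_zero_of_forall_setIntegral_eq_zero {h : (Fin n → ℝ) → ℂ} (hc : Continuous h)
    (hp : ∀ i, Function.Periodic h (Pi.single i 1))
    (h0 : ∀ k : Fin n → ℤ,
      ∫ s in cubeAt 0, Complex.exp (-(2 * Real.pi * Complex.I * (∑ i, k i * s i : ℝ))) * h s = 0) :
    h = 0 := by
  obtain ⟨F, hF⟩ := exists_torus_lift hp
  have hq : IsOpenQuotientMap (Pi.map fun (_ : Fin n) (x : ℝ) => (x : UnitAddCircle)) :=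
    IsOpenQuotientMap.piMap fun _ => QuotientAddGroup.isOpenQuotientMap_mk
  have hFc : Continuous F := by
    rw [hq.isQuotientMap.continuous_iff]
    convert hc using 1
    ext s
    exact hF s
  have hz : mFourierCoeff (⟨F, hFc⟩ : C(UnitAddTorus (Fin n), ℂ)) = 0 := by
    ext k
    rw [mFourierCoeff_eq_integral _ _ 0, Pi.zero_apply, ← h0 k]
    refine setIntegral_congr_fun (measurableSet_cubeAt 0) fun s _ => ?_
    simp only [ContinuousMap.coe_mk, hF, smul_eq_mul]
    congr 1
    simp only [mFourier, ContinuousMap.coe_mk, fourier_coe_apply, ← Complex.exp_sum]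
    congr 1
    push_cast
    rw [Finset.mul_sum, ← Finset.sum_neg_distrib]
    refine Finset.sum_congr rfl fun i _ => ?_
    simp
    ring
  have hs : Summable (mFourierCoeff (⟨F, hFc⟩ : C(UnitAddTorus (Fin n), ℂ))) := by
    rw [hz]; exact summable_zero
  ext s
  have := hasSum_mFourier_series_apply_of_summable hs (fun i => (s i : UnitAddCircle))
  rw [hz] at this
  simp only [Pi.zero_apply, zero_smul, ContinuousMap.coe_mk, hF] at this
  exact this.unique hasSum_zero

theorem integrableOn_cube {W : Type*} [NormedAddCommGroup W] {g : (Fin n → ℝ) → W}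
    (hg : Continuous g) : IntegrableOn g (cubeAt 0) :=
  (hg.continuousOn.integrableOn_compact
    (isCompact_Icc (a := (0 : Fin n → ℝ)) (b := 0 + 1))).mono_set (cubeAt_subset 0)

/-- The direction a need not be a coordinate direction. The derivative is therefore averaged along
the segment from s to s + a. The average is h(s+a) - h(s), with integral 0 by periodicity; by Fubini
and translation invariance the averaging has not changed the integral. -/
theorem setIntegral_fderiv_eq_zero [CompleteSpace W] {h : (Fin n → ℝ) → W} (hc : ContDiff ℝ 1 h)
    (hp : ∀ i, Function.Periodic h (Pi.single i 1)) (a : Fin n → ℝ) :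
    ∫ s in cubeAt 0, fderiv ℝ h s a = 0 := by
  have hc' : Continuous fun s => fderiv ℝ h s a :=
    (hc.continuous_fderiv one_ne_zero).clm_apply continuous_const
  have hp' : ∀ i, Function.Periodic (fun s => fderiv ℝ h s a) (Pi.single i 1) := by
    intro i s
    have : (fun x => h (x + Pi.single i 1)) = h := funext (hp i)
    have h2 := fderiv_comp_add_right (𝕜 := ℝ) (f := h) (x := s) (Pi.single i (1 : ℝ))
    rw [this] at h2
    simp only [h2]
  have h1 : ∀ s, ∫ τ in Set.Ioc (0 : ℝ) 1, fderiv ℝ h (s + τ • a) a = h (s + a) - h s := by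
    intro s
    rw [← intervalIntegral.integral_of_le zero_le_one]
    have := intervalIntegral.integral_eq_sub_of_hasDerivAt (a := 0) (b := 1)
      (f := fun τ : ℝ => h (s + τ • a)) (f' := fun τ => fderiv ℝ h (s + τ • a) a)
      (fun τ _ => ?_) ?_
    · simpa using this
    · have e1 : HasDerivAt (fun τ : ℝ => s + τ • a) a τ := by
        simpa using ((hasDerivAt_id τ).smul_const a).const_add s
      exact ((hc.differentiable one_ne_zero _).hasFDerivAt).comp_hasDerivAt τ e1
    · refine Continuous.intervalIntegrable ?_ _ _
      exact hc'.comp (by fun_prop)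
  have h2 : ∫ s in cubeAt 0, ∫ τ in Set.Ioc (0 : ℝ) 1, fderiv ℝ h (s + τ • a) a = 0 := by
    simp only [h1]
    have h2 : IntegrableOn (fun s => h (s + a)) (cubeAt 0) :=
      integrableOn_cube (hc.continuous.comp (continuous_add_const a))
    rw [integral_sub h2 (integrableOn_cube hc.continuous),
      setIntegral_add_cubeAt hp, sub_self]
  rw [integral_integral_swap] at h2
  · have h3 : ∀ τ : ℝ, ∫ s in cubeAt 0, fderiv ℝ h (s + τ • a) a =
        ∫ s in cubeAt 0, fderiv ℝ h s a := fun τ => setIntegral_add_cubeAt hp' (τ • a)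
    simp only [h3] at h2
    simpa using h2
  · rw [Measure.prod_restrict]
    refine (Continuous.continuousOn ?_).integrableOn_compact
      ((isCompact_Icc (a := (0 : Fin n → ℝ)) (b := 0 + 1)).prod
        (isCompact_Icc (a := (0 : ℝ)) (b := 1))) |>.mono_set
      (Set.prod_mono (cubeAt_subset 0) Set.Ioc_subset_Icc_self)
    exact hc'.comp (by fun_prop)

/-- The character `x ↦ exp(2πi u·x)`. -/
def expChar (u x : E n) : ℂ := Complex.exp (2 * Real.pi * Complex.I * (inner ℝ u x : ℝ))

theorem expChar_add_right (u x y : E n) : expChar u (x + y) = expChar u x * expChar u y := by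
  rw [expChar, expChar, expChar, ← Complex.exp_add, inner_add_right]
  push_cast; ring_nf

theorem expChar_add_left (u v x : E n) : expChar (u + v) x = expChar u x * expChar v x := by
  rw [expChar, expChar, expChar, ← Complex.exp_add, inner_add_left]
  push_cast; ring_nf

@[simp] theorem expChar_zero_right (u : E n) : expChar u 0 = 1 := by simp [expChar]

@[simp] theorem expChar_zero_left (x : E n) : expChar 0 x = 1 := by simp [expChar]

theorem expChar_neg_left (u x : E n) : expChar (-u) x = (expChar u x)⁻¹ := by
  refine eq_inv_of_mul_eq_one_left ?_
  rw [← expChar_add_left]; simp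

theorem expChar_neg_right (u x : E n) : expChar u (-x) = (expChar u x)⁻¹ := by
  refine eq_inv_of_mul_eq_one_left ?_
  rw [← expChar_add_right]; simp

theorem expChar_ne_zero (u x : E n) : expChar u x ≠ 0 := Complex.exp_ne_zero _

theorem contDiff_expChar (u : E n) {N : WithTop ℕ∞} : ContDiff ℝ N (expChar u) := by
  have : ContDiff ℝ N fun x : E n => ((inner ℝ u x : ℝ) : ℂ) :=
    Complex.ofRealCLM.contDiff.comp (contDiff_const.inner ℝ contDiff_id)
  exact (contDiff_const.mul this).cexp

theorem fderiv_expChar (u x v : E n) :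
    fderiv ℝ (expChar u) x v = (2 * Real.pi * Complex.I * (inner ℝ u v : ℝ)) * expChar u x := by
  have h1 : HasFDerivAt (fun x : E n => ((inner ℝ u x : ℝ) : ℂ))
      (Complex.ofRealCLM.comp (innerSL ℝ u)) x :=
    Complex.ofRealCLM.hasFDerivAt.comp x (innerSL ℝ u).hasFDerivAt
  have h2 := (h1.const_mul (2 * Real.pi * Complex.I)).cexp
  have h3 : fderiv ℝ (expChar u) x = _ := h2.fderiv
  rw [h3]
  simp [expChar]
  ring

/-- The Fourier coefficient of `f` at `u`, with respect to the lattice spanned by `b`. -/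
def fourierAt (b : Module.Basis (Fin n) ℝ (E n)) (u : E n) (f : E n → W) : W :=
  ∫ s in cubeAt 0, expChar (-u) (b.equivFun.symm s) • f (b.equivFun.symm s)

theorem continuous_equivFun_symm (b : Module.Basis (Fin n) ℝ (E n)) :
    Continuous b.equivFun.symm :=
  (LinearMap.toContinuousLinearMap (b.equivFun.symm : (Fin n → ℝ) →ₗ[ℝ] E n)).continuous

theorem continuous_fourier_integrand (b : Module.Basis (Fin n) ℝ (E n)) (u : E n) {f : E n → W}
    (hf : Continuous f) :
    Continuous fun s => expChar (-u) (b.equivFun.symm s) • f (b.equivFun.symm s) :=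
  (((contDiff_expChar (N := 0) (-u)).continuous).comp (continuous_equivFun_symm b)).smul
    (hf.comp (continuous_equivFun_symm b))

theorem fourierAt_add (b : Module.Basis (Fin n) ℝ (E n)) (u : E n) {f g : E n → W}
    (hf : Continuous f) (hg : Continuous g) :
    fourierAt b u (fun x => f x + g x) = fourierAt b u f + fourierAt b u g := by
  simp only [fourierAt, smul_add]
  exact integral_add (integrableOn_cube (continuous_fourier_integrand b u hf))
    (integrableOn_cube (continuous_fourier_integrand b u hg))

theorem fourierAt_sum (b : Module.Basis (Fin n) ℝ (E n)) (u : E n) {ι : Type*} (A : Finset ι)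
    {f : ι → E n → W} (hf : ∀ i ∈ A, Continuous (f i)) :
    fourierAt b u (fun x => ∑ i ∈ A, f i x) = ∑ i ∈ A, fourierAt b u (f i) := by
  simp only [fourierAt, Finset.smul_sum]
  exact integral_finsetSum _ fun i hi =>
    integrableOn_cube (continuous_fourier_integrand b u (hf i hi))

theorem fourierAt_map [CompleteSpace W] (b : Module.Basis (Fin n) ℝ (E n)) (u : E n)
    {W' : Type*} [NormedAddCommGroup W'] [InnerProductSpace ℂ W'] [CompleteSpace W']
    (T : W →L[ℂ] W') {f : E n → W}
    (hf : Continuous f) : fourierAt b u (fun x => T (f x)) = T (fourierAt b u f) := by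
  simp only [fourierAt, ← map_smul]
  exact T.integral_comp_comm (integrableOn_cube (continuous_fourier_integrand b u hf))

theorem periodic_fourier_integrand (b : Module.Basis (Fin n) ℝ (E n)) (u : E n) {f : E n → W}
    (hp : ∀ j x, f (x + b j) = expChar u (b j) • f x) (i : Fin n) :
    Function.Periodic (fun s => expChar (-u) (b.equivFun.symm s) • f (b.equivFun.symm s))
      (Pi.single i 1) := by
  intro s
  have : b.equivFun.symm (s + Pi.single i 1) = b.equivFun.symm s + b i := by
    rw [map_add, Module.Basis.equivFun_symm_apply _ (Pi.single i 1)]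
    simp [Pi.single_apply]
  simp only [this, expChar_add_right, hp, smul_smul]
  rw [expChar_neg_left u (b i), mul_assoc, inv_mul_cancel₀ (expChar_ne_zero _ _), mul_one]

/-- Integration by parts without boundary terms: f has the same multipliers as e^{2πi u·x}, so
e^{-2πi u·x} f is periodic and its derivative has integral 0. -/
theorem fourierAt_fderiv [CompleteSpace W] (b : Module.Basis (Fin n) ℝ (E n)) (u v : E n)
    {f : E n → W} (hf : ContDiff ℝ 1 f) (hp : ∀ j x, f (x + b j) = expChar u (b j) • f x) :
    fourierAt b u (fun x => fderiv ℝ f x v) =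
      (2 * Real.pi * Complex.I * (inner ℝ u v : ℝ)) • fourierAt b u f := by
  set φ : (Fin n → ℝ) →L[ℝ] E n :=
    LinearMap.toContinuousLinearMap (b.equivFun.symm : (Fin n → ℝ) →ₗ[ℝ] E n) with hφ
  set a := b.equivFun v with ha
  have hφa : φ a = v := by rw [hφ, ha]; simp
  have hc' : Continuous fun x => fderiv ℝ f x v :=
    (hf.continuous_fderiv one_ne_zero).clm_apply continuous_const
  have h0 := setIntegral_fderiv_eq_zero (h := fun s => expChar (-u) (φ s) • f (φ s))
    (((contDiff_expChar (-u)).comp φ.contDiff).smul (hf.comp φ.contDiff))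
    (periodic_fourier_integrand b u hp) a
  have h1 : ∀ s, fderiv ℝ (fun s => expChar (-u) (φ s) • f (φ s)) s a =
      expChar (-u) (φ s) • fderiv ℝ f (φ s) v -
        (2 * Real.pi * Complex.I * (inner ℝ u v : ℝ)) • expChar (-u) (φ s) • f (φ s) := by
    intro s
    have e1 : HasFDerivAt (fun s => expChar (-u) (φ s))
        ((fderiv ℝ (expChar (-u)) (φ s)).comp φ) s :=
      (((contDiff_expChar (N := 1) (-u)).differentiable one_ne_zero _).hasFDerivAt).comp s
        φ.hasFDerivAt
    have e2 : HasFDerivAt (fun s => f (φ s)) ((fderiv ℝ f (φ s)).comp φ) s :=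
      ((hf.differentiable one_ne_zero _).hasFDerivAt).comp s φ.hasFDerivAt
    have e3 : fderiv ℝ (fun s => expChar (-u) (φ s) • f (φ s)) s = _ := (e1.smul e2).fderiv
    rw [e3]
    simp only [add_apply, smul_apply,
      ContinuousLinearMap.comp_apply, ContinuousLinearMap.smulRight_apply, hφa, fderiv_expChar,
      inner_neg_left]
    rw [sub_eq_add_neg, smul_smul, ← neg_smul]
    congr 2
    push_cast; ring
  simp only [h1] at h0
  rw [integral_sub, integral_smul, sub_eq_zero] at h0
  · exact h0
  · exact integrableOn_cube (continuous_fourier_integrand b u hc')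
  · exact (integrableOn_cube (continuous_fourier_integrand b u hf.continuous)).smul _

theorem fourierAt_expChar_self [CompleteSpace W] (b : Module.Basis (Fin n) ℝ (E n)) (u : E n)
    (w : W) : fourierAt b u (fun x => expChar u x • w) = w := by
  simp only [fourierAt, smul_smul, ← expChar_add_left, neg_add_cancel, expChar_zero_left, one_smul]
  simp [Measure.real, volume_cubeAt]

/-- Differentiation in the direction u - v multiplies the coefficient by 2πi u·(u-v) and, computed
directly, by 2πi v·(u-v). These factors differ by 2πi‖u-v‖² ≠ 0. -/
theorem fourierAt_expChar_of_ne [CompleteSpace W] (b : Module.Basis (Fin n) ℝ (E n)) {u v : E n}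
    (h : ∀ j, expChar u (b j) = expChar v (b j)) (huv : u ≠ v) (w : W) :
    fourierAt b u (fun x => expChar v x • w) = 0 := by
  have h1 := fourierAt_fderiv b u (u - v) (f := fun x => expChar v x • w)
    ((contDiff_expChar v).smul contDiff_const)
    (fun j x => by rw [expChar_add_right, h, mul_comm, mul_smul])
  have h2 : (fun x => fderiv ℝ (fun x => expChar v x • w) x (u - v)) =
      fun x => expChar v x • ((2 * Real.pi * Complex.I * (inner ℝ v (u - v) : ℝ)) • w) := by
    ext x
    have e1 : HasFDerivAt (expChar v) (fderiv ℝ (expChar v) x) x :=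
      ((contDiff_expChar (N := 1) v).differentiable one_ne_zero _).hasFDerivAt
    rw [(e1.smul_const w).fderiv]
    simp only [ContinuousLinearMap.smulRight_apply, fderiv_expChar]
    rw [smul_smul, mul_comm]
  have h3 := fourierAt_map b u ((2 * Real.pi * Complex.I * (inner ℝ v (u - v) : ℝ)) •
    ContinuousLinearMap.id ℂ W) (f := fun x => expChar v x • w)
    (((contDiff_expChar (N := 0) v).continuous).smul continuous_const)
  simp only [smul_apply, ContinuousLinearMap.id_apply, smul_comm _ (expChar v _)]
    at h3
  rw [h2, h3, ← sub_eq_zero, ← sub_smul] at h1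
  refine (smul_eq_zero.1 h1).resolve_left ?_
  rw [← mul_sub, ← Complex.ofReal_sub, ← inner_sub_left]
  refine mul_ne_zero (by simp [Real.pi_ne_zero]) ?_
  rw [Complex.ofReal_ne_zero, ← neg_sub u v, inner_neg_left, neg_ne_zero,
    real_inner_self_eq_norm_sq]
  simpa [sub_eq_zero] using huv

theorem exists_inner_basis_eq (b : Module.Basis (Fin n) ℝ (E n)) (c : Fin n → ℝ) :
    ∃ u : E n, ∀ j, inner ℝ u (b j) = c j := by
  refine ⟨(InnerProductSpace.toDual ℝ (E n)).symm
    (LinearMap.toContinuousLinearMap (b.constr ℝ c)), fun j => ?_⟩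
  rw [InnerProductSpace.toDual_symm_apply]
  simp

theorem eq_zero_of_fourierAt_eq_zero [CompleteSpace W] (b : Module.Basis (Fin n) ℝ (E n)) (u : E n)
    {f : E n → W} (hf : Continuous f) (hp : ∀ j x, f (x + b j) = expChar u (b j) • f x)
    (h0 : ∀ v, (∀ j, expChar v (b j) = expChar u (b j)) → fourierAt b v f = 0) : f = 0 := by
  ext x
  refine ext_inner_left ℂ fun w => ?_
  rw [Pi.zero_apply, inner_zero_right]
  have key := eq_zero_of_forall_setIntegral_eq_zero
    (h := fun s => expChar (-u) (b.equivFun.symm s) • inner ℂ w (f (b.equivFun.symm s)))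
    (continuous_fourier_integrand b u (f := fun x => inner ℂ w (f x)) (continuous_const.inner hf))
    (periodic_fourier_integrand b u (f := fun x => inner ℂ w (f x)) fun j x => by rw [hp, inner_smul_right, smul_eq_mul])
    (fun k => ?_)
  · have := congrFun key (b.equivFun x)
    simp only [LinearEquiv.symm_apply_apply, Pi.zero_apply] at this
    exact (smul_eq_zero.1 this).resolve_left (expChar_ne_zero _ _)
  -- The integer frequency k corresponds to the dual vector v with v·b_j = k_j; the k-th coefficient
  -- of the periodic function is the one of f at u + v, paired with w.
  · obtain ⟨v, hv⟩ := exists_inner_basis_eq b fun j => (k j : ℝ)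
    have h1 := h0 (u + v) fun j => by
      rw [expChar_add_left, expChar, expChar, hv, Complex.ofReal_intCast,
        mul_comm _ (k j : ℂ), Complex.exp_int_mul_two_pi_mul_I, mul_one]
    have h2 := fourierAt_map b (u + v) (innerSL ℂ w) hf
    rw [h1, map_zero, fourierAt] at h2
    rw [← h2]
    refine setIntegral_congr_fun (measurableSet_cubeAt 0) fun s _ => ?_
    have h3 : inner ℝ v (b.equivFun.symm s) = ∑ i, k i * s i := by
      rw [Module.Basis.equivFun_symm_apply, inner_sum]
      exact Finset.sum_congr rfl fun i _ => by rw [inner_smul_right, hv, mul_comm]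
    simp only [neg_add, expChar_add_left, smul_eq_mul, innerSL_apply_apply]
    rw [← mul_assoc, mul_comm (Complex.exp _)]
    congr 2
    rw [expChar, inner_neg_left, h3]
    push_cast; ring_nf

end Fourier

/-! ### The translation lattice -/

section Lattice

variable {n k : ℕ} {Γ : Subgroup (Isom n)}

theorem rot_transl (v : E n) : rot n (transl v) = 1 := by
  ext x
  rfl

theorem eq_transl_of_rot_eq_one {γ : Isom n} (h : rot n γ = 1) : γ = transl (transPart γ) := by
  ext1 x
  rw [apply_eq, h]
  simp [add_comm]

theorem isom_mul_apply (γ γ' : Isom n) (x : E n) : (γ * γ') x = γ (γ' x) := rfl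

theorem transPart_mul (γ γ' : Isom n) :
    transPart (γ * γ') = transPart γ' + (rot n γ').symm (transPart γ) := by
  rw [transPart, LinearIsometryEquiv.symm_apply_eq]
  rw [isom_mul_apply, apply_eq γ, apply_eq γ' 0, map_mul]
  change _ = rot n γ (rot n γ' _)
  rw [zero_add, map_add (rot n γ') (transPart γ'), LinearIsometryEquiv.apply_symm_apply]

theorem transPart_mul_transl (γ : Isom n) (v : E n) :
    transPart (γ * transl v) = transPart γ + v := by
  rw [transPart_mul, rot_transl]
  have : transPart (transl v) = v := by
    rw [transPart, rot_transl, LinearIsometryEquiv.symm_apply_eq]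
    simp
  rw [this, add_comm]
  rfl

theorem exists_mul_transl {γ γ' : Isom n} (hγ : γ ∈ Γ) (hγ' : γ' ∈ Γ) (h : rot n γ = rot n γ') :
    ∃ v ∈ lattice Γ, γ' = γ * transl v := by
  have h1 : rot n (γ⁻¹ * γ') = 1 := by rw [map_mul, map_inv, h, inv_mul_cancel]
  have h2 := eq_transl_of_rot_eq_one h1
  refine ⟨transPart (γ⁻¹ * γ'), ?_, ?_⟩
  · change transl _ ∈ Γ
    rw [← h2]
    exact Γ.mul_mem (Γ.inv_mem hγ) hγ'
  · rw [← h2, mul_inv_cancel_left]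

theorem conj_transl (γ : Isom n) (v : E n) : γ * transl v * γ⁻¹ = transl (rot n γ v) := by
  rw [mul_inv_eq_iff_eq_mul]
  ext1 x
  simp only [isom_mul_apply, AffineIsometryEquiv.coe_constVAdd, vadd_eq_add]
  rw [apply_eq γ (v + x), apply_eq γ x, ← map_add, add_assoc]

theorem rot_mem_lattice {γ : Isom n} (hγ : γ ∈ Γ) {v : E n} (hv : v ∈ lattice Γ) :
    rot n γ v ∈ lattice Γ := by
  change transl _ ∈ Γ
  rw [← conj_transl]
  exact Γ.mul_mem (Γ.mul_mem hγ hv) (Γ.inv_mem hγ)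

theorem finite_holonomy (hF : Nonempty (holonomy Γ ≃* Multiplicative (Fin k → ZMod 2))) :
    Finite (holonomy Γ) := by
  obtain ⟨φ⟩ := hF
  have : Finite (Multiplicative (Fin k → ZMod 2)) := inferInstanceAs (Finite (Fin k → ZMod 2))
  exact Finite.of_equiv _ φ.symm.toEquiv

theorem card_holonomy (hF : Nonempty (holonomy Γ ≃* Multiplicative (Fin k → ZMod 2))) :
    Nat.card (holonomy Γ) = 2 ^ k := by
  obtain ⟨φ⟩ := hF
  rw [Nat.card_congr φ.toEquiv]
  change Nat.card (Fin k → ZMod 2) = _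
  simp

theorem holonomy_mul_self (hF : Nonempty (holonomy Γ ≃* Multiplicative (Fin k → ZMod 2)))
    {B : E n ≃ₗᵢ[ℝ] E n} (hB : B ∈ holonomy Γ) : B * B = 1 := by
  obtain ⟨φ⟩ := hF
  have h : (⟨B, hB⟩ : holonomy Γ) * ⟨B, hB⟩ = 1 := by
    apply φ.injective
    rw [map_mul, map_one]
    apply Multiplicative.toAdd.injective
    ext i
    exact CharTwo.add_self_eq_zero _
  exact congrArg Subtype.val h

theorem holonomy_comm (hF : Nonempty (holonomy Γ ≃* Multiplicative (Fin k → ZMod 2)))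
    {B C : E n ≃ₗᵢ[ℝ] E n} (hB : B ∈ holonomy Γ) (hC : C ∈ holonomy Γ) : B * C = C * B := by
  obtain ⟨φ⟩ := hF
  have h : (⟨B, hB⟩ : holonomy Γ) * ⟨C, hC⟩ = ⟨C, hC⟩ * ⟨B, hB⟩ := by
    apply φ.injective
    rw [map_mul, map_mul, mul_comm]
  exact congrArg Subtype.val h

theorem rot_mem_holonomy (γ : Γ) : rot n (γ : Isom n) ∈ holonomy Γ := ⟨γ, γ.2, rfl⟩

theorem rot_rot (hF : Nonempty (holonomy Γ ≃* Multiplicative (Fin k → ZMod 2))) (γ : Γ) (v : E n) :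
    rot n (γ : Isom n) (rot n (γ : Isom n) v) = v :=
  DFunLike.congr_fun (holonomy_mul_self hF (rot_mem_holonomy γ)) v

theorem rot_symm (hF : Nonempty (holonomy Γ ≃* Multiplicative (Fin k → ZMod 2))) (γ : Γ) (v : E n) :
    (rot n (γ : Isom n)).symm v = rot n (γ : Isom n) v := by
  rw [LinearIsometryEquiv.symm_apply_eq, rot_rot hF]

theorem discreteTopology_lattice (hΓ : IsBieberbach Γ) : DiscreteTopology (lattice Γ) := by
  have := hΓ.discrete
  let j : lattice Γ → (fun γ : Isom n => (γ : E n → E n)) '' (Γ : Set (Isom n)) :=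
    fun v => ⟨fun x => (v : E n) + x, ⟨transl (v : E n), v.2, rfl⟩⟩
  have hj : Continuous j :=
    Continuous.subtype_mk (continuous_pi fun x => continuous_subtype_val.add continuous_const) _
  refine DiscreteTopology.of_continuous_injective hj fun v w h => ?_
  have h2 := congrFun (congrArg Subtype.val h) 0
  simpa [j] using h2

/-- F is finite, so every γ is one of finitely many representatives times a translation of Λ. Thus
cocompactness passes from Γ to Λ, without Bieberbach's theorem. -/
theorem exists_norm_add_le (hΓ : IsBieberbach Γ)
    (hF : Nonempty (holonomy Γ ≃* Multiplicative (Fin k → ZMod 2))) :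
    ∃ R : ℝ, ∀ x : E n, ∃ v ∈ lattice Γ, ‖x + v‖ ≤ R := by
  have := finite_holonomy hF
  obtain ⟨K, hK, hcov⟩ := hΓ.cocompact
  obtain ⟨R, hR⟩ := hK.isBounded.exists_norm_le
  have hch : ∀ B : holonomy Γ, ∃ γ : Isom n, γ ∈ Γ ∧ rot n γ = B := fun B => B.2
  choose g hg hgB using hch
  obtain ⟨M, hM⟩ : ∃ M : ℝ, ∀ B, ‖transPart (g B)‖ ≤ M := by
    obtain ⟨M, hM⟩ := (Set.finite_range fun B => ‖transPart (g B)‖).bddAbove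
    exact ⟨M, fun B => hM ⟨B, rfl⟩⟩
  refine ⟨R + M, fun x => ?_⟩
  obtain ⟨γ, hγ, hx⟩ := hcov x
  obtain ⟨v, hv, hγv⟩ := exists_mul_transl (hg ⟨rot n γ, γ, hγ, rfl⟩) hγ (hgB _)
  refine ⟨v, hv, ?_⟩
  have h1 := hR _ hx
  rw [hγv, isom_mul_apply, apply_eq, LinearIsometryEquiv.norm_map] at h1
  have h2 := norm_le_norm_add_norm_sub (transl v x + transPart (g ⟨rot n γ, γ, hγ, rfl⟩)) (transl v x)
  have h3 : ‖transl v x‖ ≤ ‖transl v x + transPart (g ⟨rot n γ, γ, hγ, rfl⟩)‖ +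
      ‖transPart (g ⟨rot n γ, γ, hγ, rfl⟩)‖ := by
    simpa using norm_sub_le (transl v x + transPart (g ⟨rot n γ, γ, hγ, rfl⟩))
      (transPart (g ⟨rot n γ, γ, hγ, rfl⟩))
  have h4 : x + v = transl v x := by simp [add_comm]
  rw [h4]
  linarith [hM ⟨rot n γ, γ, hγ, rfl⟩]

/-- A vector orthogonal to Λ never gets shorter under translations in Λ, so a long one could not be
moved into the ball of radius R. -/
theorem span_lattice (hΓ : IsBieberbach Γ)
    (hF : Nonempty (holonomy Γ ≃* Multiplicative (Fin k → ZMod 2))) :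
    Submodule.span ℝ (lattice Γ : Set (E n)) = ⊤ := by
  obtain ⟨R, hR⟩ := exists_norm_add_le hΓ hF
  rw [← Submodule.orthogonal_eq_bot_iff, Submodule.eq_bot_iff]
  intro w hw
  by_contra hw0
  have hwn : 0 < ‖w‖ := by simpa using hw0
  obtain ⟨v, hv, h⟩ := hR (((|R| + 1) / ‖w‖) • w)
  have h1 : inner ℝ (((|R| + 1) / ‖w‖) • w) v = 0 := by
    rw [inner_smul_left, real_inner_comm,
      (Submodule.mem_orthogonal _ _).1 hw v (Submodule.subset_span hv), mul_zero]
  have h2 := norm_add_sq_eq_norm_sq_add_norm_sq_of_inner_eq_zero _ _ h1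
  have h3 : ‖((|R| + 1) / ‖w‖) • w‖ = |R| + 1 := by
    rw [norm_smul, Real.norm_of_nonneg (by positivity), div_mul_cancel₀ _ hwn.ne']
  rw [h3] at h2
  have h4 := le_abs_self R
  have h5 := norm_nonneg (((|R| + 1) / ‖w‖) • w + v)
  have h6 : ‖((|R| + 1) / ‖w‖) • w + v‖ ≤ |R| := h.trans h4
  nlinarith [norm_nonneg v, abs_nonneg R]

theorem exists_real_basis (hΓ : IsBieberbach Γ)
    (hF : Nonempty (holonomy Γ ≃* Multiplicative (Fin k → ZMod 2)))
    (b : Module.Basis (Fin n) ℤ (lattice Γ)) :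
    ∃ b' : Module.Basis (Fin n) ℝ (E n), ∀ j, b' j = b j := by
  have : DiscreteTopology (AddSubgroup.toIntSubmodule (lattice Γ)) := discreteTopology_lattice hΓ
  have : IsZLattice ℝ (AddSubgroup.toIntSubmodule (lattice Γ)) := ⟨span_lattice hΓ hF⟩
  let b2 : Module.Basis (Fin n) ℤ (AddSubgroup.toIntSubmodule (lattice Γ)) := b
  exact ⟨b2.ofZLatticeBasis ℝ _, fun j => Module.Basis.ofZLatticeBasis_apply ℝ _ b2 j⟩

theorem exists_lattice_basis (hΓ : IsBieberbach Γ)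
    (hF : Nonempty (holonomy Γ ≃* Multiplicative (Fin k → ZMod 2))) :
    Nonempty (Module.Basis (Fin n) ℤ (lattice Γ)) := by
  have : DiscreteTopology (AddSubgroup.toIntSubmodule (lattice Γ)) := discreteTopology_lattice hΓ
  have : IsZLattice ℝ (AddSubgroup.toIntSubmodule (lattice Γ)) := ⟨span_lattice hΓ hF⟩
  have h1 := ZLattice.rank ℝ (AddSubgroup.toIntSubmodule (lattice Γ))
  rw [finrank_euclideanSpace_fin] at h1
  let b := Module.finBasisOfFinrankEq ℤ (AddSubgroup.toIntSubmodule (lattice Γ)) h1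
  exact ⟨b⟩

/-! ### The character of the lattice and its dual coset -/

variable (ε : SpinStructure Γ)

instance : CharZero (Cl n) := charZero_of_injective_algebraMap (algebraMap_Cl_injective (n := n))

theorem SpinStructure.delta_eq (v : lattice Γ) : ε.delta v = 1 ∨ ε.delta v = -1 := by
  unfold SpinStructure.delta
  split_ifs <;> simp

theorem SpinStructure.delta_mul_self (v : lattice Γ) : ε.delta v * ε.delta v = 1 := by
  rcases ε.delta_eq v with h | h <;> simp [h]

theorem SpinStructure.coe_hom_eq_one_or_neg_one {γ : Γ} (h : rot n (γ : Isom n) = 1) :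
    (ε.hom γ : Cl n) = 1 ∨ (ε.hom γ : Cl n) = -1 :=
  Spin.coe_eq_one_or_neg_one _ fun v => by rw [ε.hom_mul_vec, h]; rfl

theorem SpinStructure.coe_hom_latticeElt (v : lattice Γ) :
    (ε.hom (latticeElt v) : Cl n) = (ε.delta v : ℤ) := by
  unfold SpinStructure.delta
  split_ifs with h
  · simp [h]
  · have := (ε.coe_hom_eq_one_or_neg_one (γ := latticeElt v) (rot_transl _)).resolve_left
      fun h' => h (Subtype.ext h')
    simp [this]

theorem SpinStructure.delta_add (v w : lattice Γ) :
    ε.delta (v + w) = ε.delta v * ε.delta w := by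
  have h : (latticeElt (v + w) : Γ) = latticeElt v * latticeElt w := by
    apply Subtype.ext
    ext1 x
    simp [latticeElt, add_assoc]
  have h2 := congrArg (fun g => (ε.hom g : Cl n)) h
  simp only [map_mul, Submonoid.coe_mul, ε.coe_hom_latticeElt] at h2
  exact_mod_cast h2

theorem SpinStructure.delta_zero : ε.delta 0 = 1 := by
  have := ε.delta_add 0 0
  rw [add_zero] at this
  rcases ε.delta_eq 0 with h | h <;> simp [h] at this ⊢

theorem SpinStructure.delta_neg (v : lattice Γ) : ε.delta (-v) = ε.delta v := by
  have h := ε.delta_add v (-v)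
  rw [add_neg_cancel, ε.delta_zero] at h
  rcases ε.delta_eq v with h1 | h1 <;> rcases ε.delta_eq (-v) with h2 | h2 <;> simp [h1, h2] at h ⊢

theorem SpinStructure.delta_zsmul (v : lattice Γ) (c : ℤ) :
    ε.delta (c • v) = if Even c then 1 else ε.delta v := by
  have h2 : ∀ a : ℤ, ε.delta ((a + a) • v) = 1 := fun a => by
    rw [add_smul, ε.delta_add, ε.delta_mul_self]
  split_ifs with h
  · obtain ⟨a, rfl⟩ := h
    exact h2 a
  · obtain ⟨a, rfl⟩ := Int.not_even_iff_odd.1 h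
    rw [add_smul, two_mul, ε.delta_add, h2, one_smul, one_mul]

theorem SpinStructure.trivialType_iff : ε.TrivialType ↔ ∀ v, ε.delta v = 1 := by
  refine forall_congr' fun v => ?_
  unfold SpinStructure.delta
  split_ifs with h <;> simp [h]

/-- Conjugation by ε(γ) does not affect a central ±1. -/
theorem SpinStructure.delta_rot (γ : Γ) (v : lattice Γ) :
    ε.delta ⟨rot n (γ : Isom n) v, rot_mem_lattice γ.2 v.2⟩ = ε.delta v := by
  have h : latticeElt ⟨rot n (γ : Isom n) v, rot_mem_lattice γ.2 v.2⟩ =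
      γ * latticeElt v * γ⁻¹ := Subtype.ext (conj_transl _ _).symm
  have h2 := congrArg (fun g => (ε.hom g : Cl n)) h
  simp only [map_mul, Submonoid.coe_mul, ε.coe_hom_latticeElt, map_inv] at h2
  rw [← Int.cast_comm, mul_assoc, Spin.coe_mul_coe_inv, mul_one] at h2
  exact_mod_cast h2

theorem SpinStructure.mem_dualCoset {u : E n} :
    u ∈ ε.dualCoset ↔ ∀ v : lattice Γ, expChar u v = ε.delta v :=
  forall_congr' fun _ => eq_comm

theorem SpinStructure.mem_dualCoset_of_basis (b : Module.Basis (Fin n) ℤ (lattice Γ)) {u : E n}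
    (h : ∀ j, expChar u (b j : E n) = ε.delta (b j)) : u ∈ ε.dualCoset := by
  rw [ε.mem_dualCoset]
  intro v
  have hv : v ∈ Submodule.span ℤ (Set.range b) := by rw [b.span_eq]; trivial
  induction hv using Submodule.closure_induction with
  | zero => simp [ε.delta_zero]
  | add x y _ _ hx hy =>
    rw [AddSubgroup.coe_add, expChar_add_right, hx, hy, ε.delta_add]; push_cast; rfl
  | smul_mem r x hx =>
    obtain ⟨j, rfl⟩ := hx
    have h1 : ∀ r : ℕ, expChar u ((r • b j : lattice Γ) : E n) = ε.delta (r • b j) := by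
      intro r
      induction r with
      | zero => simp [ε.delta_zero]
      | succ r ih =>
        rw [succ_nsmul, AddSubgroup.coe_add, expChar_add_right, ih, h, ε.delta_add]
        push_cast; rfl
    obtain ⟨r, rfl | rfl⟩ := r.eq_nat_or_neg
    · rw [natCast_zsmul]; exact h1 r
    · rw [neg_smul, natCast_zsmul, ε.delta_neg, AddSubgroup.coe_neg, expChar_neg_right, h1]
      rcases ε.delta_eq (r • b j) with h | h <;> simp [h, inv_neg]

theorem SpinStructure.dualCoset_nonempty (hΓ : IsBieberbach Γ)
    (hF : Nonempty (holonomy Γ ≃* Multiplicative (Fin k → ZMod 2))) : ε.dualCoset.Nonempty := by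
  obtain ⟨b⟩ := exists_lattice_basis hΓ hF
  obtain ⟨b', hb'⟩ := exists_real_basis hΓ hF b
  obtain ⟨u, hu⟩ := exists_inner_basis_eq b' fun j => if ε.delta (b j) = 1 then 0 else 1 / 2
  refine ⟨u, ε.mem_dualCoset_of_basis b fun j => ?_⟩
  rw [expChar, ← hb', hu]
  rcases ε.delta_eq (b j) with h | h
  · simp [h]
  · rw [if_neg (by rw [h]; decide), h]
    have : (2 * Real.pi * Complex.I * ((1 / 2 : ℝ) : ℂ)) = Real.pi * Complex.I := by
      push_cast; ring
    rw [this, Complex.exp_pi_mul_I]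
    simp

theorem SpinStructure.neg_mem_dualCoset {u : E n} (h : u ∈ ε.dualCoset) : -u ∈ ε.dualCoset := by
  rw [ε.mem_dualCoset] at h ⊢
  intro v
  rw [expChar_neg_left, h]
  rcases ε.delta_eq v with h | h <;> simp [h, inv_neg]

theorem expChar_rot (B : E n ≃ₗᵢ[ℝ] E n) (u x : E n) : expChar (B u) (B x) = expChar u x := by
  rw [expChar, expChar, LinearIsometryEquiv.inner_map_map]

theorem SpinStructure.rot_mem_dualCoset (γ : Γ) {u : E n}
    (h : u ∈ ε.dualCoset) : rot n (γ : Isom n) u ∈ ε.dualCoset := by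
  rw [ε.mem_dualCoset] at h ⊢
  intro v
  have hv := rot_mem_lattice (Γ.inv_mem γ.2) v.2
  have h1 := ε.delta_rot γ ⟨_, hv⟩
  have h2 : rot n (γ : Isom n) (rot n (γ : Isom n)⁻¹ v) = v := by
    rw [map_inv]; exact LinearIsometryEquiv.apply_symm_apply _ _
  have h3 := h ⟨_, hv⟩
  rw [← h1, ← expChar_rot (rot n (γ : Isom n))] at h3
  simpa only [h2] using h3

/-- An element u of the coset is determined by the numbers 2u·b_j, which are integers bounded by
2μ‖b_j‖. -/
theorem SpinStructure.finite_dualSphere (hΓ : IsBieberbach Γ)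
    (hF : Nonempty (holonomy Γ ≃* Multiplicative (Fin k → ZMod 2))) (μ : ℝ) :
    (ε.dualSphere μ).Finite := by
  obtain ⟨b⟩ := exists_lattice_basis hΓ hF
  obtain ⟨b', hb'⟩ := exists_real_basis hΓ hF b
  have hint : ∀ u ∈ ε.dualCoset, ∀ j, ∃ a : ℤ, 2 * inner ℝ u (b' j) = a := by
    intro u hu j
    have h1 := ε.mem_dualCoset.1 hu (b j)
    have h2 : expChar u (b j : E n) * expChar u (b j : E n) = 1 := by
      rw [h1]; exact_mod_cast ε.delta_mul_self (b j)
    rw [expChar, ← Complex.exp_add, Complex.exp_eq_one_iff] at h2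
    obtain ⟨a, ha⟩ := h2
    refine ⟨a, ?_⟩
    rw [hb']
    have h3 : ((2 * inner ℝ u (b j : E n) : ℝ) : ℂ) * (2 * Real.pi * Complex.I) =
        a * (2 * Real.pi * Complex.I) := by rw [← ha]; push_cast; ring
    have h4 := mul_right_cancel₀ (by simp [Real.pi_ne_zero]) h3
    exact_mod_cast h4
  -- The floor only reads the real number 2u·b_j as the integer that it is.
  refine Set.Finite.of_finite_image (f := fun u => fun j => ⌊2 * inner ℝ u (b' j)⌋)
    ((Set.finite_Icc (fun j => ⌊-(2 * (μ * ‖b' j‖))⌋) (fun j => ⌊2 * (μ * ‖b' j‖)⌋)).subset ?_) ?_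
  · rintro _ ⟨u, ⟨-, hu⟩, rfl⟩
    have h1 : ∀ j, |inner ℝ u (b' j)| ≤ μ * ‖b' j‖ := fun j => hu ▸ abs_real_inner_le_norm u (b' j)
    exact ⟨fun j => Int.floor_le_floor (by linarith [(abs_le.1 (h1 j)).1]),
      fun j => Int.floor_le_floor (by linarith [(abs_le.1 (h1 j)).2])⟩
  · rintro u ⟨hu, -⟩ v ⟨hv, -⟩ huv
    suffices h : innerₗ (E n) u = innerₗ (E n) v from
      ext_inner_right ℝ fun x => LinearMap.congr_fun h x
    refine b'.ext fun j => ?_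
    rw [innerₗ_apply_apply, innerₗ_apply_apply]
    obtain ⟨a, ha⟩ := hint u hu j
    obtain ⟨c, hc⟩ := hint v hv j
    have := congrFun huv j
    simp only [ha, hc, Int.floor_intCast] at this
    rw [this, ← hc] at ha
    linarith

end Lattice

/-! ### The endomorphisms `A ⊗ C` of the spinor space -/

section TensorAct

variable {S : Type*} [NormedAddCommGroup S] [InnerProductSpace ℂ S]
  {V : Type*} [NormedAddCommGroup V] [InnerProductSpace ℂ V]

instance [FiniteDimensional ℂ S] [FiniteDimensional ℂ V] : FiniteDimensional ℂ (Spinor S V) :=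
  inferInstanceAs (FiniteDimensional ℂ (S ⊗[ℂ] V))

theorem tensorAct_mul (A A' : Module.End ℂ S) (C C' : Module.End ℂ V) (w : Spinor S V) :
    tensorAct (A * A') (C * C') w = tensorAct A C (tensorAct A' C' w) :=
  LinearMap.congr_fun (TensorProduct.map_mul A A' C C') w

theorem tensorAct_one_one (w : Spinor S V) :
    tensorAct (1 : Module.End ℂ S) (1 : Module.End ℂ V) w = w :=
  LinearMap.congr_fun (TensorProduct.map_one (R := ℂ) (M := S) (N := V)) w

theorem tensorAct_add_left (A A' : Module.End ℂ S) (C : Module.End ℂ V) (w : Spinor S V) :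
    tensorAct (A + A') C w = tensorAct A C w + tensorAct A' C w :=
  LinearMap.congr_fun (TensorProduct.map_add_left A A' C) w

theorem tensorAct_smul_left (c : ℂ) (A : Module.End ℂ S) (C : Module.End ℂ V) (w : Spinor S V) :
    tensorAct (c • A) C w = c • tensorAct A C w :=
  LinearMap.congr_fun (TensorProduct.map_smul_left c A C) w

theorem tensorAct_zero_left (C : Module.End ℂ V) (w : Spinor S V) :
    tensorAct (0 : Module.End ℂ S) C w = 0 :=
  LinearMap.congr_fun (TensorProduct.map_zero_left (M₂ := S) C) w

theorem tensorAct_sum_left {ι : Type*} (s : Finset ι) (A : ι → Module.End ℂ S)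
    (C : Module.End ℂ V) (w : Spinor S V) :
    tensorAct (∑ i ∈ s, A i) C w = ∑ i ∈ s, tensorAct (A i) C w := by
  induction s using Finset.cons_induction with
  | empty => simp [tensorAct_zero_left]
  | cons a s ha ih => rw [Finset.sum_cons, Finset.sum_cons, tensorAct_add_left, ih]

theorem trace_tensorAct [FiniteDimensional ℂ S] [FiniteDimensional ℂ V]
    (A : Module.End ℂ S) (C : Module.End ℂ V) :
    LinearMap.trace ℂ (Spinor S V) (tensorAct A C) = LinearMap.trace ℂ S A * LinearMap.trace ℂ V C :=
  LinearMap.trace_tensorProduct' A C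

theorem trace_pi_eq_sum {X : Type*} [Fintype X] [DecidableEq X] {W : Type*} [AddCommGroup W]
    [Module ℂ W] [FiniteDimensional ℂ W] (T : Module.End ℂ (X → W)) :
    LinearMap.trace ℂ _ T =
      ∑ u : X, LinearMap.trace ℂ W (LinearMap.proj u ∘ₗ T ∘ₗ LinearMap.single ℂ (fun _ => W) u) := by
  have h : T = ∑ u : X, LinearMap.single ℂ (fun _ => W) u ∘ₗ (LinearMap.proj u ∘ₗ T) := by
    refine LinearMap.ext fun w => funext fun v => ?_
    simp [LinearMap.sum_apply, Finset.sum_apply, Pi.single_apply]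
  conv_lhs => rw [h]
  rw [map_sum]
  refine Finset.sum_congr rfl fun u _ => ?_
  rw [LinearMap.trace_comp_comm']
  rfl

end TensorAct

/-! ### Fourier expansion of the eigenspinors -/

section Eigenspinors

variable {n k : ℕ} {Γ : Subgroup (Isom n)}
  (hΓ : IsBieberbach Γ) (hF : Nonempty (holonomy Γ ≃* Multiplicative (Fin k → ZMod 2)))
  (ε : SpinStructure Γ)
  {S : Type*} [NormedAddCommGroup S] [InnerProductSpace ℂ S]
  (L : Cl n →ₐ[ℝ] Module.End ℂ S)
  {V : Type*} [NormedAddCommGroup V] [InnerProductSpace ℂ V]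
  (ρ : Γ →* (V ≃ₗᵢ[ℂ] V)) (hρ : TrivialOnLattice ρ)

/-- The action `L(ε(γ)) ⊗ ρ(γ)` of `γ` on spinors. -/
def spinAct (γ : Γ) : Spinor S V →ₗ[ℂ] Spinor S V :=
  tensorAct (L (ε.hom γ : Cl n)) ((ρ γ).toLinearEquiv : V →ₗ[ℂ] V)

/-- Clifford multiplication by `v` on `S ⊗ V`. -/
def cliffAct (V : Type*) [NormedAddCommGroup V] [InnerProductSpace ℂ V] (v : E n) :
    Spinor S V →ₗ[ℂ] Spinor S V :=
  tensorAct (L (vec v)) LinearMap.id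

theorem cliffAct_eq_sum (v : E n) (w : Spinor S V) :
    cliffAct L V v w = ∑ i, (v i : ℂ) • tensorAct (L (e i)) (LinearMap.id : V →ₗ[ℂ] V) w := by
  rw [cliffAct, vec_eq_sum, map_sum, tensorAct_sum_left]
  refine Finset.sum_congr rfl fun i _ => ?_
  rw [map_smul, ← tensorAct_smul_left]
  congr 1

theorem cliffAct_cliffAct (v : E n) (w : Spinor S V) :
    cliffAct L V v (cliffAct L V v w) = (-(‖v‖ ^ 2 : ℝ) : ℂ) • w := by
  have h := tensorAct_mul (L (vec v)) (L (vec v)) (1 : Module.End ℂ V) 1 w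
  rw [← map_mul, vec_sq, AlgHom.commutes, mul_one, Algebra.algebraMap_eq_smul_one] at h
  have h2 : ((-‖v‖ ^ 2 : ℝ) • (1 : Module.End ℂ S)) = ((-(‖v‖ ^ 2 : ℝ) : ℂ)) • 1 := by
    rw [← Complex.ofReal_neg, Complex.coe_smul]
  rw [h2, tensorAct_smul_left, tensorAct_one_one] at h
  exact h.symm

theorem spinAct_mul (γ γ' : Γ) (w : Spinor S V) :
    spinAct ε L ρ (γ * γ') w = spinAct ε L ρ γ (spinAct ε L ρ γ' w) := by
  rw [spinAct, spinAct, spinAct, ← Module.End.mul_apply, map_mul, map_mul, Submonoid.coe_mul,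
    map_mul]
  exact tensorAct_mul _ _ _ _ w

include hρ in
theorem spinAct_latticeElt (v : lattice Γ) (w : Spinor S V) :
    spinAct ε L ρ (latticeElt v) w = (ε.delta v : ℂ) • w := by
  rw [spinAct, hρ v, ε.coe_hom_latticeElt, map_intCast]
  have : ((ε.delta v : ℤ) : Module.End ℂ S) = (ε.delta v : ℂ) • 1 := by
    ext x; simp [Int.cast_smul_eq_zsmul]
  rw [this, tensorAct_smul_left]
  congr 1
  exact tensorAct_one_one w

theorem cliffAct_spinAct (γ : Γ) (v : E n) (w : Spinor S V) :
    cliffAct L V (rot n (γ : Isom n) v) (spinAct ε L ρ γ w) =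
      spinAct ε L ρ γ (cliffAct L V v w) := by
  have h1 := tensorAct_mul (L (vec (rot n (γ : Isom n) v))) (L (ε.hom γ : Cl n))
    (1 : Module.End ℂ V) ((ρ γ).toLinearEquiv : V →ₗ[ℂ] V) w
  have h2 := tensorAct_mul (L (ε.hom γ : Cl n)) (L (vec v))
    ((ρ γ).toLinearEquiv : V →ₗ[ℂ] V) (1 : Module.End ℂ V) w
  rw [← map_mul, one_mul] at h1
  rw [← map_mul, mul_one, ε.hom_mul_vec] at h2
  exact h1.symm.trans h2

theorem add_lattice_eq {f : E n → Spinor S V} (hf : f ∈ spinorFields ε L ρ)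
    (hρ : TrivialOnLattice ρ) {u : E n} (hu : u ∈ ε.dualCoset) (v : lattice Γ) (x : E n) :
    f (x + v) = expChar u v • f x := by
  have h := hf.2 (latticeElt v) x
  rw [ε.mem_dualCoset.1 hu v, ← spinAct_latticeElt ε L ρ hρ]
  rw [add_comm]
  exact h

/-- The Fourier coefficient at u turns ∂/∂x_j into 2πi u_j and so the Dirac equation into linear
algebra in S ⊗ V. -/
theorem cliffAct_fourierAt [FiniteDimensional ℂ S] [FiniteDimensional ℂ V]
    {b : Module.Basis (Fin n) ℝ (E n)} {t : ℝ} {f : E n → Spinor S V}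
    (hf : f ∈ eigenspace ε L ρ t) {u : E n} (hp : ∀ j x, f (x + b j) = expChar u (b j) • f x) :
    (2 * Real.pi * Complex.I) • cliffAct L V u (fourierAt b u f) = (t : ℂ) • fourierAt b u f := by
  have hc : ContDiff ℝ 1 f := hf.1.1.of_le (by norm_cast)
  have := FiniteDimensional.complete ℂ (Spinor S V)
  have h1 := fourierAt_map b u (LinearMap.toContinuousLinearMap
    ((t : ℂ) • (LinearMap.id : Spinor S V →ₗ[ℂ] Spinor S V))) hc.continuous
  have h2 : (fun x => LinearMap.toContinuousLinearMap
      ((t : ℂ) • (LinearMap.id : Spinor S V →ₗ[ℂ] Spinor S V)) (f x)) = dirac L f := by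
    ext x
    rw [hf.2 x]
    rfl
  have h3 : ∀ i : Fin n, Continuous fun x => fderiv ℝ f x (EuclideanSpace.single i (1 : ℝ)) :=
    fun i => (hc.continuous_fderiv one_ne_zero).clm_apply continuous_const
  have h4 : fourierAt b u (dirac L f) = ∑ i : Fin n,
      tensorAct (L (e i)) (LinearMap.id : V →ₗ[ℂ] V)
        (fourierAt b u fun x => fderiv ℝ f x (EuclideanSpace.single i (1 : ℝ))) := by
    unfold dirac
    rw [fourierAt_sum]
    · refine Finset.sum_congr rfl fun i _ => ?_
      exact fourierAt_map b u (LinearMap.toContinuousLinearMap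
        (tensorAct (L (e i)) (LinearMap.id : V →ₗ[ℂ] V))) (h3 i)
    · intro i _
      exact (LinearMap.toContinuousLinearMap
        (tensorAct (L (e i)) (LinearMap.id : V →ₗ[ℂ] V))).continuous.comp (h3 i)
  rw [h2, h4] at h1
  refine Eq.trans ?_ h1
  rw [cliffAct_eq_sum, Finset.smul_sum]
  refine Finset.sum_congr rfl fun i _ => ?_
  rw [fourierAt_fderiv b u _ hc hp, map_smul, smul_smul]
  congr 2
  simp [EuclideanSpace.inner_single_right]

/-- Applying 2πi L(u) twice gives (2π‖u‖)² = t². -/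
theorem norm_eq_of_cliffAct {t μ : ℝ} (hμ : 0 ≤ μ) (ht : |t| = 2 * Real.pi * μ) {u : E n}
    {w : Spinor S V} (h : (2 * Real.pi * Complex.I) • cliffAct L V u w = (t : ℂ) • w)
    (hw : w ≠ 0) : ‖u‖ = μ := by
  have h1 := congrArg (fun y => (2 * Real.pi * Complex.I) • cliffAct L V u y) h
  simp only [map_smul, cliffAct_cliffAct] at h1
  rw [smul_comm _ (t : ℂ), h, smul_smul, smul_smul, smul_smul, ← sub_eq_zero, ← sub_smul] at h1
  have h2 := (smul_eq_zero.1 h1).resolve_right hw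
  have h3 : ((2 * Real.pi * ‖u‖) ^ 2 - t ^ 2 : ℝ) = 0 := by
    have h4 : (((2 * Real.pi * ‖u‖) ^ 2 - t ^ 2 : ℝ) : ℂ) = 0 := by
      rw [← h2]
      push_cast
      linear_combination ((2 * Real.pi * (‖u‖ : ℂ)) ^ 2) * Complex.I_sq
    exact_mod_cast h4
  rw [← sq_abs t, ht] at h3
  have h5 : 2 * Real.pi * ‖u‖ = 2 * Real.pi * μ := by
    rw [← abs_of_nonneg (by positivity : 0 ≤ 2 * Real.pi * ‖u‖),
      ← abs_of_nonneg (by positivity : 0 ≤ 2 * Real.pi * μ)]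
    exact (sq_eq_sq_iff_abs_eq_abs _ _).1 (by linarith)
  exact mul_left_cancel₀ (by positivity) h5

/-- The trigonometric polynomial with frequencies in `Λ*_{ε,μ}` and coefficients `c`. -/
def trigPoly {W : Type*} [NormedAddCommGroup W] [InnerProductSpace ℂ W]
    (X : Set (E n)) [Fintype X] : (X → W) →ₗ[ℂ] (E n → W) where
  toFun c := fun x => ∑ u : X, expChar (u : E n) x • c u
  map_add' c d := by ext x; simp [Finset.sum_add_distrib]
  map_smul' a c := by ext x; simp [Finset.smul_sum, smul_comm a]

theorem fourierAt_trigPoly {W : Type*} [NormedAddCommGroup W] [InnerProductSpace ℂ W]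
    [CompleteSpace W] {X : Set (E n)} [Fintype X]
    (b : Module.Basis (Fin n) ℝ (E n)) (c : X → W) {u : E n}
    (h : ∀ v ∈ X, ∀ j, expChar u (b j) = expChar v (b j)) :
    (∀ hu : u ∈ X, fourierAt b u (trigPoly X c) = c ⟨u, hu⟩) ∧
      (u ∉ X → fourierAt b u (trigPoly X c) = 0) := by
  classical
  have h1 : fourierAt b u (trigPoly X c) =
      ∑ v : X, fourierAt b u fun x => expChar (v : E n) x • c v :=
    fourierAt_sum b u Finset.univ
      fun v _ => ((contDiff_expChar (N := 0) (v : E n)).continuous).smul continuous_const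
  rw [h1]
  refine ⟨fun hu => ?_, fun hu => Finset.sum_eq_zero fun v _ => ?_⟩
  · rw [Finset.sum_eq_single ⟨u, hu⟩]
    · exact fourierAt_expChar_self b u _
    · intro v _ hv
      exact fourierAt_expChar_of_ne b (h v v.2) (fun h => hv (Subtype.ext h.symm)) _
    · simp
  · exact fourierAt_expChar_of_ne b (h v v.2) (fun h => hu (h ▸ v.2)) _

theorem contDiff_trigPoly {W : Type*} [NormedAddCommGroup W] [InnerProductSpace ℂ W]
    {X : Set (E n)} [Fintype X] (c : X → W) {N : WithTop ℕ∞} : ContDiff ℝ N (trigPoly X c) :=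
  ContDiff.sum fun u _ => (contDiff_expChar (u : E n)).smul contDiff_const

theorem fderiv_trigPoly {W : Type*} [NormedAddCommGroup W] [InnerProductSpace ℂ W]
    {X : Set (E n)} [Fintype X] (c : X → W) (x v : E n) :
    fderiv ℝ (trigPoly X c) x v =
      ∑ u : X, ((2 * Real.pi * Complex.I * (inner ℝ (u : E n) v : ℝ)) * expChar (u : E n) x) • c u := by
  have h1 : ∀ u : X, HasFDerivAt (fun x => expChar (u : E n) x • c u)
      ((fderiv ℝ (expChar (u : E n)) x).smulRight (c u)) x := fun u =>
    (((contDiff_expChar (N := 1) (u : E n)).differentiable one_ne_zero x).hasFDerivAt).smul_const _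
  have h2 : HasFDerivAt (trigPoly X c) _ x := HasFDerivAt.fun_sum fun u (_ : u ∈ Finset.univ) => h1 u
  rw [h2.fderiv]
  simp [fderiv_expChar]

theorem dirac_trigPoly {X : Set (E n)} [Fintype X] (c : X → Spinor S V) (x : E n) :
    dirac L (trigPoly X c) x =
      ∑ u : X, expChar (u : E n) x • (2 * Real.pi * Complex.I) • cliffAct L V u (c u) := by
  unfold dirac
  simp only [fderiv_trigPoly, map_sum, map_smul]
  rw [Finset.sum_comm]
  refine Finset.sum_congr rfl fun u _ => ?_
  rw [cliffAct_eq_sum, Finset.smul_sum, Finset.smul_sum]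
  refine Finset.sum_congr rfl fun i _ => ?_
  rw [smul_smul, smul_smul]
  congr 1
  simp [EuclideanSpace.inner_single_right]
  ring

/-- The rotation of `Λ*_{ε,μ}` by the holonomy of `γ`. -/
def rotSphere (γ : Γ) (μ : ℝ) (u : ε.dualSphere μ) : ε.dualSphere μ :=
  ⟨rot n (γ : Isom n) u, ε.rot_mem_dualCoset γ u.2.1, by
    rw [LinearIsometryEquiv.norm_map]; exact u.2.2⟩

include hF in
theorem rotSphere_rotSphere (γ : Γ) (μ : ℝ) (u : ε.dualSphere μ) :
    rotSphere ε γ μ (rotSphere ε γ μ u) = u := Subtype.ext (rot_rot hF γ u)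

/-- The action of `γ` on the Fourier coefficients with frequencies in `Λ*_{ε,μ}`. -/
def coeffAct (μ : ℝ) (γ : Γ) : Module.End ℂ (ε.dualSphere μ → Spinor S V) where
  toFun c u := (expChar (rotSphere ε γ μ u : E n) (transPart (γ : Isom n)))⁻¹ •
    spinAct ε L ρ γ (c (rotSphere ε γ μ u))
  map_add' c d := by ext u; simp
  map_smul' a c := by ext u; simp [smul_comm a]

/-- The coefficients of the eigenspinors. -/
def coeffSpace (μ t : ℝ) : Submodule ℂ (ε.dualSphere μ → Spinor S V) where
  carrier := {c | (∀ u : ε.dualSphere μ,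
    (2 * Real.pi * Complex.I) • cliffAct L V (u : E n) (c u) = (t : ℂ) • c u) ∧
    ∀ γ, coeffAct ε L ρ μ γ c = c}
  zero_mem' := by simp
  add_mem' {c d} hc hd := ⟨fun u => by simp [hc.1 u, hd.1 u], fun γ => by
    rw [map_add, hc.2, hd.2]⟩
  smul_mem' a c hc := ⟨fun u => by
    simp only [Pi.smul_apply, map_smul]
    rw [smul_comm, hc.1 u, smul_comm], fun γ => by rw [map_smul, hc.2]⟩

theorem trigPoly_apply {W : Type*} [NormedAddCommGroup W] [InnerProductSpace ℂ W]
    {X : Set (E n)} [Fintype X] (c : X → W) (x : E n) :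
    trigPoly X c x = ∑ u : X, expChar (u : E n) x • c u := rfl

include hF in
theorem trigPoly_apply_isom {μ : ℝ} [Fintype (ε.dualSphere μ)]
    (c : ε.dualSphere μ → Spinor S V) (γ : Γ) (x : E n) :
    trigPoly (ε.dualSphere μ) c ((γ : Isom n) x) =
      trigPoly (ε.dualSphere μ)
        (fun u => expChar (u : E n) (transPart (γ : Isom n)) • c (rotSphere ε γ μ u)) x := by
  have hinv : Function.Involutive (rotSphere ε γ μ) := rotSphere_rotSphere hF ε γ μ
  rw [trigPoly_apply, ← Equiv.sum_comp hinv.toPerm, trigPoly_apply]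
  refine Finset.sum_congr rfl fun u _ => ?_
  change expChar (rot n (γ : Isom n) u) _ • c (rotSphere ε γ μ u) = _
  rw [apply_eq, expChar_rot, expChar_add_right, mul_smul]

include hF in
theorem coeffAct_eq_iff {μ : ℝ} (c : ε.dualSphere μ → Spinor S V) (γ : Γ) :
    coeffAct ε L ρ μ γ c = c ↔ ∀ u : ε.dualSphere μ, expChar (u : E n) (transPart (γ : Isom n)) •
      c (rotSphere ε γ μ u) = spinAct ε L ρ γ (c u) := by
  have key : ∀ u : ε.dualSphere μ, coeffAct ε L ρ μ γ c (rotSphere ε γ μ u) =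
      (expChar (u : E n) (transPart (γ : Isom n)))⁻¹ • spinAct ε L ρ γ (c u) := fun u => by
    change (expChar (rotSphere ε γ μ (rotSphere ε γ μ u) : E n) (transPart (γ : Isom n)))⁻¹ •
      spinAct ε L ρ γ (c (rotSphere ε γ μ (rotSphere ε γ μ u))) = _
    rw [rotSphere_rotSphere hF]
  constructor
  · intro h u
    rw [← congrFun h, key, smul_smul, mul_inv_cancel₀ (expChar_ne_zero _ _), one_smul]
  · intro h
    funext u
    rw [← rotSphere_rotSphere hF ε γ μ u, key, ← h, smul_smul,
      inv_mul_cancel₀ (expChar_ne_zero _ _), one_smul]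

include hΓ hF hρ in
-- The Dirac equation holds frequency by frequency and allows only norm μ; equivariance under Γ
-- becomes invariance of the coefficients. With `trigPoly_injective` this reduces the multiplicity
-- to the dimension of a space of coefficients.
theorem map_trigPoly_coeffSpace [FiniteDimensional ℂ S] [FiniteDimensional ℂ V]
    {μ t : ℝ} (hμ : 0 ≤ μ) (ht : |t| = 2 * Real.pi * μ)
    [Fintype (ε.dualSphere μ)] :
    (coeffSpace ε L ρ μ t).map (trigPoly (ε.dualSphere μ)) = eigenspace ε L ρ t := by
  have := FiniteDimensional.complete ℂ (Spinor S V)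
  obtain ⟨b⟩ := exists_lattice_basis hΓ hF
  obtain ⟨b', hb'⟩ := exists_real_basis hΓ hF b
  have hcoset : ∀ u ∈ ε.dualCoset, ∀ v ∈ ε.dualCoset, ∀ j, expChar u (b' j) = expChar v (b' j) := by
    intro u hu v hv j
    rw [hb', ε.mem_dualCoset.1 hu, ε.mem_dualCoset.1 hv]
  ext f
  constructor
  · rintro ⟨c, hc, rfl⟩
    refine ⟨⟨contDiff_trigPoly c, fun γ x => ?_⟩, fun x => ?_⟩
    · rw [trigPoly_apply_isom hF, trigPoly_apply, trigPoly_apply, map_sum]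
      refine Finset.sum_congr rfl fun u _ => ?_
      rw [(coeffAct_eq_iff hF ε L ρ c γ).1 (hc.2 γ) u, map_smul]
      rfl
    · rw [dirac_trigPoly, trigPoly_apply, Finset.smul_sum]
      refine Finset.sum_congr rfl fun u _ => ?_
      rw [hc.1 u, smul_comm]
  · intro hf
    obtain ⟨u₀, hu₀⟩ := ε.dualCoset_nonempty hΓ hF
    have hp : ∀ u ∈ ε.dualCoset, ∀ j x, f (x + b' j) = expChar u (b' j) • f x :=
      fun u hu j x => by rw [hb']; exact add_lattice_eq ε L ρ hf.1 hρ hu (b j) x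
    have hfc : Continuous f := hf.1.1.continuous
    have hcl : ∀ u ∈ ε.dualCoset, (2 * Real.pi * Complex.I) • cliffAct L V u (fourierAt b' u f) =
        (t : ℂ) • fourierAt b' u f := fun u hu => cliffAct_fourierAt ε L ρ hf (hp u hu)
    set c : ε.dualSphere μ → Spinor S V := fun u => fourierAt b' (u : E n) f with hcdef
    -- Both sides have the same Fourier coefficients: by construction on the sphere of radius μ, and
    -- elsewhere because those of f vanish by `norm_eq_of_cliffAct`.
    have hfc' : f = trigPoly (ε.dualSphere μ) c := by
      rw [← sub_eq_zero]
      refine eq_zero_of_fourierAt_eq_zero b' u₀ (hfc.sub (contDiff_trigPoly (N := 0) c).continuous)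
        (fun j x => ?_) (fun v hv => ?_)
      · rw [Pi.sub_apply, Pi.sub_apply, smul_sub, hp u₀ hu₀]
        congr 1
        rw [trigPoly_apply, trigPoly_apply, Finset.smul_sum]
        refine Finset.sum_congr rfl fun u _ => ?_
        rw [expChar_add_right, hcoset u u.2.1 u₀ hu₀, mul_comm, mul_smul]
      · have hvmem : v ∈ ε.dualCoset := ε.mem_dualCoset_of_basis b fun j => by
          rw [← hb', hv, hb']; exact ε.mem_dualCoset.1 hu₀ _
        have h1 := fourierAt_add b' v hfc
          ((contDiff_trigPoly (N := 0) c).continuous.const_smul (-1 : ℂ))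
        have h2 := fourierAt_map b' v ((-1 : ℂ) • ContinuousLinearMap.id ℂ (Spinor S V))
          (contDiff_trigPoly (N := 0) c).continuous
        have h3 : (f - trigPoly (ε.dualSphere μ) c) =
            fun x => f x + (-1 : ℂ) • trigPoly (ε.dualSphere μ) c x := by
          ext x; simp [sub_eq_add_neg]
        rw [h3]
        refine h1.trans ?_
        have h4 := fourierAt_trigPoly b' c (u := v) fun w hw => hcoset v hvmem w hw.1
        have h5 : (fourierAt b' v fun x => (-1 : ℂ) • trigPoly (ε.dualSphere μ) c x) =
          -fourierAt b' v (trigPoly (ε.dualSphere μ) c) := by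
          simpa using h2
        erw [h5]
        by_cases hv' : v ∈ ε.dualSphere μ
        · rw [h4.1 hv', hcdef, add_neg_cancel]
        · rw [h4.2 hv', neg_zero, add_zero]
          by_contra h0
          exact hv' ⟨hvmem, norm_eq_of_cliffAct L hμ ht (hcl v hvmem) h0⟩
    refine ⟨c, ⟨fun u => hcl u u.2.1, fun γ => ?_⟩, hfc'.symm⟩
    rw [coeffAct_eq_iff hF]
    intro u
    have h1 : trigPoly (ε.dualSphere μ)
        (fun u => expChar (u : E n) (transPart (γ : Isom n)) • c (rotSphere ε γ μ u)) =
        trigPoly (ε.dualSphere μ) (fun u => spinAct ε L ρ γ (c u)) := by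
      ext x
      rw [← trigPoly_apply_isom hF, ← hfc', hf.1.2 γ x, hfc', trigPoly_apply, trigPoly_apply,
        map_sum]
      refine Finset.sum_congr rfl fun u _ => ?_
      rw [map_smul]
      rfl
    have h2 := fun c' : ε.dualSphere μ → Spinor S V =>
      (fourierAt_trigPoly b' c' (u := u) fun w hw => hcoset u u.2.1 w hw.1).1 u.2
    have h3 := h2 (fun u => expChar (u : E n) (transPart (γ : Isom n)) • c (rotSphere ε γ μ u))
    rw [h1, h2] at h3
    exact h3.symm

include hΓ hF in
theorem trigPoly_injective [FiniteDimensional ℂ S] [FiniteDimensional ℂ V] {μ : ℝ} [Fintype (ε.dualSphere μ)] :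
    Function.Injective (trigPoly (W := Spinor S V) (ε.dualSphere μ)) := by
  have := FiniteDimensional.complete ℂ (Spinor S V)
  obtain ⟨b⟩ := exists_lattice_basis hΓ hF
  obtain ⟨b', hb'⟩ := exists_real_basis hΓ hF b
  intro c d h
  funext u
  have h2 := fun c' : ε.dualSphere μ → Spinor S V =>
    (fourierAt_trigPoly b' c' (u := u) fun w hw j => by
      rw [hb', ε.mem_dualCoset.1 u.2.1, ε.mem_dualCoset.1 hw.1]).1 u.2
  rw [← h2 c, h, h2 d]

end Eigenspinors

/-! ### The multiplicity formula -/

section Multiplicity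

variable {n k : ℕ} {Γ : Subgroup (Isom n)}
  (hΓ : IsBieberbach Γ) (hF : Nonempty (holonomy Γ ≃* Multiplicative (Fin k → ZMod 2)))
  (ε : SpinStructure Γ)
  {S : Type*} [NormedAddCommGroup S] [InnerProductSpace ℂ S]
  (L : Cl n →ₐ[ℝ] Module.End ℂ S)
  {V : Type*} [NormedAddCommGroup V] [InnerProductSpace ℂ V]
  (ρ : Γ →* (V ≃ₗᵢ[ℂ] V)) (hρ : TrivialOnLattice ρ)

theorem L_vec_sq (v : E n) : L (vec v) * L (vec v) = (-(‖v‖ : ℂ) ^ 2) • (1 : Module.End ℂ S) := by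
  rw [← map_mul, vec_sq, AlgHom.commutes, Algebra.algebraMap_eq_smul_one, ← Complex.coe_smul]
  push_cast
  rfl

/-- The projection of `S` onto the kernel of `2πi L(u) - t`, when `|t| = 2π‖u‖`. -/
def spinProj (t : ℝ) (u : E n) : Module.End ℂ S :=
  if t = 0 then 1 else (1 / 2 : ℂ) • (1 + (2 * Real.pi * Complex.I / t) • L (vec u))

/-- For t ≠ 0 the operator 2πi L(u) has square t², so ½(1 + 2πi L(u)/t) projects onto its
t-eigenspace. For t = 0 the hypotheses force u = 0, and every spinor is a solution. -/
theorem L_vec_mul_spinProj {t μ : ℝ} (ht : |t| = 2 * Real.pi * μ) {u : E n} (hu : ‖u‖ = μ) :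
    (2 * Real.pi * Complex.I) • (L (vec u) * spinProj L t u) = (t : ℂ) • spinProj L t u := by
  unfold spinProj
  split_ifs with h
  · subst h
    rw [abs_zero, eq_comm, mul_eq_zero, or_iff_right (by positivity)] at ht
    rw [ht, norm_eq_zero] at hu
    simp [hu, vec]
  · have ht0 : (t : ℂ) ≠ 0 := by exact_mod_cast h
    have h1 : ((t : ℂ)) ^ 2 = (2 * Real.pi * ‖u‖) ^ 2 := by
      rw [hu]
      have : t ^ 2 = (2 * Real.pi * μ) ^ 2 := by rw [← ht, sq_abs]
      exact_mod_cast this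
    rw [mul_smul_comm, mul_add, mul_one, mul_smul_comm, L_vec_sq, smul_comm _ (1 / 2 : ℂ),
      smul_comm _ (1 / 2 : ℂ)]
    congr 1
    rw [smul_add, smul_add, smul_smul, smul_smul, smul_smul, add_comm]
    congr 1
    · congr 1
      rw [div_eq_mul_inv]
      field_simp
      rw [h1]
      linear_combination (-(2 * Real.pi * (‖u‖ : ℂ)) ^ 2) * Complex.I_sq
    · congr 1
      field_simp

theorem tensorAct_spinProj_of_eq {t : ℝ} {u : E n} {w : Spinor S V}
    (h : (2 * Real.pi * Complex.I) • cliffAct L V u w = (t : ℂ) • w) :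
    tensorAct (spinProj L t u) (LinearMap.id : V →ₗ[ℂ] V) w = w := by
  unfold spinProj
  split_ifs with h0
  · exact tensorAct_one_one w
  · have ht0 : (t : ℂ) ≠ 0 := by exact_mod_cast h0
    rw [tensorAct_smul_left, tensorAct_add_left, tensorAct_smul_left]
    change (1 / 2 : ℂ) • (tensorAct 1 1 w + (2 * Real.pi * Complex.I / t) • cliffAct L V u w) = w
    rw [tensorAct_one_one, div_eq_inv_mul (2 * (Real.pi : ℂ) * Complex.I), mul_smul, h, smul_smul, inv_mul_cancel₀ ht0,
      one_smul, ← two_smul ℂ w, smul_smul]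
    norm_num

theorem cliffAct_tensorAct_spinProj {t μ : ℝ} (ht : |t| = 2 * Real.pi * μ) {u : E n}
    (hu : ‖u‖ = μ) (w : Spinor S V) :
    (2 * Real.pi * Complex.I) •
        cliffAct L V u (tensorAct (spinProj L t u) (LinearMap.id : V →ₗ[ℂ] V) w) =
      (t : ℂ) • tensorAct (spinProj L t u) (LinearMap.id : V →ₗ[ℂ] V) w := by
  rw [← tensorAct_smul_left, ← L_vec_mul_spinProj L ht hu, tensorAct_smul_left]
  congr 1
  exact (tensorAct_mul (L (vec u)) (spinProj L t u) 1 1 w).symm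

/-- The projection of the coefficient families onto the solutions of `2πi L(u) c_u = t c_u`. -/
def pointProj (V : Type*) [NormedAddCommGroup V] [InnerProductSpace ℂ V] (X : Set (E n)) (t : ℝ) :
    Module.End ℂ (X → Spinor S V) :=
  LinearMap.pi fun u =>
    tensorAct (spinProj L t (u : E n)) (LinearMap.id : V →ₗ[ℂ] V) ∘ₗ LinearMap.proj u

include hF in
-- The rotation of the frequencies would reverse the order of composition; commutativity of F
-- repairs this, and B = B⁻¹ allows c_{Bu} in place of c_{B⁻¹u}.
theorem coeffAct_mul (μ : ℝ) (γ γ' : Γ) :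
    coeffAct ε L ρ μ γ * coeffAct ε L ρ μ γ' = coeffAct ε L ρ μ (γ * γ') := by
  refine LinearMap.ext fun c => funext fun u => ?_
  have hu : rotSphere ε γ' μ (rotSphere ε γ μ u) = rotSphere ε (γ * γ') μ u := by
    apply Subtype.ext
    change rot n (γ' : Isom n) (rot n (γ : Isom n) u) = rot n ((γ * γ' : Γ) : Isom n) u
    rw [Subgroup.coe_mul, map_mul, holonomy_comm hF (rot_mem_holonomy γ) (rot_mem_holonomy γ')]
    rfl
  change (expChar (rotSphere ε γ μ u : E n) (transPart (γ : Isom n)))⁻¹ •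
    spinAct ε L ρ γ ((expChar (rotSphere ε γ' μ (rotSphere ε γ μ u) : E n)
      (transPart (γ' : Isom n)))⁻¹ • spinAct ε L ρ γ' (c (rotSphere ε γ' μ (rotSphere ε γ μ u)))) =
    (expChar (rotSphere ε (γ * γ') μ u : E n) (transPart ((γ * γ' : Γ) : Isom n)))⁻¹ •
      spinAct ε L ρ (γ * γ') (c (rotSphere ε (γ * γ') μ u))
  rw [map_smul, smul_smul, spinAct_mul, hu, Subgroup.coe_mul, transPart_mul, rot_symm hF,
    expChar_add_right, mul_inv]
  congr 1
  rw [mul_comm]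
  congr 2
  rw [← hu]
  exact (expChar_rot (rot n (γ' : Isom n)) (rotSphere ε γ μ u : E n) (transPart (γ : Isom n))).symm

include hρ in
-- A translation L_λ multiplies spinors by δ_ε(λ), which cancels against e^{-2πi u·λ}. So the action
-- on coefficients factors through F.
theorem coeffAct_eq_of_rot_eq (μ : ℝ) {γ γ' : Γ} (h : rot n (γ : Isom n) = rot n (γ' : Isom n)) :
    coeffAct ε L ρ μ γ' = coeffAct ε L ρ μ γ := by
  obtain ⟨v, hv, hγ⟩ := exists_mul_transl γ.2 γ'.2 h
  have hγ' : γ' = γ * latticeElt ⟨v, hv⟩ := Subtype.ext hγ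
  refine LinearMap.ext fun c => funext fun u => ?_
  have hu : rotSphere ε γ' μ u = rotSphere ε γ μ u := by
    apply Subtype.ext
    change rot n (γ' : Isom n) u = rot n (γ : Isom n) u
    rw [h]
  change (expChar (rotSphere ε γ' μ u : E n) (transPart (γ' : Isom n)))⁻¹ •
    spinAct ε L ρ γ' (c (rotSphere ε γ' μ u)) = (expChar (rotSphere ε γ μ u : E n)
      (transPart (γ : Isom n)))⁻¹ • spinAct ε L ρ γ (c (rotSphere ε γ μ u))
  rw [hu, hγ, transPart_mul_transl, hγ', spinAct_mul, spinAct_latticeElt ε L ρ hρ, map_smul,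
    smul_smul, expChar_add_right]
  congr 1
  have h1 := ε.mem_dualCoset.1 (rotSphere ε γ μ u).2.1 ⟨v, hv⟩
  rw [h1, mul_inv, mul_assoc]
  rcases ε.delta_eq ⟨v, hv⟩ with h2 | h2 <;> simp [h2, inv_neg]

theorem chi_eq_trace (γ : Γ) :
    LinearMap.trace ℂ V ((ρ γ).toLinearEquiv : V →ₗ[ℂ] V) = chi ρ γ := rfl

open Classical in
/-- The trace of the action of `γ` on the solutions of `2πi L(u) c_u = t c_u`. -/
def orbitTrace (μ t : ℝ) [Fintype (ε.dualSphere μ)] (γ : Γ) : ℂ :=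
  ∑ u : ε.dualSphere μ, if rot n (γ : Isom n) (u : E n) = u then
    (expChar (u : E n) (transPart (γ : Isom n)))⁻¹ *
      LinearMap.trace ℂ S (L (ε.hom γ : Cl n) * spinProj L t (u : E n)) else 0

/-- The operator permutes the blocks indexed by u as B does; only the blocks with Bu = u meet the
diagonal. -/
theorem trace_coeffAct_mul_pointProj [FiniteDimensional ℂ S] [FiniteDimensional ℂ V]
    (μ t : ℝ) [Fintype (ε.dualSphere μ)] (γ : Γ) :
    LinearMap.trace ℂ _ (coeffAct ε L ρ μ γ * pointProj L V (ε.dualSphere μ) t) =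
      chi ρ γ * orbitTrace ε L μ t γ := by
  classical
  rw [trace_pi_eq_sum, orbitTrace, Finset.mul_sum]
  refine Finset.sum_congr rfl fun u _ => ?_
  have h1 : ∀ w : Spinor S V, (LinearMap.proj u ∘ₗ (coeffAct ε L ρ μ γ *
      pointProj L V (ε.dualSphere μ) t) ∘ₗ LinearMap.single ℂ (fun _ => Spinor S V) u) w =
      (expChar (rotSphere ε γ μ u : E n) (transPart (γ : Isom n)))⁻¹ •
        spinAct ε L ρ γ (tensorAct (spinProj L t (rotSphere ε γ μ u : E n))
          (LinearMap.id : V →ₗ[ℂ] V)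
          ((Pi.single u w : ε.dualSphere μ → Spinor S V) (rotSphere ε γ μ u))) := fun w => rfl
  split_ifs with h
  · have hu : rotSphere ε γ μ u = u := Subtype.ext h
    rw [hu] at h1
    simp only [Pi.single_eq_same] at h1
    have h2 : (LinearMap.proj u ∘ₗ (coeffAct ε L ρ μ γ *
      pointProj L V (ε.dualSphere μ) t) ∘ₗ LinearMap.single ℂ (fun _ => Spinor S V) u) =
      (expChar (u : E n) (transPart (γ : Isom n)))⁻¹ •
        tensorAct (L (ε.hom γ : Cl n) * spinProj L t (u : E n))
          ((ρ γ).toLinearEquiv : V →ₗ[ℂ] V) := by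
      refine LinearMap.ext fun w => (h1 w).trans ?_
      rw [LinearMap.smul_apply]
      congr 1
      exact (tensorAct_mul (L (ε.hom γ : Cl n)) (spinProj L t (u : E n))
        ((ρ γ).toLinearEquiv : V →ₗ[ℂ] V) 1 w).symm
    rw [h2, map_smul, trace_tensorAct, smul_eq_mul, chi_eq_trace]
    ring
  · have hu : rotSphere ε γ μ u ≠ u := fun h' => h (congrArg Subtype.val h')
    have h2 : (LinearMap.proj u ∘ₗ (coeffAct ε L ρ μ γ *
      pointProj L V (ε.dualSphere μ) t) ∘ₗ LinearMap.single ℂ (fun _ => Spinor S V) u) = 0 := by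
      refine LinearMap.ext fun w => (h1 w).trans ?_
      rw [Pi.single_eq_of_ne hu]
      simp
    rw [h2, map_zero, mul_zero]

include hρ in
-- The product is the trace of an operator that depends on B alone.
theorem chi_mul_orbitTrace_eq_of_rot_eq [FiniteDimensional ℂ S] [FiniteDimensional ℂ V]
    (μ t : ℝ) [Fintype (ε.dualSphere μ)] {γ γ' : Γ}
    (h : rot n (γ : Isom n) = rot n (γ' : Isom n)) :
    chi ρ γ' * orbitTrace ε L μ t γ' = chi ρ γ * orbitTrace ε L μ t γ := by
  rw [← trace_coeffAct_mul_pointProj, ← trace_coeffAct_mul_pointProj,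
    coeffAct_eq_of_rot_eq ε L ρ hρ μ h]

include hF in
theorem coeffAct_mem (μ t : ℝ) (γ : Γ) (c : ε.dualSphere μ → Spinor S V)
    (hc : ∀ u : ε.dualSphere μ,
      (2 * Real.pi * Complex.I) • cliffAct L V (u : E n) (c u) = (t : ℂ) • c u)
    (u : ε.dualSphere μ) :
    (2 * Real.pi * Complex.I) • cliffAct L V (u : E n) (coeffAct ε L ρ μ γ c u) =
      (t : ℂ) • coeffAct ε L ρ μ γ c u := by
  change (2 * Real.pi * Complex.I) • cliffAct L V (u : E n)
    ((expChar (rotSphere ε γ μ u : E n) (transPart (γ : Isom n)))⁻¹ •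
      spinAct ε L ρ γ (c (rotSphere ε γ μ u))) =
    (t : ℂ) • (expChar (rotSphere ε γ μ u : E n) (transPart (γ : Isom n)))⁻¹ •
      spinAct ε L ρ γ (c (rotSphere ε γ μ u))
  have h1 : (u : E n) = rot n (γ : Isom n) (rotSphere ε γ μ u : E n) := (rot_rot hF γ u).symm
  have h2 := congrArg (spinAct ε L ρ γ) (hc (rotSphere ε γ μ u))
  rw [map_smul, map_smul, ← cliffAct_spinAct, ← h1] at h2
  rw [map_smul, smul_comm, h2, smul_comm]

include hΓ hF hρ in
-- The dimension of the coefficient space is the trace of a projection onto it: pointwise projection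
-- to the t-eigenspaces, followed by the average over F. Here g picks one γ for each B.
theorem finiteDimensional_eigenspace_and_mult [FiniteDimensional ℂ S] [FiniteDimensional ℂ V]
    {μ t : ℝ} (hμ : 0 ≤ μ) (ht : |t| = 2 * Real.pi * μ) [Fintype (ε.dualSphere μ)]
    [Fintype (holonomy Γ)] (g : holonomy Γ → Γ) (hg : ∀ B, rot n (g B : Isom n) = B) :
    FiniteDimensional ℂ (eigenspace ε L ρ t) ∧
      (mult ε L ρ t : ℂ) = (2 ^ k)⁻¹ * ∑ B, chi ρ (g B) * orbitTrace ε L μ t (g B) := by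
  have hmap := map_trigPoly_coeffSpace hΓ hF ε L ρ hρ hμ ht
  have hcard : (Fintype.card (holonomy Γ) : ℂ) = 2 ^ k := by
    rw [← Nat.card_eq_fintype_card, card_holonomy hF]; push_cast; rfl
  refine ⟨by rw [← hmap]; infer_instance, ?_⟩
  have h1 : mult ε L ρ t = Module.finrank ℂ (coeffSpace ε L (V := V) ρ μ t) := by
    rw [mult, ← hmap]
    exact (LinearEquiv.finrank_eq (Submodule.equivMapOfInjective _
      (trigPoly_injective hΓ hF ε) _)).symm
  set Q : Module.End ℂ (ε.dualSphere μ → Spinor S V) :=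
    (2 ^ k : ℂ)⁻¹ • ∑ B, coeffAct ε L ρ μ (g B) * pointProj L V (ε.dualSphere μ) t with hQ
  have hQapply : ∀ c, Q c = (2 ^ k : ℂ)⁻¹ •
      ∑ B, coeffAct ε L ρ μ (g B) (pointProj L V (ε.dualSphere μ) t c) := fun c => by
    rw [hQ, LinearMap.smul_apply, LinearMap.sum_apply]
    rfl
  have hproj : LinearMap.IsProj (coeffSpace ε L (V := V) ρ μ t) Q := by
    constructor
    · intro c
      refine ⟨fun u => ?_, fun γ => ?_⟩
      · have h2 : ∀ B, (2 * Real.pi * Complex.I) • cliffAct L V (u : E n)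
          (coeffAct ε L ρ μ (g B) (pointProj L V (ε.dualSphere μ) t c) u) =
          (t : ℂ) • coeffAct ε L ρ μ (g B) (pointProj L V (ε.dualSphere μ) t c) u := fun B =>
          coeffAct_mem hF ε L ρ μ t (g B) _
            (fun u => cliffAct_tensorAct_spinProj L ht u.2.2 (c u)) u
        rw [hQapply, Pi.smul_apply, Finset.sum_apply, map_smul, map_sum, smul_comm,
          Finset.smul_sum, Finset.sum_congr rfl fun B _ => h2 B, ← Finset.smul_sum, smul_comm]
      · rw [hQapply, map_smul, map_sum]
        congr 1
        -- Acting with γ permutes the summands of the average by left multiplication in F.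
        rw [← Equiv.sum_comp (Equiv.mulLeft (⟨_, rot_mem_holonomy γ⟩ : holonomy Γ))
          fun B => coeffAct ε L ρ μ (g B) (pointProj L V (ε.dualSphere μ) t c)]
        refine Finset.sum_congr rfl fun B _ => ?_
        rw [← Module.End.mul_apply, coeffAct_mul hF]
        congr 1
        refine coeffAct_eq_of_rot_eq ε L ρ hρ μ ?_
        rw [hg, Subgroup.coe_mul, map_mul, hg]
        rfl
    · intro c hc
      have h2 : pointProj L V (ε.dualSphere μ) t c = c :=
        funext fun u => tensorAct_spinProj_of_eq L (hc.1 u)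
      rw [hQapply, h2, Finset.sum_congr rfl fun B _ => hc.2 (g B)]
      rw [Finset.sum_const, Finset.card_univ, ← Nat.cast_smul_eq_nsmul ℂ, hcard, smul_smul,
        inv_mul_cancel₀ (pow_ne_zero _ two_ne_zero), one_smul]
  rw [h1, ← hproj.trace, hQ, map_smul, map_sum, smul_eq_mul]
  simp only [trace_coeffAct_mul_pointProj]

end Multiplicity

/-! ### Isometric involutions and their axes -/

section Axis

variable {n : ℕ} {B : E n ≃ₗᵢ[ℝ] E n}

theorem mem_ker_sub_id {v : E n} :
    v ∈ LinearMap.ker ((B.toLinearEquiv : E n →ₗ[ℝ] E n) - LinearMap.id) ↔ B v = v := by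
  rw [LinearMap.mem_ker, LinearMap.sub_apply, sub_eq_zero]
  rfl

theorem exists_fixed_of_nFix_eq_one (h : nFix B = 1) : ∃ u : E n, u ≠ 0 ∧ B u = u := by
  obtain ⟨⟨u, hu⟩, hu0, -⟩ := finrank_eq_one_iff'.1 h
  exact ⟨u, fun h => hu0 (Subtype.ext h), mem_ker_sub_id.1 hu⟩

theorem exists_eq_smul_of_nFix_eq_one (h : nFix B = 1) {u v : E n} (hu : u ≠ 0) (hBu : B u = u)
    (hBv : B v = v) : ∃ c : ℝ, v = c • u := by
  obtain ⟨c, hc⟩ := (finrank_eq_one_iff_of_nonzero'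
    (⟨u, mem_ker_sub_id.2 hBu⟩ :
      LinearMap.ker ((B.toLinearEquiv : E n →ₗ[ℝ] E n) - LinearMap.id))
    (fun h => hu (congrArg Subtype.val h))).1 h ⟨v, mem_ker_sub_id.2 hBv⟩
  exact ⟨c, (congrArg Subtype.val hc).symm⟩

theorem inner_map_of_fixed {u : E n} (hBu : B u = u) (v : E n) : inner ℝ u (B v) = inner ℝ u v := by
  conv_lhs => rw [← hBu]
  exact B.inner_map_map u v

/-- The vector v + Bv is fixed, hence a multiple of u, and it is orthogonal to u, hence 0. -/
theorem map_eq_neg_of_nFix_eq_one (hB : ∀ v, B (B v) = v) (h : nFix B = 1) {u v : E n} (hu : u ≠ 0)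
    (hBu : B u = u) (hv : inner ℝ u v = 0) : B v = -v := by
  obtain ⟨c, hc⟩ := exists_eq_smul_of_nFix_eq_one h hu hBu (v := v + B v)
    (by rw [map_add, hB, add_comm])
  have h1 : inner ℝ u (v + B v) = 0 := by
    rw [inner_add_right, inner_map_of_fixed hBu, hv, add_zero]
  rw [hc, inner_smul_right, mul_eq_zero, inner_self_eq_zero, or_iff_left hu] at h1
  rw [h1, zero_smul] at hc
  exact eq_neg_of_add_eq_zero_right hc

theorem exists_fixed_orthogonal (h : nFix B ≠ 1) {u : E n} (hu : u ≠ 0) (hBu : B u = u) :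
    ∃ v : E n, v ≠ 0 ∧ B v = v ∧ inner ℝ u v = 0 := by
  by_contra! hcon
  refine h ((finrank_eq_one_iff_of_nonzero'
    (⟨u, mem_ker_sub_id.2 hBu⟩ :
      LinearMap.ker ((B.toLinearEquiv : E n →ₗ[ℝ] E n) - LinearMap.id))
    (fun h => hu (congrArg Subtype.val h))).2 ?_)
  rintro ⟨w, hw⟩
  have huu : inner ℝ u u ≠ (0 : ℝ) := by simpa using hu
  refine ⟨inner ℝ u w / inner ℝ u u, Subtype.ext ?_⟩
  change (inner ℝ u w / inner ℝ u u) • u = w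
  by_contra hne
  refine hcon (w - (inner ℝ u w / inner ℝ u u) • u) (fun h0 => hne (sub_eq_zero.1 h0).symm) ?_ ?_
  · rw [map_sub, map_smul, hBu, mem_ker_sub_id.1 hw]
  · rw [inner_sub_right, inner_smul_right, div_mul_cancel₀ _ huu, sub_self]

theorem exists_map_eq_neg (hB : ∀ v, B (B v) = v) (h : B ≠ 1) : ∃ v : E n, v ≠ 0 ∧ B v = -v := by
  obtain ⟨x, hx⟩ : ∃ x, B x ≠ x := by
    by_contra! hcon
    exact h (LinearIsometryEquiv.ext hcon)
  exact ⟨x - B x, sub_ne_zero.2 (Ne.symm hx), by rw [map_sub, hB, neg_sub]⟩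

theorem inner_eq_zero_of_fixed_of_neg {u v : E n} (hu : B u = u) (hv : B v = -v) :
    inner ℝ u v = 0 := by
  have := inner_map_of_fixed hu v
  rw [hv, inner_neg_right] at this
  linarith

theorem two_le_of_fixed (hB : ∀ v, B (B v) = v) (h : B ≠ 1) {u : E n} (hu : u ≠ 0)
    (hBu : B u = u) : 2 ≤ n := by
  obtain ⟨v, hv, hBv⟩ := exists_map_eq_neg hB h
  have huv := inner_eq_zero_of_fixed_of_neg hBu hBv
  have hli : LinearIndependent ℝ ![u, v] := by
    refine linearIndependent_of_ne_zero_of_inner_eq_zero (fun i => ?_) (fun i j hij => ?_)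
    · fin_cases i <;> simpa
    · fin_cases i <;> fin_cases j <;> simp_all [real_inner_comm]
  simpa using hli.fintype_card_le_finrank

/-- B is the reflection in the line ℝu, whose determinant is (-1)^{n-1}. -/
theorem odd_of_nFix_eq_one (hB : ∀ v, B (B v) = v) (h : nFix B = 1)
    (hdet : LinearMap.det (B.toLinearEquiv : E n →ₗ[ℝ] E n) = 1) : Odd n := by
  obtain ⟨u, hu, hBu⟩ := exists_fixed_of_nFix_eq_one h
  have hrefl : (B.toLinearEquiv : E n →ₗ[ℝ] E n) =
      ((ℝ ∙ u).reflection.toLinearEquiv : E n →ₗ[ℝ] E n) := by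
    refine LinearMap.ext fun x => ?_
    change B x = (ℝ ∙ u).reflection x
    obtain ⟨y, hy, z, hz, rfl⟩ := (ℝ ∙ u).exists_add_mem_mem_orthogonal x
    rw [map_add, map_add, Submodule.reflection_mem_subspace_eq_self hy,
      Submodule.reflection_mem_subspace_orthogonalComplement_eq_neg hz]
    obtain ⟨c, rfl⟩ := Submodule.mem_span_singleton.1 hy
    rw [map_smul, hBu, map_eq_neg_of_nFix_eq_one hB h hu hBu
      (Submodule.mem_orthogonal_singleton_iff_inner_right.1 hz)]
  have h1 := (ℝ ∙ u).det_reflection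
  have h2 : LinearMap.det ((ℝ ∙ u).reflection.toLinearEquiv : E n →ₗ[ℝ] E n) = 1 := hrefl ▸ hdet
  have h3 : (-1 : ℝ) ^ Module.finrank ℝ (ℝ ∙ u)ᗮ = 1 := h1.symm.trans h2
  have h4 := (ℝ ∙ u).finrank_add_finrank_orthogonal
  rw [finrank_span_singleton hu, finrank_euclideanSpace_fin] at h4
  rw [neg_one_pow_eq_one_iff_even (by norm_num)] at h3
  rw [← h4, add_comm]
  exact h3.add_one

end Axis

/-! ### Evaluation of the traces -/

section Evaluation

variable {n k : ℕ} {Γ : Subgroup (Isom n)}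
  (hF : Nonempty (holonomy Γ ≃* Multiplicative (Fin k → ZMod 2))) (hor : IsOriented Γ)
  (ε : SpinStructure Γ)
  {S : Type*} [NormedAddCommGroup S] [InnerProductSpace ℂ S]
  (L : Cl n →ₐ[ℝ] Module.End ℂ S) (hL : IsSpinRep L)

theorem trace_eq_zero_of_anticommute_vec {T : Module.End ℂ S} {v : E n} (hv : v ≠ 0)
    (h : T * L (vec v) = -(L (vec v) * T)) : LinearMap.trace ℂ S T = 0 := by
  have h0 : (-(‖v‖ : ℂ) ^ 2) ≠ 0 := by simpa using hv
  refine trace_eq_zero_of_anticommute (M' := (-(‖v‖ : ℂ) ^ 2)⁻¹ • L (vec v)) h ?_ ?_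
  · rw [mul_smul_comm, L_vec_sq, smul_smul, inv_mul_cancel₀ h0, one_smul]
  · rw [smul_mul_assoc, L_vec_sq, smul_smul, inv_mul_cancel₀ h0, one_smul]

include hF in
-- ε(γ) anticommutes with any vector v ≠ 0 such that Bv = -v.
theorem trace_L_hom_eq_zero {γ : Γ} (h : rot n (γ : Isom n) ≠ 1) :
    LinearMap.trace ℂ S (L (ε.hom γ : Cl n)) = 0 := by
  obtain ⟨v, hv, hBv⟩ := exists_map_eq_neg (rot_rot hF γ) h
  refine trace_eq_zero_of_anticommute_vec L hv ?_
  rw [← map_mul, ← map_mul, ε.hom_mul_vec, hBv, ← map_neg, vec, map_neg, neg_mul]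

/-- If n_B ≠ 1 there is a second fixed vector orthogonal to u; it commutes with ε(γ) and
anticommutes with u. -/
theorem trace_L_hom_mul_vec_eq_zero {γ : Γ} (h : nFix (rot n (γ : Isom n)) ≠ 1) {u : E n}
    (hu : u ≠ 0) (hBu : rot n (γ : Isom n) u = u) :
    LinearMap.trace ℂ S (L ((ε.hom γ : Cl n) * vec u)) = 0 := by
  obtain ⟨v, hv, hBv, huv⟩ := exists_fixed_orthogonal h hu hBu
  refine trace_eq_zero_of_anticommute_vec L hv ?_
  rw [← map_mul, ← map_mul, mul_assoc, vec_mul_vec_of_inner_eq_zero huv, mul_neg, ← mul_assoc,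
    ε.hom_mul_vec, hBv, map_neg, mul_assoc]

include hF in
theorem trace_L_hom_mul_spinProj {γ : Γ} (h : rot n (γ : Isom n) ≠ 1) {t : ℝ} (ht : t ≠ 0)
    (u : E n) :
    LinearMap.trace ℂ S (L (ε.hom γ : Cl n) * spinProj L t u) =
      (Real.pi * Complex.I / t) * LinearMap.trace ℂ S (L ((ε.hom γ : Cl n) * vec u)) := by
  rw [spinProj, if_neg ht, mul_smul_comm, mul_add, mul_one, mul_smul_comm, ← map_mul, map_smul,
    map_add, map_smul, trace_L_hom_eq_zero hF ε L h, zero_add, smul_smul, smul_eq_mul]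
  congr 1
  ring

theorem trace_L_vec_neg (u : E n) :
    LinearMap.trace ℂ S (L (vec (-u))) = -LinearMap.trace ℂ S (L (vec u)) := by
  rw [vec, map_neg, map_neg, map_neg]

/-- `u ↦ -u` on `Λ*_{ε,μ}`. -/
def negSphere (μ : ℝ) : Equiv.Perm (ε.dualSphere μ) :=
  Function.Involutive.toPerm
    (fun u => ⟨-u, ε.neg_mem_dualCoset u.2.1, by rw [norm_neg]; exact u.2.2⟩)
    fun u => Subtype.ext (neg_neg _)

include hL in
-- Each frequency contributes (dim S)/2 plus a term linear in u; the latter cancels under u ↦ -u.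
theorem orbitTrace_one [FiniteDimensional ℂ S] {μ t : ℝ} (ht : t ≠ 0)
    [Fintype (ε.dualSphere μ)] :
    orbitTrace ε L μ t 1 = 2 ^ (n / 2) / 2 * (ε.dualSphere μ).ncard := by
  have h0 : transPart (1 : Isom n) = 0 := by
    rw [transPart, map_one]; rfl
  have h1 : ∀ u : ε.dualSphere μ, LinearMap.trace ℂ S (spinProj L t (u : E n)) =
      2 ^ (n / 2) / 2 + (Real.pi * Complex.I / t) * LinearMap.trace ℂ S (L (vec (u : E n))) := by
    intro u
    rw [spinProj, if_neg ht, map_smul, map_add, map_smul, LinearMap.trace_one, hL.finrank_eq,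
      smul_eq_mul, smul_eq_mul]
    push_cast
    ring
  have h2 : ∑ u : ε.dualSphere μ, LinearMap.trace ℂ S (L (vec (u : E n))) = 0 := by
    have h3 := Equiv.sum_comp (negSphere ε μ)
      fun u : ε.dualSphere μ => LinearMap.trace ℂ S (L (vec (u : E n)))
    have h4 : ∀ u : ε.dualSphere μ, LinearMap.trace ℂ S (L (vec (negSphere ε μ u : E n))) =
        -LinearMap.trace ℂ S (L (vec (u : E n))) := fun u => trace_L_vec_neg L (u : E n)
    rw [Finset.sum_congr rfl fun u _ => h4 u, Finset.sum_neg_distrib] at h3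
    exact CharZero.neg_eq_self_iff.1 h3
  have h5 : orbitTrace ε L μ t 1 = ∑ u : ε.dualSphere μ,
      LinearMap.trace ℂ S (spinProj L t (u : E n)) := by
    refine Finset.sum_congr rfl fun u _ => ?_
    rw [if_pos (by rfl)]
    simp [h0]
  rw [h5, Finset.sum_congr rfl fun u _ => h1 u, Finset.sum_add_distrib, ← Finset.mul_sum, h2,
    Finset.sum_const, Finset.card_univ, ← Nat.card_eq_fintype_card, Nat.card_coe_set_eq]
  simp [mul_comm]

include hF in
theorem orbitTrace_eq_zero_of_nFix_ne_one {γ : Γ} (h : rot n (γ : Isom n) ≠ 1)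
    (h1 : nFix (rot n (γ : Isom n)) ≠ 1) {μ t : ℝ} (hμ : μ ≠ 0) (ht : t ≠ 0)
    [Fintype (ε.dualSphere μ)] : orbitTrace ε L μ t γ = 0 := by
  refine Finset.sum_eq_zero fun u _ => ?_
  split_ifs with hBu
  · have hu : (u : E n) ≠ 0 := fun h0 => hμ (by rw [← u.2.2, h0, norm_zero])
    rw [trace_L_hom_mul_spinProj hF ε L h ht, trace_L_hom_mul_vec_eq_zero ε L h1 hu hBu,
      mul_zero, mul_zero]
  · rfl

theorem orbitTrace_eq_zero_of_forall {γ : Γ} {μ t : ℝ} [Fintype (ε.dualSphere μ)]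
    (h : ∀ u ∈ ε.dualSphere μ, rot n (γ : Isom n) u ≠ u) : orbitTrace ε L μ t γ = 0 :=
  Finset.sum_eq_zero fun u _ => if_neg (h u u.2)

/-- The square of an element whose rotational part is an involution is a translation. -/
theorem sq_eq_transl {γ : Γ} (hB : ∀ v, rot n (γ : Isom n) (rot n (γ : Isom n) v) = v) :
    (γ : Isom n) * γ = transl (transPart (γ : Isom n) + rot n (γ : Isom n) (transPart γ)) := by
  have h1 : rot n ((γ : Isom n) * γ) = 1 := by
    rw [map_mul]
    exact LinearIsometryEquiv.ext hB
  rw [eq_transl_of_rot_eq_one h1, transPart_mul]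
  congr 2
  rw [LinearIsometryEquiv.symm_apply_eq, hB]

theorem transPart_add_mem_lattice {γ : Γ}
    (hB : ∀ v, rot n (γ : Isom n) (rot n (γ : Isom n) v) = v) :
    transPart (γ : Isom n) + rot n (γ : Isom n) (transPart γ) ∈ lattice Γ := by
  change transl _ ∈ Γ
  rw [← sq_eq_transl hB]
  exact Γ.mul_mem γ.2 γ.2

include hF hor hL in
theorem L_hom_mul_vec {γ : Γ} (h : rot n (γ : Isom n) ≠ 1) (h1 : nFix (rot n (γ : Isom n)) = 1)
    {u : E n} (hu : u ≠ 0) (hBu : rot n (γ : Isom n) u = u) :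
    L ((ε.hom γ : Cl n) * vec u) =
      (-(‖u‖ * ε.sign γ u (eProd n (2 * (n / 2))) * Complex.I ^ (n / 2 + 1)) : ℂ) • 1 := by
  have hn := odd_of_nFix_eq_one (rot_rot hF γ) h1 (hor γ γ.2)
  have hn2 := two_le_of_fixed (rot_rot hF γ) h hu hBu
  rw [ε.hom_mul_vec_eq_sign γ hn hn2 hu hBu
    fun v hv => map_eq_neg_of_nFix_eq_one (rot_rot hF γ) h1 hu hBu hv, map_smul,
    hL.L_eProd_self hn, ← Complex.coe_smul, smul_smul]
  congr 1
  push_cast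
  ring

theorem SpinStructure.sign_mul_self (γ : Γ) (u : E n) (x : Cl n) :
    ε.sign γ u x * ε.sign γ u x = 1 := by
  unfold SpinStructure.sign
  split_ifs <;> simp

theorem SpinStructure.sign_ne_zero (γ : Γ) (u : E n) (x : Cl n) : ε.sign γ u x ≠ 0 := by
  unfold SpinStructure.sign
  split_ifs <;> simp

include hF hor hL in
-- γ² is the translation by b + Bb. The square of ε(γ)u is -‖u‖²ε(γ²), because u commutes with ε(γ),
-- and acts as ‖u‖²(i^{m+1})², because ε(γ)u acts as ±‖u‖ i^{m+1}.
theorem delta_sq {γ : Γ} (h : rot n (γ : Isom n) ≠ 1) (h1 : nFix (rot n (γ : Isom n)) = 1) :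
    ε.delta ⟨_, transPart_add_mem_lattice (rot_rot hF γ)⟩ = (-1) ^ (n / 2) := by
  have := hL.nontrivial
  obtain ⟨u, hu, hBu⟩ := exists_fixed_of_nFix_eq_one h1
  have h2 : ε.hom γ * ε.hom γ =
      ε.hom (latticeElt ⟨_, transPart_add_mem_lattice (rot_rot hF γ)⟩) := by
    rw [← map_mul]
    congr 1
    exact Subtype.ext (sq_eq_transl (rot_rot hF γ))
  have h3 := ε.coe_hom_latticeElt ⟨_, transPart_add_mem_lattice (rot_rot hF γ)⟩
  rw [← h2, Submonoid.coe_mul] at h3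
  have h4 : (ε.hom γ : Cl n) * vec u * ((ε.hom γ : Cl n) * vec u) =
      (ε.hom γ : Cl n) * ε.hom γ * (vec u * vec u) := by
    have h0 : vec u * (ε.hom γ : Cl n) = (ε.hom γ : Cl n) * vec u := by rw [ε.hom_mul_vec γ u, hBu]
    rw [mul_assoc (ε.hom γ : Cl n), ← mul_assoc (vec u), h0, mul_assoc, mul_assoc]
  have h5 := congrArg L h4
  rw [map_mul, L_hom_mul_vec hF hor ε L hL h h1 hu hBu, h3, map_mul, map_mul, L_vec_sq,
    map_intCast] at h5
  have h6 : ((ε.delta ⟨_, transPart_add_mem_lattice (rot_rot hF γ)⟩ : ℤ) : Module.End ℂ S) =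
      ((ε.delta ⟨_, transPart_add_mem_lattice (rot_rot hF γ)⟩ : ℤ) : ℂ) • 1 := by
    ext x; simp [Int.cast_smul_eq_zsmul]
  rw [h6, smul_mul_smul_comm, smul_mul_smul_comm, mul_one] at h5
  have h7 := smul_left_injective ℂ (one_ne_zero : (1 : Module.End ℂ S) ≠ 0) h5
  have hu2 : ((‖u‖ : ℂ) ^ 2) ≠ 0 := by simpa using hu
  have h8 : (ε.sign γ u (eProd n (2 * (n / 2))) : ℂ) * ε.sign γ u (eProd n (2 * (n / 2))) = 1 := by
    exact_mod_cast ε.sign_mul_self γ u _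
  have h9 : (Complex.I ^ (n / 2 + 1)) * (Complex.I ^ (n / 2 + 1)) = -(-1) ^ (n / 2) := by
    rw [← mul_pow, Complex.I_mul_I, pow_succ]; ring
  have h10 : ((ε.delta ⟨_, transPart_add_mem_lattice (rot_rot hF γ)⟩ : ℤ) : ℂ) =
      (-1) ^ (n / 2) := by
    apply mul_right_cancel₀ hu2
    linear_combination h7 - (‖u‖ : ℂ) ^ 2 * (Complex.I ^ (n / 2 + 1)) *
      (Complex.I ^ (n / 2 + 1)) * h8 - (‖u‖ : ℂ) ^ 2 * h9
  exact_mod_cast h10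

include hF hor hL in
-- For u fixed by B one has 2u·b = u·(b + Bb), so the square is δ_ε(b + Bb).
theorem expChar_transPart_mul_self {γ : Γ} (h : rot n (γ : Isom n) ≠ 1)
    (h1 : nFix (rot n (γ : Isom n)) = 1) {u : E n} (hu : u ∈ ε.dualCoset)
    (hBu : rot n (γ : Isom n) u = u) :
    expChar u (transPart (γ : Isom n)) * expChar u (transPart (γ : Isom n)) = (-1) ^ (n / 2) := by
  have h2 := ε.mem_dualCoset.1 hu ⟨_, transPart_add_mem_lattice (rot_rot hF γ)⟩
  have h3 : expChar u (rot n (γ : Isom n) (transPart (γ : Isom n))) =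
      expChar u (transPart (γ : Isom n)) := by
    conv_lhs => rw [← hBu]
    exact expChar_rot _ _ _
  rw [delta_sq hF hor ε L hL h h1, expChar_add_right, h3] at h2
  rw [h2]
  push_cast
  rfl

include hF in
-- The only fixed frequencies of norm μ are u and -u, and their traces are opposite.
theorem orbitTrace_eq_of_fixed {γ : Γ} (h : rot n (γ : Isom n) ≠ 1)
    (h1 : nFix (rot n (γ : Isom n)) = 1) {μ t : ℝ} (hμ : μ ≠ 0) (ht : t ≠ 0)
    [Fintype (ε.dualSphere μ)] {u : E n} (hu : u ∈ ε.dualSphere μ)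
    (hBu : rot n (γ : Isom n) u = u) :
    orbitTrace ε L μ t γ = (Real.pi * Complex.I / t) *
      LinearMap.trace ℂ S (L ((ε.hom γ : Cl n) * vec u)) *
        ((expChar u (transPart (γ : Isom n)))⁻¹ - expChar u (transPart (γ : Isom n))) := by
  classical
  have hu0 : u ≠ 0 := fun h0 => hμ (by rw [← hu.2, h0, norm_zero])
  have hne : (⟨u, hu⟩ : ε.dualSphere μ) ≠ negSphere ε μ ⟨u, hu⟩ := by
    intro h
    have h2 : u = -u := congrArg Subtype.val h
    have h3 : (2 : ℝ) • u = 0 := by rw [two_smul]; nth_rewrite 1 [h2]; exact neg_add_cancel u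
    exact hu0 ((smul_eq_zero.1 h3).resolve_left two_ne_zero)
  have hsub : orbitTrace ε L μ t γ = ∑ v ∈ {(⟨u, hu⟩ : ε.dualSphere μ), negSphere ε μ ⟨u, hu⟩},
      if rot n (γ : Isom n) (v : E n) = v then
        (expChar (v : E n) (transPart (γ : Isom n)))⁻¹ *
          LinearMap.trace ℂ S (L (ε.hom γ : Cl n) * spinProj L t (v : E n)) else 0 := by
    symm
    refine Finset.sum_subset (Finset.subset_univ _) fun v _ hv => if_neg fun hBv => hv ?_
    obtain ⟨c, hc⟩ := exists_eq_smul_of_nFix_eq_one h1 hu0 hBu hBv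
    have h2 : |c| * μ = μ := by
      have := v.2.2
      rwa [hc, norm_smul, hu.2] at this
    have h3 : |c| = 1 := mul_right_cancel₀ hμ (by rw [h2, one_mul])
    rw [Finset.mem_insert, Finset.mem_singleton]
    rcases eq_or_eq_neg_of_abs_eq h3 with rfl | rfl
    · left; exact Subtype.ext (by rw [hc, one_smul])
    · right; exact Subtype.ext (by rw [hc, neg_one_smul]; rfl)
  rw [hsub, Finset.sum_pair hne]
  change (if rot n (γ : Isom n) u = u then _ else _) +
    (if rot n (γ : Isom n) (-u) = -u then (expChar (-u) _)⁻¹ *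
      LinearMap.trace ℂ S (L (ε.hom γ : Cl n) * spinProj L t (-u)) else _) = _
  rw [if_pos hBu, if_pos (by rw [map_neg, hBu]), trace_L_hom_mul_spinProj hF ε L h ht,
    trace_L_hom_mul_spinProj hF ε L h ht, expChar_neg_left, inv_inv, vec, vec, map_neg, mul_neg,
    map_neg, map_neg]
  ring

include hF hor hL in
-- For even m, e^{2πi u·b} = ±1 equals its inverse, and the contributions of u and -u cancel.
theorem orbitTrace_eq_zero_of_even {γ : Γ} (h : rot n (γ : Isom n) ≠ 1) (hn : Even (n / 2))
    {μ t : ℝ} (hμ : μ ≠ 0) (ht : t ≠ 0) [Fintype (ε.dualSphere μ)] :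
    orbitTrace ε L μ t γ = 0 := by
  by_cases h1 : nFix (rot n (γ : Isom n)) = 1
  · by_cases h2 : ∃ u ∈ ε.dualSphere μ, rot n (γ : Isom n) u = u
    · obtain ⟨u, hu, hBu⟩ := h2
      have h3 := expChar_transPart_mul_self hF hor ε L hL h h1 hu.1 hBu
      rw [hn.neg_one_pow] at h3
      rw [orbitTrace_eq_of_fixed hF ε L h h1 hμ ht hu hBu, inv_eq_of_mul_eq_one_left h3, sub_self,
        mul_zero]
    · push Not at h2
      exact orbitTrace_eq_zero_of_forall ε L h2
  · exact orbitTrace_eq_zero_of_nFix_ne_one hF ε L h h1 hμ ht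

include hF hor hL in
-- For odd m, e^{2πi u·b} = ±i is minus its inverse, and the contributions add up. When |t| = 2πμ
-- the factor 2πμ/t is the sign of t, the source of the asymmetry.
theorem orbitTrace_eq_sign [FiniteDimensional ℂ S] {γ : Γ} {r : ℕ} (hn : n = 4 * r + 3)
    (h : rot n (γ : Isom n) ≠ 1)
    (h1 : nFix (rot n (γ : Isom n)) = 1) {μ t : ℝ} (hμ : μ ≠ 0) (ht : t ≠ 0)
    [Fintype (ε.dualSphere μ)] {u : E n} (hu : u ∈ ε.dualSphere μ)
    (hBu : rot n (γ : Isom n) u = u) :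
    orbitTrace ε L μ t γ = (2 * Real.pi * μ / t) * (ε.sign γ u (eProd n (2 * (n / 2))) *
      (-1) ^ r * 2 ^ (n / 2) * (-Complex.I * expChar u (transPart (γ : Isom n)))) := by
  have hu0 : u ≠ 0 := fun h0 => hμ (by rw [← hu.2, h0, norm_zero])
  have ht' : (t : ℂ) ≠ 0 := by exact_mod_cast ht
  have hm : n / 2 = 2 * r + 1 := by omega
  have h3 := expChar_transPart_mul_self hF hor ε L hL h h1 hu.1 hBu
  rw [hm, Odd.neg_one_pow ⟨r, rfl⟩] at h3
  have h4 : (expChar u (transPart (γ : Isom n)))⁻¹ = -expChar u (transPart (γ : Isom n)) :=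
    inv_eq_of_mul_eq_one_left (by rw [neg_mul, h3, neg_neg])
  have h5 : Complex.I ^ (n / 2 + 1) = -(-1) ^ r := by
    rw [hm, show 2 * r + 1 + 1 = 2 * (r + 1) by ring, pow_mul, Complex.I_sq, pow_succ]; ring
  rw [orbitTrace_eq_of_fixed hF ε L h h1 hμ ht hu hBu, L_hom_mul_vec hF hor ε L hL h h1 hu0 hBu,
    map_smul, LinearMap.trace_one, hL.finrank_eq, h4, hu.2, h5, smul_eq_mul]
  push_cast
  ring

end Evaluation

/-! ### The fixed line of an element with one-dimensional fixed space -/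

section FixedLine

variable {n k : ℕ} {Γ : Subgroup (Isom n)} (hΓ : IsBieberbach Γ)
  (hF : Nonempty (holonomy Γ ≃* Multiplicative (Fin k → ZMod 2)))
  (ε : SpinStructure Γ)

theorem expChar_of_two_mul_inner {u x : E n} {a : ℤ} (h : 2 * inner ℝ u x = a) :
    expChar u x = ((if Even a then 1 else -1 : ℤ) : ℂ) := by
  have h1 : expChar u x = (-1) ^ a := by
    rw [expChar, ← Complex.exp_pi_mul_I, ← Complex.exp_int_mul]
    congr 1
    have h2 : ((2 * inner ℝ u x : ℝ) : ℂ) = a := by rw [h]; norm_cast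
    rw [← h2]
    push_cast
    ring
  rw [h1]
  split_ifs with ha
  · rw [ha.neg_one_zpow]; norm_num
  · rw [(Int.not_even_iff_odd.1 ha).neg_one_zpow]; norm_num

theorem SpinStructure.exists_two_mul_inner_eq {u : E n} (hu : u ∈ ε.dualCoset) (v : lattice Γ) :
    ∃ a : ℤ, 2 * inner ℝ u (v : E n) = a ∧ ε.delta v = if Even a then 1 else -1 := by
  have h1 := ε.mem_dualCoset.1 hu v
  have h2 : expChar u (v : E n) * expChar u (v : E n) = 1 := by
    rw [h1]; exact_mod_cast ε.delta_mul_self v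
  rw [expChar, ← Complex.exp_add, Complex.exp_eq_one_iff] at h2
  obtain ⟨a, ha⟩ := h2
  have h3 : ((2 * inner ℝ u (v : E n) : ℝ) : ℂ) * (2 * Real.pi * Complex.I) =
      a * (2 * Real.pi * Complex.I) := by rw [← ha]; push_cast; ring
  have h4 : 2 * inner ℝ u (v : E n) = (a : ℝ) := by
    exact_mod_cast mul_right_cancel₀ (by simp [Real.pi_ne_zero]) h3
  refine ⟨a, h4, ?_⟩
  rw [expChar_of_two_mul_inner h4] at h1
  exact_mod_cast h1.symm

theorem GeneratesFixed.mem {B : E n ≃ₗᵢ[ℝ] E n} {f : E n} (hf : GeneratesFixed Γ B f) :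
    f ∈ lattice Γ ∧ B f = f := by
  have : f ∈ (AddSubgroup.zmultiples f : Set (E n)) := AddSubgroup.mem_zmultiples f
  rwa [← hf] at this

theorem GeneratesFixed.exists_eq_zsmul {B : E n ≃ₗᵢ[ℝ] E n} {f : E n} (hf : GeneratesFixed Γ B f)
    {v : E n} (hv : v ∈ lattice Γ) (hBv : B v = v) : ∃ c : ℤ, v = c • f := by
  have h : v ∈ {v : E n | v ∈ lattice Γ ∧ B v = v} := ⟨hv, hBv⟩
  rw [hf] at h
  obtain ⟨c, hc⟩ := h
  exact ⟨c, hc.symm⟩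

/-- The pairing v ↦ 2u·v embeds Λ^B into ℤ, whose subgroups are cyclic. That f ≠ 0 is not claimed;
it comes from `generator_ne_zero`. -/
theorem exists_generatesFixed {B : E n ≃ₗᵢ[ℝ] E n} (hB : nFix B = 1) {u : E n} (hu0 : u ≠ 0)
    (hu : u ∈ ε.dualCoset) (hBu : B u = u) : ∃ f, GeneratesFixed Γ B f := by
  let H : AddSubgroup ℤ :=
    { carrier := {a | ∃ v ∈ lattice Γ, B v = v ∧ 2 * inner ℝ u v = (a : ℝ)}
      zero_mem' := ⟨0, zero_mem _, map_zero B, by simp⟩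
      add_mem' := by
        rintro a a' ⟨v, hv, hBv, h⟩ ⟨v', hv', hBv', h'⟩
        refine ⟨v + v', add_mem hv hv', by rw [map_add, hBv, hBv'], ?_⟩
        rw [inner_add_right, mul_add, h, h', Int.cast_add]
      neg_mem' := by
        rintro a ⟨v, hv, hBv, h⟩
        refine ⟨-v, neg_mem hv, by rw [map_neg, hBv], ?_⟩
        rw [inner_neg_right, mul_neg, h, Int.cast_neg] }
  obtain ⟨q, hq⟩ := Int.subgroup_cyclic H
  rw [← AddSubgroup.zmultiples_eq_closure] at hq
  obtain ⟨f, hf, hBf, hqf⟩ : q ∈ H := hq ▸ AddSubgroup.mem_zmultiples q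
  refine ⟨f, Set.Subset.antisymm ?_ ?_⟩
  · rintro v ⟨hv, hBv⟩
    obtain ⟨a, ha, -⟩ := ε.exists_two_mul_inner_eq hu ⟨v, hv⟩
    have haH : a ∈ H := ⟨v, hv, hBv, ha⟩
    rw [hq] at haH
    obtain ⟨l, rfl⟩ := haH
    refine ⟨l, ?_⟩
    obtain ⟨c, hc⟩ := exists_eq_smul_of_nFix_eq_one hB hu0 hBu (v := v - l • f)
      (by rw [map_sub, map_zsmul, hBv, hBf])
    have h1 : inner ℝ u (v - l • f) = 0 := by
      have : inner ℝ u (l • f) = l * inner ℝ u f := by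
        rw [← Int.cast_smul_eq_zsmul ℝ, inner_smul_right]
      rw [inner_sub_right, this]
      simp only [smul_eq_mul, Int.cast_mul] at ha
      linear_combination (1 / 2 : ℝ) * ha - (1 / 2 : ℝ) * l * hqf
    rw [hc, inner_smul_right, mul_eq_zero, inner_self_eq_zero, or_iff_left hu0] at h1
    rw [h1, zero_smul] at hc
    exact (sub_eq_zero.1 hc).symm
  · rintro _ ⟨l, rfl⟩
    exact ⟨zsmul_mem hf l, by simp [hBf]⟩

variable {γ : Γ} (h1 : nFix (rot n (γ : Isom n)) = 1)
  (hδ : ε.delta ⟨_, transPart_add_mem_lattice (rot_rot hF γ)⟩ = -1)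
  {f : E n} (hf : GeneratesFixed Γ (rot n (γ : Isom n)) f)

include hδ in
theorem ne_zero_of_mem_dualCoset {u : E n} (hu : u ∈ ε.dualCoset) : u ≠ 0 := by
  rintro rfl
  have := ε.mem_dualCoset.1 hu ⟨_, transPart_add_mem_lattice (rot_rot hF γ)⟩
  rw [hδ, expChar_zero_left] at this
  norm_num at this

include hf hδ in
-- b + Bb lies in Λ^B = ℤf. Writing it as cf, δ_ε(cf) = -1 forces c odd and δ_ε(f) = -1; pairing
-- with f gives 2f·b = c‖f‖².
theorem delta_generator : ε.delta ⟨f, hf.mem.1⟩ = -1 ∧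
    ∃ c : ℤ, Odd c ∧ 2 * inner ℝ f (transPart (γ : Isom n)) = c * ‖f‖ ^ 2 := by
  obtain ⟨c, hc⟩ := hf.exists_eq_zsmul (transPart_add_mem_lattice (rot_rot hF γ))
    (by rw [map_add, rot_rot hF, add_comm])
  have h2 : (⟨_, transPart_add_mem_lattice (rot_rot hF γ)⟩ : lattice Γ) = c • ⟨f, hf.mem.1⟩ :=
    Subtype.ext hc
  rw [h2, ε.delta_zsmul] at hδ
  split_ifs at hδ with hev
  refine ⟨hδ, c, Int.not_even_iff_odd.1 hev, ?_⟩
  have h3 : inner ℝ f (transPart (γ : Isom n) + rot n (γ : Isom n) (transPart (γ : Isom n))) =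
      c * ‖f‖ ^ 2 := by
    rw [hc, ← Int.cast_smul_eq_zsmul ℝ, inner_smul_right, real_inner_self_eq_norm_sq]
  rw [inner_add_right, inner_map_of_fixed hf.mem.2] at h3
  rw [← h3]
  ring

include hf hδ in
theorem generator_ne_zero : f ≠ 0 := by
  have h := (delta_generator hF ε hδ hf).1
  rintro rfl
  have : (⟨0, hf.mem.1⟩ : lattice Γ) = 0 := rfl
  rw [this, ε.delta_zero] at h
  norm_num at h

include hf hδ h1 in
theorem exists_eq_smul_generator {u : E n} (hu : u ∈ ε.dualCoset)
    (hBu : rot n (γ : Isom n) u = u) :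
    ∃ p : ℤ, Odd p ∧ u = ((p : ℝ) / (2 * ‖f‖ ^ 2)) • f := by
  have hf0 := generator_ne_zero hF ε hδ hf
  obtain ⟨p, hp, hp2⟩ := ε.exists_two_mul_inner_eq hu ⟨f, hf.mem.1⟩
  rw [(delta_generator hF ε hδ hf).1] at hp2
  split_ifs at hp2 with hev
  refine ⟨p, Int.not_even_iff_odd.1 hev, ?_⟩
  obtain ⟨a, rfl⟩ := exists_eq_smul_of_nFix_eq_one h1 hf0 hf.mem.2 hBu
  have hf2 : ‖f‖ ^ 2 ≠ 0 := by simpa using hf0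
  change 2 * inner ℝ (a • f) f = (p : ℝ) at hp
  rw [real_inner_smul_left, real_inner_self_eq_norm_sq] at hp
  congr 1
  field_simp
  linarith

include hf hδ h1 in
/-- The orthogonal projection of `Λ` to the fixed line of `γ` is `ℤ f`. -/
theorem exists_inner_generator_eq {u : E n} (hu : u ∈ ε.dualCoset)
    (hBu : rot n (γ : Isom n) u = u) (v : lattice Γ) :
    ∃ d : ℤ, inner ℝ f (v : E n) = d * ‖f‖ ^ 2 ∧ ε.delta v = if Even d then 1 else -1 := by
  have hf0 := generator_ne_zero hF ε hδ hf
  have hf2 : ‖f‖ ^ 2 ≠ 0 := by simpa using hf0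
  obtain ⟨p, hp, rfl⟩ := exists_eq_smul_generator hF ε h1 hδ hf hu hBu
  obtain ⟨a, ha, hda⟩ := ε.exists_two_mul_inner_eq hu v
  obtain ⟨c, hc⟩ := hf.exists_eq_zsmul (add_mem v.2 (rot_mem_lattice γ.2 v.2))
    (by rw [map_add, rot_rot hF, add_comm])
  have h2 : inner ℝ f ((v : E n) + rot n (γ : Isom n) v) = c * ‖f‖ ^ 2 := by
    rw [hc, ← Int.cast_smul_eq_zsmul ℝ, inner_smul_right, real_inner_self_eq_norm_sq]
  rw [inner_add_right, inner_map_of_fixed hf.mem.2] at h2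
  have h3 : inner ℝ f (v : E n) = c * ‖f‖ ^ 2 / 2 := by linarith
  rw [real_inner_smul_left, h3] at ha
  have h4 : (p * c : ℝ) = 2 * a := by
    rw [← ha]; field_simp
  have h5 : p * c = 2 * a := by exact_mod_cast h4
  -- From v + Bv = cf alone, f·v is only a half-integral multiple of ‖f‖². Pairing with the fixed u,
  -- an odd multiple of f/(2‖f‖²), excludes odd c.
  have h6 : Even c := by
    have : Even (p * c) := ⟨a, by rw [h5]; ring⟩
    exact (Int.even_mul.1 this).resolve_left (Int.not_even_iff_odd.2 hp)
  obtain ⟨d, rfl⟩ := h6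
  refine ⟨d, by rw [h3]; push_cast; ring, ?_⟩
  have h7 : a = p * d := by
    have : 2 * a = 2 * (p * d) := by rw [← h5]; ring
    omega
  rw [hda, h7]
  simp [Int.even_mul, Int.not_even_iff_odd.2 hp]

include hf hδ h1 in
theorem smul_generator_mem_dualCoset {u : E n} (hu : u ∈ ε.dualCoset)
    (hBu : rot n (γ : Isom n) u = u) {p : ℤ} (hp : Odd p) :
    ((p : ℝ) / (2 * ‖f‖ ^ 2)) • f ∈ ε.dualCoset := by
  rw [ε.mem_dualCoset]
  intro v
  obtain ⟨d, hd, hdd⟩ := exists_inner_generator_eq hF ε h1 hδ hf hu hBu v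
  have hf1 : ‖f‖ ≠ 0 := norm_ne_zero_iff.2 (generator_ne_zero hF ε hδ hf)
  rw [expChar_of_two_mul_inner (a := p * d), hdd]
  · simp [Int.even_mul, Int.not_even_iff_odd.2 hp]
  · rw [real_inner_smul_left, hd]
    push_cast
    field_simp

include hΓ hδ h1 in
-- The projection to the fixed line makes Λ the direct sum of ℤf, where B = 1 and δ_ε(f) = -1, and
-- of Λ ∩ f^⊥, where B = -1 and δ_ε = 1. A basis adapted to this splitting is the required one.
theorem negDelta_of_fixed {u : E n} (hu : u ∈ ε.dualCoset)
    (hBu : rot n (γ : Isom n) u = u) : ε.NegDelta (rot n (γ : Isom n)) := by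
  obtain ⟨f, hf⟩ := exists_generatesFixed ε h1 (ne_zero_of_mem_dualCoset hF ε hδ hu) hu hBu
  have hf0 := generator_ne_zero hF ε hδ hf
  have hf2 : ‖f‖ ^ 2 ≠ 0 := by simpa using hf0
  choose d hd hdd using exists_inner_generator_eq hF ε h1 hδ hf hu hBu
  let φ : lattice Γ →ₗ[ℤ] ℤ := AddMonoidHom.toIntLinearMap
    { toFun := d
      map_zero' := by
        have := hd 0
        rw [AddSubgroup.coe_zero, inner_zero_right, eq_comm, mul_eq_zero, or_iff_left hf2] at this
        exact_mod_cast this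
      map_add' := fun v w => by
        have := hd (v + w)
        rw [AddSubgroup.coe_add, inner_add_right, hd, hd, ← add_mul] at this
        exact_mod_cast (mul_right_cancel₀ hf2 this).symm }
  have hφ : ∀ v, φ v = d v := fun _ => rfl
  have hφf : φ ⟨f, hf.mem.1⟩ = 1 := by
    have := hd ⟨f, hf.mem.1⟩
    rw [real_inner_self_eq_norm_sq] at this
    have h2 : (1 : ℝ) * ‖f‖ ^ 2 = d ⟨f, hf.mem.1⟩ * ‖f‖ ^ 2 := by rw [one_mul]; exact this
    rw [hφ]
    exact_mod_cast (mul_right_cancel₀ hf2 h2).symm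
  obtain ⟨b⟩ := exists_lattice_basis hΓ hF
  obtain ⟨m, bK⟩ := Submodule.basisOfPid b (LinearMap.ker φ)
  let b' := Module.Basis.mkFinCons (⟨f, hf.mem.1⟩ : lattice Γ) bK
    (fun c x hx h => by
      have := congrArg φ h
      rw [map_add, map_smul, hφf, LinearMap.mem_ker.1 hx, map_zero] at this
      simpa using this)
    (fun z => ⟨-φ z, by rw [LinearMap.mem_ker, map_add, map_smul, hφf]; simp⟩)
  have hb' : ∀ i, rot n (γ : Isom n) (b' i : E n) = -(ε.delta (b' i)) • (b' i : E n) := by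
    intro i
    have hcoe : ⇑b' = _ := Module.Basis.coe_mkFinCons _ _ _ _
    rw [hcoe]
    refine Fin.cases ?_ (fun i => ?_) i
    · rw [Fin.cons_zero, (delta_generator hF ε hδ hf).1, neg_neg, one_smul]
      exact hf.mem.2
    · rw [Fin.cons_succ, Function.comp_apply]
      have h2 : d (bK i : lattice Γ) = 0 := LinearMap.mem_ker.1 (bK i).2
      rw [hdd, h2, if_pos Even.zero, neg_one_smul]
      refine map_eq_neg_of_nFix_eq_one (rot_rot hF γ) h1 hf0 hf.mem.2 ?_
      rw [hd, h2, Int.cast_zero, zero_mul]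
  -- The adapted basis is indexed by `Fin (m + 1)`; comparison with b reindexes it by `Fin n`.
  refine ⟨b'.reindex (b'.indexEquiv b), fun j => ?_⟩
  rw [Module.Basis.reindex_apply]
  exact hb' _

include hΓ hF in
-- Take u with u·f_j = 0 or ½ according to δ_ε(f_j) = 1 or -1. B negates only those f_j with u·f_j =
-- 0, so Bu and u have the same pairings.
theorem SpinStructure.NegDelta.exists_fixed {B : E n ≃ₗᵢ[ℝ] E n} (h : ε.NegDelta B)
    (hB : ∀ v, B (B v) = v) : ∃ u ∈ ε.dualCoset, B u = u := by
  obtain ⟨b, hb⟩ := h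
  obtain ⟨b', hb'⟩ := exists_real_basis hΓ hF b
  obtain ⟨u, hu⟩ := exists_inner_basis_eq b' fun j => if ε.delta (b j) = 1 then 0 else 1 / 2
  refine ⟨u, ε.mem_dualCoset_of_basis b fun j => ?_, ?_⟩
  · rcases ε.delta_eq (b j) with h | h
    · rw [expChar_of_two_mul_inner (a := 0), h]
      · simp
      · rw [← hb', hu, if_pos h]; simp
    · rw [expChar_of_two_mul_inner (a := 1), h]
      · simp
      · rw [← hb', hu, if_neg (by rw [h]; decide)]; simp
  · suffices h : innerₗ (E n) (B u) = innerₗ (E n) u from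
      ext_inner_right ℝ fun x => LinearMap.congr_fun h x
    refine b'.ext fun j => ?_
    rw [innerₗ_apply_apply, innerₗ_apply_apply]
    have h2 : inner ℝ (B u) (b' j) = inner ℝ u (B (b' j)) := by
      rw [← B.inner_map_map u, hB]
    rw [h2, hb', hb, ← hb']
    rcases ε.delta_eq (b j) with h | h
    · rw [h, neg_one_smul, inner_neg_right, hu, if_pos h, neg_zero]
    · rw [h, neg_neg, one_smul]

include hδ h1 in
/-- At most one element of the holonomy group contributes to the asymmetry. -/
theorem rot_eq_of_fixed {u : E n} (hu : u ∈ ε.dualCoset) (hBu : rot n (γ : Isom n) u = u)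
    {γ' : Γ} (h1' : nFix (rot n (γ' : Isom n)) = 1) {u' : E n} (hu' : u' ∈ ε.dualCoset)
    (hBu' : rot n (γ' : Isom n) u' = u') : rot n (γ' : Isom n) = rot n (γ : Isom n) := by
  obtain ⟨f, hf⟩ := exists_generatesFixed ε h1 (ne_zero_of_mem_dualCoset hF ε hδ hu) hu hBu
  have hf0 := generator_ne_zero hF ε hδ hf
  have h2 : rot n (γ : Isom n) (rot n (γ' : Isom n) f) = rot n (γ' : Isom n) f := by
    have := DFunLike.congr_fun
      (holonomy_comm hF (rot_mem_holonomy γ) (rot_mem_holonomy γ')) f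
    refine this.trans ?_
    change rot n (γ' : Isom n) (rot n (γ : Isom n) f) = _
    rw [hf.mem.2]
  obtain ⟨a, ha⟩ := exists_eq_smul_of_nFix_eq_one h1 hf0 hf.mem.2 h2
  have h3 : |a| = 1 := by
    have := (rot n (γ' : Isom n)).norm_map f
    rw [ha, norm_smul, Real.norm_eq_abs] at this
    exact mul_right_cancel₀ (norm_ne_zero_iff.2 hf0) (by rw [this, one_mul])
  -- F is commutative, so the other half-turn maps f to ±f. In the case +f the axes agree. In the
  -- case -f its fixed vector u' is orthogonal to f, against e^{2πi u'·f} = δ_ε(f) = -1.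
  rcases eq_or_eq_neg_of_abs_eq h3 with rfl | rfl
  · rw [one_smul] at ha
    refine LinearIsometryEquiv.ext fun x => ?_
    have hf2 : inner ℝ f f ≠ (0 : ℝ) := by simpa using hf0
    have hw : inner ℝ f (x - (inner ℝ f x / inner ℝ f f) • f) = 0 := by
      rw [inner_sub_right, inner_smul_right, div_mul_cancel₀ _ hf2, sub_self]
    have e1 := map_eq_neg_of_nFix_eq_one (rot_rot hF γ) h1 hf0 hf.mem.2 hw
    have e2 := map_eq_neg_of_nFix_eq_one (rot_rot hF γ') h1' hf0 ha hw
    rw [← e2, map_sub, map_sub, map_smul, map_smul, ha, hf.mem.2] at e1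
    exact (sub_left_inj.1 e1).symm
  · rw [neg_one_smul] at ha
    have h4 := inner_eq_zero_of_fixed_of_neg hBu' ha
    have h5 := ε.mem_dualCoset.1 hu' ⟨f, hf.mem.1⟩
    rw [(delta_generator hF ε hδ hf).1, expChar_of_two_mul_inner (a := 0) (by simp [h4])] at h5
    norm_num at h5

theorem SpinStructure.sign_smul_of_pos (γ : Γ) (u : E n) (x : Cl n) {c : ℝ} (hc : 0 < c) :
    ε.sign γ (c • u) x = ε.sign γ u x := by
  have : ∀ h : Spin n, (h : Cl n) * vec (c • u) * (h⁻¹ : Spin n) = vec (‖c • u‖ • lastVec n) ↔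
      (h : Cl n) * vec u * (h⁻¹ : Spin n) = vec (‖u‖ • lastVec n) := by
    intro h
    rw [norm_smul, Real.norm_of_nonneg hc.le, mul_smul, vec, vec, map_smul, map_smul,
      mul_smul_comm, smul_mul_assoc]
    exact (smul_right_injective (Cl n) hc.ne').eq_iff
  classical
  exact if_congr (exists_congr fun h => and_congr_left' (this h)) rfl rfl

end FixedLine

/-! ### Multiplicities -/

section Spectrum

variable {n k : ℕ} {Γ : Subgroup (Isom n)}
  (hΓ : IsBieberbach Γ) (hor : IsOriented Γ)
  (hF : Nonempty (holonomy Γ ≃* Multiplicative (Fin k → ZMod 2)))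
  (ε : SpinStructure Γ)
  {S : Type*} [NormedAddCommGroup S] [InnerProductSpace ℂ S] [FiniteDimensional ℂ S]
  (L : Cl n →ₐ[ℝ] Module.End ℂ S) (hL : IsSpinRep L)
  {V : Type*} [NormedAddCommGroup V] [InnerProductSpace ℂ V] [FiniteDimensional ℂ V]
  (ρ : Γ →* (V ≃ₗᵢ[ℂ] V)) (hρ : TrivialOnLattice ρ)

theorem nFix_one : nFix (1 : E n ≃ₗᵢ[ℝ] E n) = n := by
  have : LinearMap.ker (((1 : E n ≃ₗᵢ[ℝ] E n).toLinearEquiv : E n →ₗ[ℝ] E n) - LinearMap.id) = ⊤ :=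
    eq_top_iff.2 fun v _ => mem_ker_sub_id.2 rfl
  rw [nFix, this, finrank_top, finrank_euclideanSpace_fin]

theorem chi_one : chi ρ 1 = Module.finrank ℂ V := by
  rw [chi, map_one]
  exact LinearMap.trace_id ℂ V

include hΓ hF hρ in
theorem finiteDimensional_eigenspace (t : ℝ) : FiniteDimensional ℂ (eigenspace ε L ρ t) := by
  have := finite_holonomy hF
  have := Fintype.ofFinite (holonomy Γ)
  have := (ε.finite_dualSphere hΓ hF (|t| / (2 * Real.pi))).fintype
  have hg : ∀ B : holonomy Γ, ∃ γ : Γ, rot n (γ : Isom n) = B := fun B =>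
    let ⟨γ, hγ, h⟩ := B.2; ⟨⟨γ, hγ⟩, h⟩
  choose g hg using hg
  exact (finiteDimensional_eigenspace_and_mult hΓ hF ε L ρ hρ (μ := |t| / (2 * Real.pi))
    (by positivity) (mul_div_cancel₀ _ (by positivity)).symm g hg).1

include hΓ hF hρ in
theorem mult_eq_of_unique {μ t : ℝ} (hμ : 0 ≤ μ) (ht : |t| = 2 * Real.pi * μ)
    [Fintype (ε.dualSphere μ)] {γ : Γ} (hγ : rot n (γ : Isom n) ≠ 1)
    (h : ∀ γ' : Γ, rot n (γ' : Isom n) ≠ 1 → rot n (γ' : Isom n) ≠ rot n (γ : Isom n) →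
      chi ρ γ' * orbitTrace ε L μ t γ' = 0) :
    (mult ε L ρ t : ℂ) = (2 ^ k)⁻¹ *
      (Module.finrank ℂ V * orbitTrace ε L μ t 1 + chi ρ γ * orbitTrace ε L μ t γ) := by
  have := finite_holonomy hF
  have := Fintype.ofFinite (holonomy Γ)
  have hg : ∀ B : holonomy Γ, ∃ γ : Γ, rot n (γ : Isom n) = B := fun B =>
    let ⟨γ, hγ, h⟩ := B.2; ⟨⟨γ, hγ⟩, h⟩
  choose g hg using hg
  rw [(finiteDimensional_eigenspace_and_mult hΓ hF ε L ρ hρ hμ ht g hg).2,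
    Fintype.sum_eq_add (1 : holonomy Γ) ⟨_, rot_mem_holonomy γ⟩
      (fun h => hγ (congrArg Subtype.val h).symm), ← chi_one ρ,
    chi_mul_orbitTrace_eq_of_rot_eq ε L ρ hρ μ t (γ := 1) (γ' := g 1) (by
      rw [hg]; exact map_one (rot n)),
    chi_mul_orbitTrace_eq_of_rot_eq ε L ρ hρ μ t (γ := γ)
      (γ' := g ⟨_, rot_mem_holonomy γ⟩) (by rw [hg])]
  rintro B ⟨hB1, hB2⟩
  refine h _ (fun h => hB1 (Subtype.ext ((hg B).symm.trans h)))
    (fun h => hB2 (Subtype.ext ((hg B).symm.trans h)))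

include hΓ hF hρ in
theorem mult_eq_of_forall_eq_zero {μ t : ℝ} (hμ : 0 ≤ μ) (ht : |t| = 2 * Real.pi * μ)
    [Fintype (ε.dualSphere μ)]
    (h : ∀ γ : Γ, rot n (γ : Isom n) ≠ 1 → chi ρ γ * orbitTrace ε L μ t γ = 0) :
    (mult ε L ρ t : ℂ) = (2 ^ k)⁻¹ * (Module.finrank ℂ V * orbitTrace ε L μ t 1) := by
  have := finite_holonomy hF
  have := Fintype.ofFinite (holonomy Γ)
  have hg : ∀ B : holonomy Γ, ∃ γ : Γ, rot n (γ : Isom n) = B := fun B =>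
    let ⟨γ, hγ, h⟩ := B.2; ⟨⟨γ, hγ⟩, h⟩
  choose g hg using hg
  rw [(finiteDimensional_eigenspace_and_mult hΓ hF ε L ρ hρ hμ ht g hg).2,
    Fintype.sum_eq_single (1 : holonomy Γ), ← chi_one ρ,
    chi_mul_orbitTrace_eq_of_rot_eq ε L ρ hρ μ t (γ := 1) (γ' := g 1) (by
      rw [hg]; exact map_one (rot n))]
  exact fun B hB => h _ (fun h => hB (Subtype.ext ((hg B).symm.trans h)))

theorem two_zpow_sub_sub {K : Type*} [Field K] [CharZero K] (m k : ℕ) :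
    (2 : K) ^ ((m : ℕ) - k - 1 : ℤ) = (2 ^ k)⁻¹ * (2 ^ m / 2) := by
  rw [zpow_sub₀ two_ne_zero, zpow_sub₀ two_ne_zero, zpow_natCast, zpow_natCast, zpow_one]
  ring

include hΓ hF hL hρ in
theorem symmetricFormula_of_forall_eq_zero {μ : ℝ} (hμ : 0 < μ) [Fintype (ε.dualSphere μ)]
    (h : ∀ γ : Γ, rot n (γ : Isom n) ≠ 1 → ∀ t ≠ 0, chi ρ γ * orbitTrace ε L μ t γ = 0) :
    SymmetricFormula k ε L ρ μ := by
  have key : ∀ t : ℝ, |t| = 2 * Real.pi * μ → (mult ε L ρ t : ℝ) =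
      (2 : ℝ) ^ ((n / 2 : ℕ) - k - 1 : ℤ) *
        (Module.finrank ℂ V * (ε.dualSphere μ).ncard) := by
    intro t ht
    have ht0 : t ≠ 0 := by
      rintro rfl
      rw [abs_zero] at ht
      have : 0 < 2 * Real.pi * μ := by positivity
      linarith
    have h2 := mult_eq_of_forall_eq_zero hΓ hF ε L ρ hρ hμ.le ht fun γ hγ => h γ hγ t ht0
    rw [orbitTrace_one ε L hL ht0] at h2
    rw [two_zpow_sub_sub]
    apply Complex.ofReal_injective
    push_cast
    rw [h2]
    ring
  have h0 : 0 < 2 * Real.pi * μ := by positivity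
  exact ⟨key _ (abs_of_pos h0), key _ (by rw [abs_neg, abs_of_pos h0])⟩

include hF hor hL in
omit [FiniteDimensional ℂ S] in
theorem orbitTrace_eq_zero_of_not {γ : Γ} (hγ : rot n (γ : Isom n) ≠ 1) {μ t : ℝ} (hμ : μ ≠ 0)
    (ht : t ≠ 0) [Fintype (ε.dualSphere μ)]
    (h : ¬((∃ r, n = 4 * r + 3) ∧ nFix (rot n (γ : Isom n)) = 1 ∧
      ∃ u ∈ ε.dualCoset, rot n (γ : Isom n) u = u)) : orbitTrace ε L μ t γ = 0 := by
  by_cases h1 : nFix (rot n (γ : Isom n)) = 1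
  · by_cases hn : Even (n / 2)
    · exact orbitTrace_eq_zero_of_even hF hor ε L hL hγ hn hμ ht
    · obtain ⟨a, ha⟩ := odd_of_nFix_eq_one (rot_rot hF γ) h1 (hor γ γ.2)
      obtain ⟨r, hr⟩ := Nat.not_even_iff_odd.1 hn
      exact orbitTrace_eq_zero_of_forall ε L fun u hu hBu =>
        h ⟨⟨r, by omega⟩, h1, u, hu.1, hBu⟩
  · exact orbitTrace_eq_zero_of_nFix_ne_one hF ε L hγ h1 hμ ht

omit [FiniteDimensional ℂ S] [FiniteDimensional ℂ V] in
theorem symmetricSpectrum_of_forall (h : ∀ μ : ℝ, 0 < μ → SymmetricFormula k ε L ρ μ) :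
    SymmetricSpectrum ε L ρ := by
  refine Set.eq_empty_iff_forall_notMem.2 fun t ht => ht ?_
  have key : ∀ t : ℝ, 0 < t → mult ε L ρ t = mult ε L ρ (-t) := by
    intro t ht
    obtain ⟨h1, h2⟩ := h (t / (2 * Real.pi)) (by positivity)
    rw [mul_div_cancel₀ _ (by positivity)] at h1 h2
    exact_mod_cast h1.trans h2.symm
  rcases lt_trichotomy t 0 with h0 | rfl | h0
  · have := key (-t) (by linarith)
    rw [neg_neg] at this
    exact this.symm
  · rw [neg_zero]
  · exact key t h0

/-- `γ` fixes a vector of `Λ*_ε`, its fixed space is a line, and `n ≡ 3 (mod 4)`. -/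
def HasFixedDual (γ : Γ) : Prop :=
  (∃ r, n = 4 * r + 3) ∧ nFix (rot n (γ : Isom n)) = 1 ∧
    ∃ u ∈ ε.dualCoset, rot n (γ : Isom n) u = u

include hΓ hor hF hL hρ in
theorem symmetricFormula_of_forall_chi_eq_zero (h : ∀ γ, HasFixedDual ε γ → chi ρ γ = 0) {μ : ℝ}
    (hμ : 0 < μ) : SymmetricFormula k ε L ρ μ := by
  have := (ε.finite_dualSphere hΓ hF μ).fintype
  refine symmetricFormula_of_forall_eq_zero hΓ hF ε L hL ρ hρ hμ fun γ hγ t ht => ?_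
  by_cases h1 : HasFixedDual ε γ
  · rw [h γ h1, zero_mul]
  · rw [orbitTrace_eq_zero_of_not hor hF ε L hL hγ hμ.ne' ht h1, mul_zero]

variable {ε}

theorem HasFixedDual.rot_ne_one {γ : Γ} (h : HasFixedDual ε γ) : rot n (γ : Isom n) ≠ 1 := by
  obtain ⟨⟨r, rfl⟩, h1, -⟩ := h
  intro h
  rw [h, nFix_one] at h1
  omega

include hor hF hL in
omit [FiniteDimensional ℂ S] in
theorem HasFixedDual.delta_eq {γ : Γ} (h : HasFixedDual ε γ) :
    ε.delta ⟨_, transPart_add_mem_lattice (rot_rot hF γ)⟩ = -1 := by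
  rw [delta_sq hF hor ε L hL h.rot_ne_one h.2.1]
  obtain ⟨⟨r, hr⟩, -⟩ := h
  rw [show n / 2 = 2 * r + 1 by omega]
  exact Odd.neg_one_pow ⟨r, rfl⟩

omit [FiniteDimensional ℂ S] in
include hΓ hor hF hL in
-- The traces call for a fixed frequency and the theorem for a basis condition; this is the passage
-- between them.
theorem hasFixedDual_iff {γ : Γ} : HasFixedDual ε γ ↔ (∃ r, n = 4 * r + 3) ∧
    nFix (rot n (γ : Isom n)) = 1 ∧ ε.NegDelta (rot n (γ : Isom n)) := by
  constructor
  · intro h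
    obtain ⟨u, hu, hBu⟩ := h.2.2
    exact ⟨h.1, h.2.1, negDelta_of_fixed hΓ hF ε h.2.1 (h.delta_eq hor hF L hL) hu hBu⟩
  · exact fun h => ⟨h.1, h.2.1, h.2.2.exists_fixed hΓ hF ε (rot_rot hF γ)⟩

include hΓ hor hF hL hρ in
theorem HasFixedDual.mult_eq {γ : Γ} (h : HasFixedDual ε γ) {μ t : ℝ} (hμ : 0 < μ)
    (ht : |t| = 2 * Real.pi * μ) [Fintype (ε.dualSphere μ)] :
    (mult ε L ρ t : ℂ) = (2 ^ k)⁻¹ *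
      (Module.finrank ℂ V * (2 ^ (n / 2) / 2 * (ε.dualSphere μ).ncard) +
        chi ρ γ * orbitTrace ε L μ t γ) := by
  have ht0 : t ≠ 0 := by
    rintro rfl
    rw [abs_zero] at ht
    have : 0 < 2 * Real.pi * μ := by positivity
    linarith
  rw [← orbitTrace_one ε L hL ht0]
  refine mult_eq_of_unique hΓ hF ε L ρ hρ hμ.le ht h.rot_ne_one fun γ' hγ' hne => ?_
  rw [orbitTrace_eq_zero_of_not hor hF ε L hL hγ' hμ.ne' ht0, mul_zero]
  rintro ⟨-, h1', u', hu', hBu'⟩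
  obtain ⟨u, hu, hBu⟩ := h.2.2
  exact hne (rot_eq_of_fixed hF ε h.2.1 (h.delta_eq hor hF L hL) hu hBu h1' hu' hBu')

theorem norm_smul_generator {f : E n} (hf : f ≠ 0) (p : ℤ) :
    ‖((p : ℝ) / (2 * ‖f‖ ^ 2)) • f‖ = |(p : ℝ)| / 2 / ‖f‖ := by
  have : ‖f‖ ≠ 0 := norm_ne_zero_iff.2 hf
  rw [norm_smul, norm_div, Real.norm_eq_abs, Real.norm_of_nonneg (by positivity)]
  field_simp

theorem exists_abs_eq_of_odd {p : ℤ} (hp : Odd p) : ∃ j : ℕ, |(p : ℝ)| = 2 * j + 1 := by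
  obtain ⟨j, hj⟩ := Int.natAbs_odd.2 hp
  refine ⟨j, ?_⟩
  rw [← Int.cast_abs, Int.abs_eq_natAbs, hj]
  push_cast
  rfl

include hΓ hor hF hL hρ in
-- An exceptional trace needs a fixed frequency of norm μ, and these are odd multiples of f/(2‖f‖²).
theorem HasFixedDual.symmetricFormula {γ : Γ} (h : HasFixedDual ε γ) {f : E n}
    (hf : GeneratesFixed Γ (rot n (γ : Isom n)) f) {μ : ℝ} (hμ : 0 < μ)
    (hne : ∀ j : ℕ, μ ≠ (j + 1 / 2) / ‖f‖) : SymmetricFormula k ε L ρ μ := by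
  have := (ε.finite_dualSphere hΓ hF μ).fintype
  have hδ := h.delta_eq hor hF L hL
  obtain ⟨u, hu, hBu⟩ := h.2.2
  refine symmetricFormula_of_forall_eq_zero hΓ hF ε L hL ρ hρ hμ fun γ' hγ' t ht => ?_
  by_cases hfix : ∃ u' ∈ ε.dualSphere μ, rot n (γ' : Isom n) u' = u'
  · rw [orbitTrace_eq_zero_of_not hor hF ε L hL hγ' hμ.ne' ht, mul_zero]
    rintro ⟨-, h1', -⟩
    obtain ⟨u', hu', hBu'⟩ := hfix
    rw [rot_eq_of_fixed hF ε h.2.1 hδ hu hBu h1' hu'.1 hBu'] at hBu'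
    obtain ⟨p, hp, hpu⟩ := exists_eq_smul_generator hF ε h.2.1 hδ hf hu'.1 hBu'
    obtain ⟨j, hj⟩ := exists_abs_eq_of_odd hp
    refine hne j ?_
    rw [← hu'.2, hpu, norm_smul_generator (generator_ne_zero hF ε hδ hf), hj]
    ring
  · push Not at hfix
    rw [orbitTrace_eq_zero_of_forall ε L hfix, mul_zero]

include hor hF hL in
theorem HasFixedDual.orbitTrace_eq {γ : Γ} (h : HasFixedDual ε γ) {r : ℕ} (hn : n = 4 * r + 3)
    {f : E n} (hf : GeneratesFixed Γ (rot n (γ : Isom n)) f) {c : ℤ}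
    (hc : 2 * inner ℝ f (transPart (γ : Isom n)) = c * ‖f‖ ^ 2) {s : ℕ}
    (hs : |(c : ℝ)| = 2 * s + 1) (j : ℕ) {μ t : ℝ} (hμ : μ = (j + 1 / 2) / ‖f‖) (ht : t ≠ 0)
    [Fintype (ε.dualSphere μ)] :
    orbitTrace ε L μ t γ = (2 * Real.pi * μ / t) *
      (ε.sign γ ((2 * inner ℝ f (transPart (γ : Isom n))) • f) (eProd n (2 * (n / 2))) *
        (-1) ^ (r + j + s) * 2 ^ (n / 2)) := by
  have hδ := h.delta_eq hor hF L hL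
  have hf0 := generator_ne_zero hF ε hδ hf
  have hf1 : 0 < ‖f‖ := norm_pos_iff.2 hf0
  obtain ⟨u, hu, hBu⟩ := h.2.2
  -- Of the two fixed frequencies ±u of norm μ, q = ±(2j+1) with the sign of c selects the positive
  -- multiple of (f·2b)f, so that σ can be taken there.
  obtain ⟨q, hqo, hq0, hqc⟩ : ∃ q : ℤ, Odd q ∧ |(q : ℝ)| = 2 * j + 1 ∧
      (q : ℝ) * c = (2 * j + 1) * (2 * s + 1) := by
    have hj : |(2 * j + 1 : ℝ)| = 2 * j + 1 := abs_of_pos (by positivity)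
    rcases abs_choice (c : ℝ) with h | h <;> rw [h] at hs
    · exact ⟨2 * j + 1, ⟨j, rfl⟩, by push_cast; exact hj, by rw [hs]; push_cast; ring⟩
    · refine ⟨-(2 * j + 1), Odd.neg ⟨j, rfl⟩, by push_cast; rw [abs_neg]; exact hj, ?_⟩
      rw [← hs]; push_cast; ring
  have hsphere : ((q : ℝ) / (2 * ‖f‖ ^ 2)) • f ∈ ε.dualSphere μ := by
    refine ⟨smul_generator_mem_dualCoset hF ε h.2.1 hδ hf hu hBu hqo, ?_⟩
    rw [norm_smul_generator hf0, hq0, hμ]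
    ring
  have hμ0 : μ ≠ 0 := by rw [hμ]; positivity
  rw [orbitTrace_eq_sign hF hor ε L hL hn h.rot_ne_one h.2.1 hμ0 ht hsphere
    (by rw [map_smul, hf.mem.2])]
  have hsign : ε.sign γ (((q : ℝ) / (2 * ‖f‖ ^ 2)) • f) (eProd n (2 * (n / 2))) =
      ε.sign γ ((2 * inner ℝ f (transPart (γ : Isom n))) • f) (eProd n (2 * (n / 2))) := by
    have hc0 : (c : ℝ) ≠ 0 := by
      intro h0
      rw [h0, abs_zero] at hs
      have : (0 : ℝ) < 2 * s + 1 := by positivity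
      linarith
    rw [← ε.sign_smul_of_pos γ ((2 * inner ℝ f (transPart (γ : Isom n))) • f) _
      (c := (q * c) / (2 * ‖f‖ ^ 4 * c ^ 2)) (by rw [hqc]; positivity), smul_smul, hc]
    congr 2
    field_simp
  have hexp : expChar (((q : ℝ) / (2 * ‖f‖ ^ 2)) • f) (transPart (γ : Isom n)) =
      (-1) ^ (j + s) * Complex.I := by
    have h2 : inner ℝ (((q : ℝ) / (2 * ‖f‖ ^ 2)) • f) (transPart (γ : Isom n)) =
        (2 * j + 1) * (2 * s + 1) / 4 := by
      rw [real_inner_smul_left, ← hqc]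
      field_simp
      linear_combination 2 * q * hc
    -- Here (2j+1)(2s+1)/2 = 2js + (j+s) + ½: the last term gives i and j + s the sign.
    have h3 : (2 * Real.pi * Complex.I * (((2 * j + 1) * (2 * s + 1) / 4 : ℝ) : ℂ)) =
        ((2 * (j * s) + (j + s) : ℕ) : ℂ) * (Real.pi * Complex.I) + Real.pi / 2 * Complex.I := by
      push_cast
      ring
    rw [expChar, h2, h3, Complex.exp_add, Complex.exp_nat_mul, Complex.exp_pi_mul_I,
      Complex.exp_pi_div_two_mul_I, pow_add, pow_mul, neg_one_sq, one_pow, one_mul]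
  rw [hsign, hexp]
  linear_combination (-(2 * Real.pi * μ / t) *
    ε.sign γ ((2 * inner ℝ f (transPart (γ : Isom n))) • f) (eProd n (2 * (n / 2))) *
      (-1) ^ (r + (j + s)) * 2 ^ (n / 2) : ℂ) * Complex.I_sq

include hΓ hor hF hL hρ in
theorem HasFixedDual.mult_eq_of_generator {γ : Γ} (h : HasFixedDual ε γ) {r : ℕ}
    (hn : n = 4 * r + 3) {f : E n} (hf : GeneratesFixed Γ (rot n (γ : Isom n)) f) {c : ℤ}
    (hc : 2 * inner ℝ f (transPart (γ : Isom n)) = c * ‖f‖ ^ 2) {s : ℕ}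
    (hs : |(c : ℝ)| = 2 * s + 1) (j : ℕ) {μ : ℝ} (hμ : μ = (j + 1 / 2) / ‖f‖) :
    (mult ε L ρ (2 * Real.pi * μ) : ℂ) =
      (2 : ℂ) ^ ((n / 2 : ℕ) - k - 1 : ℤ) *
        (Module.finrank ℂ V * (ε.dualSphere μ).ncard +
          2 * ε.sign γ ((2 * inner ℝ f (transPart (γ : Isom n))) • f) (eProd n (2 * (n / 2))) *
            (-1) ^ (r + j + s) * chi ρ γ) ∧
    (mult ε L ρ (-(2 * Real.pi * μ)) : ℂ) =
      (2 : ℂ) ^ ((n / 2 : ℕ) - k - 1 : ℤ) *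
        (Module.finrank ℂ V * (ε.dualSphere μ).ncard -
          2 * ε.sign γ ((2 * inner ℝ f (transPart (γ : Isom n))) • f) (eProd n (2 * (n / 2))) *
            (-1) ^ (r + j + s) * chi ρ γ) := by
  have := (ε.finite_dualSphere hΓ hF μ).fintype
  have hf1 : 0 < ‖f‖ := norm_pos_iff.2 (generator_ne_zero hF ε (h.delta_eq hor hF L hL) hf)
  have hμ0 : 0 < μ := by rw [hμ]; positivity
  have ht0 : 0 < 2 * Real.pi * μ := by positivity
  have htc : (2 * Real.pi * μ : ℂ) ≠ 0 := by exact_mod_cast ht0.ne'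
  rw [h.mult_eq hΓ hor hF L hL ρ hρ hμ0 (abs_of_pos ht0),
    h.mult_eq hΓ hor hF L hL ρ hρ hμ0 (t := -(2 * Real.pi * μ)) (by rw [abs_neg, abs_of_pos ht0]),
    h.orbitTrace_eq hor hF L hL hn hf hc hs j hμ ht0.ne',
    h.orbitTrace_eq hor hF L hL hn hf hc hs j hμ (neg_ne_zero.2 ht0.ne'), two_zpow_sub_sub]
  push_cast
  rw [div_neg, div_self htc]
  constructor <;> ring

include hΓ hor hF hL hρ in
-- At 2πμ_j the two multiplicities differ by a nonzero multiple of χ_ρ(γ); at all other values they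
-- agree.
theorem HasFixedDual.asymSpectrum_eq {γ : Γ} (h : HasFixedDual ε γ) (hχ : chi ρ γ ≠ 0)
    {f : E n} (hf : GeneratesFixed Γ (rot n (γ : Isom n)) f) :
    asymSpectrum ε L ρ = {t | ∃ j : ℕ, t = 2 * Real.pi * ((j + 1 / 2) / ‖f‖) ∨
      t = -(2 * Real.pi * ((j + 1 / 2) / ‖f‖))} := by
  obtain ⟨r, hn⟩ := h.1
  obtain ⟨-, c, hco, hc⟩ := delta_generator hF ε (h.delta_eq hor hF L hL) hf
  obtain ⟨s, hs⟩ := exists_abs_eq_of_odd hco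
  have hne : ∀ j : ℕ, mult ε L ρ (2 * Real.pi * ((j + 1 / 2) / ‖f‖)) ≠
      mult ε L ρ (-(2 * Real.pi * ((j + 1 / 2) / ‖f‖))) := by
    intro j heq
    obtain ⟨h1, h2⟩ := h.mult_eq_of_generator hΓ hor hF L hL ρ hρ hn hf hc hs j rfl
    rw [heq, h2] at h1
    have h3 := mul_left_cancel₀ (zpow_ne_zero _ two_ne_zero) h1
    have h4 : (ε.sign γ ((2 * inner ℝ f (transPart (γ : Isom n))) • f)
        (eProd n (2 * (n / 2))) : ℂ) ≠ 0 := by exact_mod_cast ε.sign_ne_zero γ _ _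
    have h5 : ((-1 : ℂ) ^ (r + j + s)) ≠ 0 := pow_ne_zero _ (by norm_num)
    refine mul_ne_zero (mul_ne_zero h4 h5) hχ ?_
    linear_combination (-1 / 4 : ℂ) * h3
  refine Set.Subset.antisymm (fun t ht => ?_) ?_
  · by_contra hcon
    have key : ∀ t : ℝ, 0 < t → (∀ j : ℕ, t ≠ 2 * Real.pi * ((j + 1 / 2) / ‖f‖)) →
        mult ε L ρ t = mult ε L ρ (-t) := by
      intro t ht hj
      obtain ⟨h1, h2⟩ := h.symmetricFormula hΓ hor hF L hL ρ hρ hf (μ := t / (2 * Real.pi))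
        (by positivity) fun j h => hj j (by rw [← h, mul_div_cancel₀ _ (by positivity)])
      rw [mul_div_cancel₀ _ (by positivity)] at h1 h2
      exact_mod_cast h1.trans h2.symm
    rcases lt_trichotomy t 0 with h0 | rfl | h0
    · have := key (-t) (by linarith) fun j hj => hcon ⟨j, Or.inr (by rw [← hj, neg_neg])⟩
      rw [neg_neg] at this
      exact ht this.symm
    · exact ht (by rw [neg_zero])
    · exact ht (key t h0 fun j hj => hcon ⟨j, Or.inl hj⟩)
  · rintro _ ⟨j, rfl | rfl⟩
    · exact hne j
    · change mult ε L ρ _ ≠ mult ε L ρ _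
      rw [neg_neg]
      exact (hne j).symm

/-! ### Harmonic spinors -/

variable (ε)

theorem dualSphere_zero_of_trivialType (h : ε.TrivialType) : ε.dualSphere 0 = {0} := by
  ext u
  refine ⟨fun hu => norm_eq_zero.1 hu.2, ?_⟩
  rintro rfl
  refine ⟨ε.mem_dualCoset.2 fun v => ?_, norm_zero⟩
  rw [ε.trivialType_iff.1 h, expChar_zero_left, Int.cast_one]

theorem dualSphere_zero_of_not_trivialType (h : ¬ ε.TrivialType) : ε.dualSphere 0 = ∅ := by
  refine Set.eq_empty_iff_forall_notMem.2 fun u hu => h (ε.trivialType_iff.2 fun v => ?_)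
  have h1 := ε.mem_dualCoset.1 hu.1 v
  rw [norm_eq_zero.1 hu.2, expChar_zero_left] at h1
  exact_mod_cast h1.symm

include hL in
theorem orbitTrace_one_zero [Fintype (ε.dualSphere 0)] :
    orbitTrace ε L 0 0 1 = 2 ^ (n / 2) * (ε.dualSphere 0).ncard := by
  have h0 : transPart (1 : Isom n) = 0 := by
    rw [transPart, map_one]; rfl
  have h5 : orbitTrace ε L 0 0 1 = ∑ u : ε.dualSphere 0, (2 : ℂ) ^ (n / 2) := by
    refine Finset.sum_congr rfl fun u _ => ?_
    rw [if_pos (by rfl), spinProj, if_pos rfl]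
    simp [h0, hL.finrank_eq]
  rw [h5, Finset.sum_const, Finset.card_univ, ← Nat.card_eq_fintype_card, Nat.card_coe_set_eq,
    nsmul_eq_mul, mul_comm]

include hF in
omit [FiniteDimensional ℂ S] in
theorem orbitTrace_zero_eq_zero [Fintype (ε.dualSphere 0)] {γ : Γ}
    (hγ : rot n (γ : Isom n) ≠ 1) : orbitTrace ε L 0 0 γ = 0 := by
  refine Finset.sum_eq_zero fun u _ => ?_
  split_ifs
  · rw [spinProj, if_pos rfl, mul_one, trace_L_hom_eq_zero hF ε L hγ, mul_zero]
  · rfl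

include hΓ hF hL hρ in
-- Only u = 0 has norm 0, and there P is the identity, so the traces of all B ≠ Id vanish.
theorem mult_zero_eq : (mult ε L ρ 0 : ℂ) =
    (2 ^ k)⁻¹ * (Module.finrank ℂ V * (2 ^ (n / 2) * (ε.dualSphere 0).ncard)) := by
  have := (ε.finite_dualSphere hΓ hF 0).fintype
  rw [mult_eq_of_forall_eq_zero hΓ hF ε L ρ hρ le_rfl (by simp) fun γ hγ => by
    rw [orbitTrace_zero_eq_zero hF ε L hγ, mul_zero], orbitTrace_one_zero ε L hL]

include hΓ hF hL hρ in
theorem mult_zero_of_trivialType (h : ε.TrivialType) :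
    (mult ε L ρ 0 : ℝ) * 2 ^ k = 2 ^ (n / 2) * Module.finrank ℂ V := by
  have h1 := mult_zero_eq hΓ hF ε L hL ρ hρ
  rw [dualSphere_zero_of_trivialType ε h, Set.ncard_singleton] at h1
  apply Complex.ofReal_injective
  push_cast
  rw [h1]
  push_cast
  field_simp

include hΓ hF hL hρ in
theorem mult_zero_of_not_trivialType (h : ¬ ε.TrivialType) : mult ε L ρ 0 = 0 := by
  have h1 := mult_zero_eq hΓ hF ε L hL ρ hρ
  rw [dualSphere_zero_of_not_trivialType ε h, Set.ncard_empty] at h1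
  simpa using h1

include hΓ hF hL in
-- For the trivial one-dimensional ρ the multiplicity d of 0 is an integer with d·2^k = 2^m.
theorem not_trivialType_of_lt (hk : n / 2 < k) : ¬ ε.TrivialType := by
  intro h
  have h1 := mult_zero_of_trivialType hΓ hF ε L hL (1 : Γ →* (ℂ ≃ₗᵢ[ℂ] ℂ)) (fun _ => rfl) h
  rw [Module.finrank_self, Nat.cast_one, mul_one] at h1
  have h2 : mult ε L (1 : Γ →* (ℂ ≃ₗᵢ[ℂ] ℂ)) 0 * 2 ^ k = 2 ^ (n / 2) := by exact_mod_cast h1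
  have h3 : 2 ^ k ∣ 2 ^ (n / 2) := Dvd.intro_left _ h2
  exact absurd ((Nat.pow_dvd_pow_iff_le_right (by norm_num)).1 h3) (by omega)

include hΓ hF hL hρ in
-- Positivity forces ε to be trivial on Λ; comparing multiplicities then gives 2^k = 1, so F is
-- trivial.
theorem translations_of_mult_zero_eq (hV : 0 < Module.finrank ℂ V)
    (h : mult ε L ρ 0 = 2 ^ (n / 2) * Module.finrank ℂ V) :
    (∀ γ ∈ Γ, ∃ v ∈ lattice Γ, γ = transl v) ∧ ∀ γ : Γ, ε.hom γ = 1 := by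
  have hpos : 0 < 2 ^ (n / 2) * Module.finrank ℂ V := by positivity
  have htriv : ε.TrivialType := by
    by_contra hcon
    rw [mult_zero_of_not_trivialType hΓ hF ε L hL ρ hρ hcon] at h
    omega
  have h1 : mult ε L ρ 0 * 2 ^ k = 2 ^ (n / 2) * Module.finrank ℂ V := by
    exact_mod_cast mult_zero_of_trivialType hΓ hF ε L hL ρ hρ htriv
  rw [← h] at h1 hpos
  have h2 : 2 ^ k = 1 := Nat.eq_of_mul_eq_mul_left hpos (by rw [h1, mul_one])
  have h3 := card_holonomy hF
  rw [h2, Subgroup.card_eq_one] at h3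
  have h4 : ∀ γ ∈ Γ, ∃ v ∈ lattice Γ, γ = transl v := by
    intro γ hγ
    have h5 : rot n γ ∈ holonomy Γ := ⟨γ, hγ, rfl⟩
    rw [h3, Subgroup.mem_bot] at h5
    have h6 := eq_transl_of_rot_eq_one h5
    refine ⟨transPart γ, ?_, h6⟩
    change transl _ ∈ Γ
    rwa [← h6]
  refine ⟨h4, fun γ => ?_⟩
  obtain ⟨v, hv, h5⟩ := h4 γ γ.2
  have h6 : γ = latticeElt ⟨v, hv⟩ := Subtype.ext h5
  rw [h6]
  exact htriv _

end Spectrum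

end FlatSpin

end

/-! ### Assembly of the theorem -/

open FlatSpin in
theorem theorem3p2 {n k : ℕ} (Γ : Subgroup (Isom n)) (hΓ : IsBieberbach Γ) (hor : IsOriented Γ)
    (hF : Nonempty (holonomy Γ ≃* Multiplicative (Fin k → ZMod 2)))
    (ε : SpinStructure Γ)
    {S : Type*} [NormedAddCommGroup S] [InnerProductSpace ℂ S] [FiniteDimensional ℂ S]
    (L : Cl n →ₐ[ℝ] Module.End ℂ S) (hL : IsSpinRep L)
    {V : Type*} [NormedAddCommGroup V] [InnerProductSpace ℂ V] [FiniteDimensional ℂ V]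
    (ρ : Γ →* (V ≃ₗᵢ[ℂ] V)) (hρ : TrivialOnLattice ρ) :
    -- all multiplicities are finite
    (∀ t : ℝ, FiniteDimensional ℂ (eigenspace ε L ρ t)) ∧
    -- (i)
    (F₁ Γ = ∅ → SymmetricSpectrum ε L ρ ∧ ∀ μ : ℝ, 0 < μ → SymmetricFormula k ε L ρ μ) ∧
    -- (ii)
    ((F₁ Γ).Nonempty →
      (¬ SymmetricSpectrum ε L ρ ↔
        (∃ r : ℕ, n = 4 * r + 3) ∧ ∃ γ : Γ, IsAsymmetryElement ε ρ γ) ∧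
      (∀ r : ℕ, n = 4 * r + 3 → ∀ γ : Γ, IsAsymmetryElement ε ρ γ →
        (∃ f : E n, GeneratesFixed Γ (rot n (γ : Isom n)) f) ∧
        ∀ f : E n, GeneratesFixed Γ (rot n (γ : Isom n)) f →
          f ≠ 0 ∧
          asymSpectrum ε L ρ =
            {t | ∃ j : ℕ, t = 2 * Real.pi * ((j + 1 / 2) / ‖f‖) ∨
              t = -(2 * Real.pi * ((j + 1 / 2) / ‖f‖))} ∧
          (∃ s : ℕ, |2 * inner ℝ f (transPart (γ : Isom n))| = (2 * s + 1) * ‖f‖ ^ 2 ∧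
            ∀ (j : ℕ) (μ : ℝ), μ = (j + 1 / 2) / ‖f‖ →
              (mult ε L ρ (2 * Real.pi * μ) : ℂ) =
                (2 : ℂ) ^ ((n / 2 : ℕ) - k - 1 : ℤ) *
                  (Module.finrank ℂ V * (ε.dualSphere μ).ncard +
                    2 * ε.sign γ ((2 * inner ℝ f (transPart (γ : Isom n))) • f)
                        (eProd n (2 * (n / 2))) *
                      (-1) ^ (r + j + s) * chi ρ γ) ∧
              (mult ε L ρ (-(2 * Real.pi * μ)) : ℂ) =
                (2 : ℂ) ^ ((n / 2 : ℕ) - k - 1 : ℤ) *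
                  (Module.finrank ℂ V * (ε.dualSphere μ).ncard -
                    2 * ε.sign γ ((2 * inner ℝ f (transPart (γ : Isom n))) • f)
                        (eProd n (2 * (n / 2))) *
                      (-1) ^ (r + j + s) * chi ρ γ)) ∧
          ∀ μ : ℝ, 0 < μ → (∀ j : ℕ, μ ≠ (j + 1 / 2) / ‖f‖) → SymmetricFormula k ε L ρ μ) ∧
      (SymmetricSpectrum ε L ρ → ∀ μ : ℝ, 0 < μ → SymmetricFormula k ε L ρ μ)) ∧
    -- (iii)
    (ε.TrivialType →
      (mult ε L ρ 0 : ℝ) = (2 : ℝ) ^ ((n / 2 : ℕ) - k : ℤ) * Module.finrank ℂ V) ∧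
    (¬ ε.TrivialType → mult ε L ρ 0 = 0) ∧
    (n / 2 < k → (∀ ε' : SpinStructure Γ, ¬ ε'.TrivialType) ∧ mult ε L ρ 0 = 0) ∧
    (0 < Module.finrank ℂ V → mult ε L ρ 0 = 2 ^ (n / 2) * Module.finrank ℂ V →
      (∀ γ ∈ Γ, ∃ v ∈ lattice Γ, γ = transl v) ∧ ∀ γ : Γ, ε.hom γ = 1) := by
  have hsym : ∀ {μ : ℝ}, 0 < μ → (∀ γ, HasFixedDual ε γ → chi ρ γ = 0) →
      SymmetricFormula k ε L ρ μ :=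
    fun hμ h => symmetricFormula_of_forall_chi_eq_zero hΓ hor hF ε L hL ρ hρ h hμ
  have hasym : ∀ γ, HasFixedDual ε γ → chi ρ γ ≠ 0 → ¬ SymmetricSpectrum ε L ρ := by
    intro γ h hχ h0
    obtain ⟨u, hu, hBu⟩ := h.2.2
    obtain ⟨f, hf⟩ := exists_generatesFixed ε h.2.1
      (ne_zero_of_mem_dualCoset hF ε (h.delta_eq hor hF L hL) hu) hu hBu
    rw [SymmetricSpectrum, h.asymSpectrum_eq hΓ hor hF L hL ρ hρ hχ hf] at h0
    -- The point with j = 0 shows that the asymmetric spectrum is not empty.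
    exact Set.eq_empty_iff_forall_notMem.1 h0 _ ⟨0, Or.inl rfl⟩
  refine ⟨finiteDimensional_eigenspace hΓ hF ε L ρ hρ, fun h => ?_, fun _ => ⟨⟨fun h => ?_, ?_⟩,
    fun r hn γ hγ => ?_, fun h μ hμ => hsym hμ fun γ hγ => ?_⟩, fun h => ?_,
    mult_zero_of_not_trivialType hΓ hF ε L hL ρ hρ,
    fun hk => ⟨fun ε' => not_trivialType_of_lt hΓ hF ε' L hL hk,
      mult_zero_of_not_trivialType hΓ hF ε L hL ρ hρ (not_trivialType_of_lt hΓ hF ε L hL hk)⟩,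
    translations_of_mult_zero_eq hΓ hF ε L hL ρ hρ⟩
  · have h1 : ∀ γ, HasFixedDual ε γ → chi ρ γ = 0 := fun γ hγ =>
      (Set.eq_empty_iff_forall_notMem.1 h _ ⟨rot_mem_holonomy γ, hγ.2.1⟩).elim
    exact ⟨symmetricSpectrum_of_forall (k := k) ε L ρ fun μ hμ => hsym hμ h1,
      fun μ hμ => hsym hμ h1⟩
  · by_contra hcon
    refine h (symmetricSpectrum_of_forall (k := k) ε L ρ fun μ hμ => hsym hμ fun γ hγ => ?_)
    by_contra hχ
    obtain ⟨hn, h1, hδ⟩ := (hasFixedDual_iff hΓ hor hF L hL).1 hγ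
    exact hcon ⟨hn, γ, h1, hχ, hδ⟩
  · rintro ⟨hn, γ, h1, hχ, hδ⟩
    exact hasym γ ((hasFixedDual_iff hΓ hor hF L hL).2 ⟨hn, h1, hδ⟩) hχ
  · obtain ⟨h1, hχ, hδ⟩ := hγ
    have hγ := (hasFixedDual_iff hΓ hor hF L hL).2 ⟨⟨r, hn⟩, h1, hδ⟩
    have hδ' := hγ.delta_eq hor hF L hL
    obtain ⟨u, hu, hBu⟩ := hγ.2.2
    refine ⟨exists_generatesFixed ε h1 (ne_zero_of_mem_dualCoset hF ε hδ' hu) hu hBu,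
      fun f hf => ⟨generator_ne_zero hF ε hδ' hf, hγ.asymSpectrum_eq hΓ hor hF L hL ρ hρ hχ hf, ?_,
        fun μ hμ => hγ.symmetricFormula hΓ hor hF L hL ρ hρ hf hμ⟩⟩
    obtain ⟨-, c, hco, hc⟩ := delta_generator hF ε hδ' hf
    obtain ⟨s, hs⟩ := exists_abs_eq_of_odd hco
    refine ⟨s, ?_, fun j μ hμ => hγ.mult_eq_of_generator hΓ hor hF L hL ρ hρ hn hf hc hs j hμ⟩
    rw [hc, abs_mul, hs, abs_of_nonneg (sq_nonneg _)]
  · by_contra hχ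
    exact hasym γ hγ hχ h
  · have h1 := mult_zero_of_trivialType hΓ hF ε L hL ρ hρ h
    rw [zpow_sub₀ two_ne_zero, zpow_natCast, zpow_natCast, div_mul_eq_mul_div, ← h1,
      mul_div_cancel_right₀ _ (by positivity)]
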